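/- Let $N\ge 1$ and $\sigma\in\mathbb R\setminus\{0\}$. For $k\ge 1$ let $$H^k_{\sin}(\mathbb R^N)=\{v\in L^1_{\rm loc}(\mathbb R^N):\ \nabla v\in H^{k-1}(\mathbb R^N),\ \sin(v)\in L^2(\mathbb R^N)\},\quad d^k_{\sin}(v,w)=\big(\|\sin(v-w)\|_{L^2}^2+\|\nabla v-\nabla w\|_{H^{k-1}}^2\big)^{1/2},$$ all functions being real-valued. For an interval $I\ni 0$, a solution of class $k$ on $I$ with initial conditions $(\phi^0,\phi^1)$ is a function $\phi\in\mathcal C^0(I,\phi^0+H^k(\mathbb R^N))$ with $\partial_t\phi\in\mathcal C^0(I,H^{k-1}(\mathbb R^N))$, which satisfies the Sine-Gordon equation $$\partial_{tt}\phi-\Delta\phi+\tfrac{\sigma}{2}\sin(2\phi)=0$$ in the sense of distributions, and $\phi(\cdot,0)=\phi^0$, $\partial_t\phi(\cdot,0)=\phi^1$. Let $T^k_{\max}=T^k_{\max}(\phi^0,\phi^1)\in[0,\infty]$ be the supremum of the times $T$ for which there is a solution of class $k$ on $[0,T)$. Let $k\in\mathbb N$ with $k>N/2+1$, and let $(\phi^0,\phi^1)\in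 H^k_{\sin}(\mathbb R^N)\times H^{k-1}(\mathbb R^N)$. Then $T^k_{\max}>0$, there is a solution $\phi$ of class $k$ on $[0,T^k_{\max})$, and two solutions of class $k$ on the same interval $[0,T)$ with these initial conditions are equal. Moreover: (i) The maximal time is characterized by blow-up. If $\phi$ is a solution of class $k$ on $[0,T)$ with $0<T\le\infty$, then each of the following two conditions is equivalent to $T=T^k_{\max}$: $$\lim_{t\to T}\big(d^k_{\sin}(\phi(\cdot,t),0)+\|\partial_t\phi(\cdot,t)\|_{H^{k-1}}\big)=\infty\ \text{ if } T<\infty;\qquad \limsup_{t\to T}d^k_{\sin}(\phi(\cdot,t),0)=\infty\ \text{ if } T<\infty.$$ (ii) For $0\le T<T^k_{\max}$ there are positive numbers $R$ and $A$ such that, for all $(\tilde\phi^0,\tilde\phi^1)\in H^k_{\sin}\times H^{k-1}$ with $d^k_{\sin}(\phi^0,\tilde\phi^0)+\|\phi^1-\tilde\phi^1\|_{H^{k-1}}<R$, one has $T<T^k_{\max}(\tilde\phi^0,\tilde\phi^1)$, and the corresponding solution $\tilde\phi$ satisfies $$d^k_{\sin}(\phi(\cdot,t),\tilde\phi(\cdot,t))+\|\partial_t\phi(\cdot,t)-\partial_t\tilde\phi(\cdot,t)\|_{H^{k-1}}\le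 A\big(d^k_{\sin}(\phi^0,\tilde\phi^0)+\|\phi^1-\tilde\phi^1\|_{H^{k-1}}\big)\quad\text{for } t\in[0,T].$$ Given $\sigma$, $k$ and $N$, the numbers $R$ and $A$ can be chosen to depend only on $T$ and on an upper bound of $d^k_{\sin}(\phi(\cdot,t),0)+\|\partial_t\phi(\cdot,t)\|_{H^{k-1}}$ for $t\in[0,T]$. Given upper bounds $D$ of $d^k_{\sin}(\phi^0,0)$ and $M$ of $\|\phi^1\|_{H^{k-1}}$, there is $\tau>0$, depending only on $D$ and $M$, such that $T^k_{\max}>\tau$ and, for $T\le\tau$, the numbers $R$ and $A$ can be chosen to depend only on $D$ and $M$. When $N\le 3$, they can be chosen to depend only on $T$, $D$ and $M$, for any $T\ge0$. (iii) If $\phi^0\in H^{k+1}_{\sin}(\mathbb R^N)$ and $\phi^1\in H^k(\mathbb R^N)$, then $\phi\in\mathcal C^0([0,T^k_{\max}),\phi^0+H^{k+1})$, $\partial_t\phi\in\mathcal C^0([0,T^k_{\max}),H^k)$ and $\partial_{tt}\phi\in\mathcal C^0([0,T^k_{\max}),H^{k-1})$; in particular $T^{k+1}_{\max}=T^k_{\max}$.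 (iv) If $1\le N\le3$, then $T^k_{\max}=\infty$. Moreover, if $N\in\{2,3\}$, the flow is also well-defined and continuous for $k=2$: for all $(\phi^0,\phi^1)\in H^2_{\sin}\times H^1$ there is a unique solution $\phi$ of class $2$ on $\mathbb R$, and if $(\phi^0_n,\phi^1_n)\in H^2_{\sin}\times H^1$ satisfy $d^2_{\sin}(\phi^0_n,\phi^0)+\|\phi^1_n-\phi^1\|_{H^1}\to0$, then the corresponding solutions satisfy, for any $T>0$, $$\sup_{t\in[-T,T]}\big(d^2_{\sin}(\phi_n(\cdot,t),\phi(\cdot,t))+\|\partial_t\phi_n(\cdot,t)-\partial_t\phi(\cdot,t)\|_{H^1}\big)\to0.$$ -/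

import Mathlib

open MeasureTheory Filter Topology Set
open scoped ENNReal ContDiff

noncomputable section

namespace SineGordon

/-- The space `ℝ^N`. -/
abbrev Space (N : ℕ) : Type := EuclideanSpace ℝ (Fin N)

variable {N : ℕ}

/-- Smooth compactly supported real functions on `ℝ^N`. -/
def IsTest (χ : Space N → ℝ) : Prop := ContDiff ℝ ∞ χ ∧ HasCompactSupport χ

/-- The classical partial derivative `∂_{α 0} ⋯ ∂_{α (m - 1)} χ` of order `m`. -/
def partialD {m : ℕ} (α : Fin m → Fin N) (χ : Space N → ℝ) (x : Space N) : ℝ :=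
  iteratedFDeriv ℝ m χ x fun j => EuclideanSpace.single (α j) (1 : ℝ)

/-- `g` is the weak partial derivative `∂_{α 0} ⋯ ∂_{α (m - 1)} v`. -/
def IsWeakDeriv {m : ℕ} (α : Fin m → Fin N) (v g : Space N → ℝ) : Prop :=
  LocallyIntegrable v volume ∧ LocallyIntegrable g volume ∧
    ∀ χ : Space N → ℝ, IsTest χ →
      ∫ x, v x * partialD α χ x = (-1) ^ m * ∫ x, g x * χ x

/-- The `L²` norm of the weak derivative of `v` along `α`. The weak derivative is unique almost
everywhere, so that the infimum is over a single value; it is `∞` if there is no weak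
derivative. -/
def weakDerivNorm {m : ℕ} (α : Fin m → Fin N) (v : Space N → ℝ) : ℝ≥0∞ :=
  ⨅ (g : Space N → ℝ) (_ : IsWeakDeriv α v g), eLpNorm g 2 volume

/-- `∑ ‖∂^α v‖_{L²}²` over all partial derivatives of order `m`, that is `‖D^m v‖_{L²}²`. -/
def orderNormSq (m : ℕ) (v : Space N → ℝ) : ℝ≥0∞ :=
  ∑ α : Fin m → Fin N, weakDerivNorm α v ^ 2

/-- Membership in the Sobolev space `H^k(ℝ^N)` (real-valued functions). -/
def MemH (k : ℕ) (v : Space N → ℝ) : Prop :=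
  ∀ m ≤ k, ∀ α : Fin m → Fin N, ∃ g, IsWeakDeriv α v g ∧ MemLp g 2 volume

/-- The norm of `H^k(ℝ^N)`: `‖v‖_{H^k}² = ∑_{0 ≤ m ≤ k} ‖D^m v‖_{L²}²`. -/
def hNorm (k : ℕ) (v : Space N → ℝ) : ℝ≥0∞ :=
  (∑ m ∈ Finset.range (k + 1), orderNormSq m v) ^ (1 / 2 : ℝ)

/-- Membership in `H_sin^k(ℝ^N)`: `v ∈ L¹_loc`, `∇v ∈ H^{k-1}` and `sin v ∈ L²`. The condition on
`∇v` says that all weak derivatives of `v` of orders `1, …, k` are in `L²`. -/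
def MemHsin (k : ℕ) (v : Space N → ℝ) : Prop :=
  LocallyIntegrable v volume ∧
    (∀ m, 1 ≤ m → m ≤ k → ∀ α : Fin m → Fin N, ∃ g, IsWeakDeriv α v g ∧ MemLp g 2 volume) ∧
    MemLp (fun x => Real.sin (v x)) 2 volume

/-- The pseudodistance
`d_sin^k(v, w) = (‖sin (v - w)‖_{L²}² + ‖∇v - ∇w‖_{H^{k-1}}²)^{1/2}`. -/
def dsin (k : ℕ) (v w : Space N → ℝ) : ℝ≥0∞ :=
  (eLpNorm (fun x => Real.sin (v x - w x)) 2 volume ^ 2 +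
    ∑ m ∈ Finset.Icc 1 k, orderNormSq m (v - w)) ^ (1 / 2 : ℝ)

/-- `f ∈ C⁰(I, v₀ + H^k(ℝ^N))`. -/
def ContInH (k : ℕ) (I : Set ℝ) (v₀ : Space N → ℝ) (f : ℝ → Space N → ℝ) : Prop :=
  (∀ t ∈ I, MemH k (f t - v₀)) ∧
    ∀ t ∈ I, Tendsto (fun s => hNorm k (f s - f t)) (𝓝[I] t) (𝓝 0)

/-- `g` is the time derivative of `f` on `I`, for the norm of `H^k(ℝ^N)`. -/
def HasTimeDeriv (k : ℕ) (I : Set ℝ) (f g : ℝ → Space N → ℝ) : Prop :=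
  ∀ t ∈ I, Tendsto (fun s => hNorm k ((s - t)⁻¹ • (f s - f t) - g t)) (𝓝[I \ {t}] t) (𝓝 0)

/-- `φ ∈ C⁰(I, φ₀ + H^k)`, with `ψ = ∂_t φ ∈ C⁰(I, H^{k-1})`, is a solution on the interval `I` of
`∂_tt φ - Δφ + (σ/2) sin (2φ) = 0` with `φ(0) = φ₀` and `∂_t φ(0) = φ₁`. The equation holds in the
sense of distributions: for any test function `χ` on `ℝ^N`,
`d/dt ∫ ∂_t φ(t) χ = ∫ φ(t) Δχ - (σ/2) ∫ sin (2φ(t)) χ` on `I`. -/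
structure IsSolution (σ : ℝ) (k : ℕ) (I : Set ℝ) (φ₀ φ₁ : Space N → ℝ)
    (φ ψ : ℝ → Space N → ℝ) : Prop where
  contInH : ContInH k I φ₀ φ
  contInH_deriv : ContInH (k - 1) I 0 ψ
  hasTimeDeriv : HasTimeDeriv (k - 1) I φ ψ
  equation : ∀ χ : Space N → ℝ, IsTest χ → ∀ t ∈ I,
    HasDerivWithinAt (fun s => ∫ x, ψ s x * χ x)
      ((∫ x, φ t x * Laplacian.laplacian χ x) - σ / 2 * ∫ x, Real.sin (2 * φ t x) * χ x) I t
  initial : φ 0 =ᵐ[volume] φ₀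
  initial_deriv : ψ 0 =ᵐ[volume] φ₁

/-- The time interval `[0, T)`, with `T ∈ [0, ∞]`. -/
def timeIco (T : ℝ≥0∞) : Set ℝ := {t : ℝ | 0 ≤ t ∧ ENNReal.ofReal t < T}

/-- The maximal time of existence `T_max^k ∈ [0, ∞]` for the initial conditions `(φ₀, φ₁)`: the
supremum of all `T` such that there is a solution on `[0, T)`. -/
def maxTime (σ : ℝ) (k : ℕ) (φ₀ φ₁ : Space N → ℝ) : ℝ≥0∞ :=
  sSup {T : ℝ≥0∞ | ∃ φ ψ : ℝ → Space N → ℝ, IsSolution σ k (timeIco T) φ₀ φ₁ φ ψ}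

/-- The flow is well-defined up to the time `T` on the ball of centre `(φ₀, φ₁)` and radius `R` of
`H_sin^k × H^{k-1}`, and it satisfies there the Lipschitz estimate with constant `A`. -/
def FlowLipschitz (σ : ℝ) (k : ℕ) (T R A : ℝ) (φ₀ φ₁ : Space N → ℝ) : Prop :=
  ∀ φ₀' φ₁' : Space N → ℝ, MemHsin k φ₀' → MemH (k - 1) φ₁' →
    dsin k φ₀ φ₀' + hNorm (k - 1) (φ₁ - φ₁') < ENNReal.ofReal R →
    ENNReal.ofReal T < maxTime σ k φ₀' φ₁' ∧
    ∀ φ ψ φ' ψ' : ℝ → Space N → ℝ,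
      IsSolution σ k (timeIco (maxTime σ k φ₀ φ₁)) φ₀ φ₁ φ ψ →
      IsSolution σ k (timeIco (maxTime σ k φ₀' φ₁')) φ₀' φ₁' φ' ψ' →
      ∀ t ∈ Icc 0 T,
        dsin k (φ t) (φ' t) + hNorm (k - 1) (ψ t - ψ' t) ≤
          ENNReal.ofReal A * (dsin k φ₀ φ₀' + hNorm (k - 1) (φ₁ - φ₁'))

end SineGordon

end

open SineGordon

/-! Write `Λ = (1 - Δ)^{1/2}`. A function `v` of `H^s` is stored as the element `y` of `L²` with `v
= Λ^{-s} y` (`Rep`, `bes`), so that derivatives (`rie`) and the group `e^{itΛ}` (`kg`) are bounded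
Fourier multipliers on one Hilbert space. With `k = s + 1`, a solution is `φ = φ₀ + Λ^{-s-1} u`,
`∂_t φ = Λ^{-s} p`, `sin 2φ = Λ^{-s} q`. Adding and subtracting `φ` in the equation turns it into a
half-wave equation for `w = u - e + ip`, namely `∂_t w = -iΛw + i(Λ^{-1}u - (σ/2)q)`. The constant
vector `e` carries the gradient of `φ₀`, because `φ₀` itself need not be in `L²`. Conjugation with
`e^{itΛ}` removes the unbounded operator: `ζ = e^{itΛ} w` solves an ordinary differential equation
in `L²`. Its vector field is locally Lipschitz as soon as `v ↦ sin 2v` is Lipschitz on bounded sets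
of `H_sin^{s+1}` with values in `H^s`.

That property, `LipschitzSin`, is the common hypothesis of the theory. For `N < 2s` it is
`exists_hBound_sin_cos`, by induction on the number of derivatives. For `s = 1`, `N ≤ 3` it is
`lipschitzSin_one`, where `|cos 2v - cos 2w| ≤ 2|sin (v - w)|` replaces the missing derivative
count. Both rest on the multiplication `H^a × H^b → H^c` of `exists_product`, proved on the Fourier
side, and on the chain rule `WeakD.comp`.

The Picard-Lindelöf theorem (`exists_local_solOn`) gives an existence time depending only on the
norms of the data, hence the blow-up alternative. Gronwall's inequality for the difference of two
waves (`LipschitzSin.exists_stability`) gives uniqueness and the Lipschitz flow. A bound of `φ` in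
`H_sin` already bounds `∂_t φ`, which yields the criterion with the upper limit.

A bound in `H_sin^{s+1}` bounds `sin 2φ` in `H^{s+1}`, which is the forcing at the next level of
regularity, so regularity persists up to the same maximal time. When `N ≤ 3`, the inequality `|sin
2φ| ≤ 2|sin φ|` makes the forcing grow linearly at the lowest level, and `exists_hBound_sin` carries
the resulting bound upwards, so solutions are global. Negative times follow by reversal of time. -/

namespace SineGordon

noncomputable section

open FourierTransform SchwartzMap
open scoped ComplexConjugate

variable {N : ℕ}

/-! ### Fourier multipliers on `L²` -/

/-- Complex-valued square integrable functions on `ℝ^N`. -/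
abbrev L2C (N : ℕ) : Type := Lp ℂ 2 (volume : Measure (Space N))

/-- Bounded continuous Fourier symbols on `ℝ^N`. -/
abbrev Symb (N : ℕ) : Type := BoundedContinuousFunction (Space N) ℂ

theorem memLp_symb_mul (m : Symb N) (f : L2C N) :
    MemLp (fun ξ => m ξ * f ξ) 2 (volume : Measure (Space N)) :=
  (Lp.memLp f).of_le_mul (c := ‖m‖)
    (m.continuous.aestronglyMeasurable.mul (Lp.aestronglyMeasurable f))
    (ae_of_all _ fun ξ => by
      rw [norm_mul]; exact mul_le_mul_of_nonneg_right (m.norm_coe_le_norm ξ) (norm_nonneg _))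

/-- Multiplication by a bounded symbol, as an operator on `L²`. -/
def mulOp (m : Symb N) : L2C N →L[ℂ] L2C N :=
  LinearMap.mkContinuous
    { toFun := fun f => (memLp_symb_mul m f).toLp _
      map_add' := fun f g => by
        rw [← MemLp.toLp_add, MemLp.toLp_eq_toLp_iff]
        filter_upwards [Lp.coeFn_add f g] with ξ h
        simp only [Pi.add_apply, h]; ring
      map_smul' := fun c f => by
        rw [RingHom.id_apply, ← MemLp.toLp_const_smul, MemLp.toLp_eq_toLp_iff]
        filter_upwards [Lp.coeFn_smul c f] with ξ h
        simp only [Pi.smul_apply, h, smul_eq_mul]; ring }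
    ‖m‖ fun f => by
      refine Lp.norm_le_mul_norm_of_ae_le_mul ?_
      filter_upwards [(memLp_symb_mul m f).coeFn_toLp] with ξ h
      simp only [LinearMap.coe_mk, AddHom.coe_mk, h, norm_mul]
      exact mul_le_mul_of_nonneg_right (m.norm_coe_le_norm ξ) (norm_nonneg _)

theorem coeFn_mulOp (m : Symb N) (f : L2C N) : mulOp m f =ᵐ[volume] fun ξ => m ξ * f ξ :=
  (memLp_symb_mul m f).coeFn_toLp

theorem norm_mulOp_le (m : Symb N) {C : ℝ} (hC : ∀ ξ, ‖m ξ‖ ≤ C) (f : L2C N) :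
    ‖mulOp m f‖ ≤ C * ‖f‖ := by
  refine Lp.norm_le_mul_norm_of_ae_le_mul ?_
  filter_upwards [coeFn_mulOp m f] with ξ h
  rw [h, norm_mul]
  exact mul_le_mul_of_nonneg_right (hC ξ) (norm_nonneg _)

theorem norm_mulOp_eq (m : Symb N) (hm : ∀ ξ, ‖m ξ‖ = 1) (f : L2C N) : ‖mulOp m f‖ = ‖f‖ := by
  apply le_antisymm
  · simpa using norm_mulOp_le m (fun ξ => (hm ξ).le) f
  · refine Lp.norm_le_norm_of_ae_le ?_
    filter_upwards [coeFn_mulOp m f] with ξ h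
    rw [h, norm_mul, hm, one_mul]

theorem mulOp_mul (m₁ m₂ : Symb N) (f : L2C N) : mulOp (m₁ * m₂) f = mulOp m₁ (mulOp m₂ f) := by
  apply Lp.ext
  filter_upwards [coeFn_mulOp (m₁ * m₂) f, coeFn_mulOp m₁ (mulOp m₂ f), coeFn_mulOp m₂ f]
    with ξ h₁ h₂ h₃
  rw [h₁, h₂, h₃, BoundedContinuousFunction.mul_apply]; ring

theorem mulOp_add (m₁ m₂ : Symb N) (f : L2C N) : mulOp (m₁ + m₂) f = mulOp m₁ f + mulOp m₂ f := by
  apply Lp.ext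
  filter_upwards [coeFn_mulOp (m₁ + m₂) f, coeFn_mulOp m₁ f, coeFn_mulOp m₂ f,
    Lp.coeFn_add (mulOp m₁ f) (mulOp m₂ f)] with ξ h₁ h₂ h₃ h₄
  rw [h₁, h₄, Pi.add_apply, h₂, h₃, BoundedContinuousFunction.add_apply]; ring

theorem mulOp_smul (c : ℂ) (m : Symb N) (f : L2C N) : mulOp (c • m) f = c • mulOp m f := by
  apply Lp.ext
  filter_upwards [coeFn_mulOp (c • m) f, coeFn_mulOp m f, Lp.coeFn_smul c (mulOp m f)]
    with ξ h₁ h₂ h₃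
  rw [h₁, h₃, Pi.smul_apply, h₂, BoundedContinuousFunction.smul_apply, smul_eq_mul, smul_eq_mul]
  ring

theorem mulOp_one (f : L2C N) : mulOp 1 f = f := by
  apply Lp.ext
  filter_upwards [coeFn_mulOp 1 f] with ξ h
  rw [h]; simp

theorem inner_mulOp (m : Symb N) (f g : L2C N) : inner ℂ (mulOp m f) g = inner ℂ f (mulOp (star m) g) := by
  rw [L2.inner_def, L2.inner_def]
  apply integral_congr_ae
  filter_upwards [coeFn_mulOp m f, coeFn_mulOp (star m) g] with ξ h₁ h₂
  rw [h₁, h₂]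
  simp only [RCLike.inner_apply, map_mul, BoundedContinuousFunction.star_apply, RCLike.star_def]
  ring

/-- Dominated convergence with the majorant `(C + ‖m₀‖)² |f|²`. Strong convergence is all that can
be expected for unimodular symbols with unbounded phase. -/
theorem tendsto_mulOp {ι : Type*} {l : Filter ι} [l.IsCountablyGenerated] {m : ι → Symb N}
    {m₀ : Symb N} {C : ℝ} (hC : ∀ᶠ i in l, ∀ ξ, ‖m i ξ‖ ≤ C)
    (h : ∀ ξ, Tendsto (fun i => m i ξ) l (𝓝 (m₀ ξ))) (f : L2C N) :
    Tendsto (fun i => mulOp (m i) f) l (𝓝 (mulOp m₀ f)) := by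
  have key : Tendsto (fun i => ∫⁻ ξ, ‖(m i ξ - m₀ ξ) * f ξ‖ₑ ^ (2 : ℝ)) l (𝓝 0) := by
    have hf : ∫⁻ ξ, ‖f ξ‖ₑ ^ (2 : ℝ) ≠ ⊤ := by
      have := (Lp.memLp f).2
      rw [eLpNorm_lt_top_iff_lintegral_rpow_enorm_lt_top (by norm_num) (by norm_num)] at this
      simpa using this.ne
    have h0 : ∫⁻ _ : Space N, (0 : ℝ≥0∞) = 0 := by simp
    rw [← h0]
    refine tendsto_lintegral_filter_of_dominated_convergence
      (fun ξ => ENNReal.ofReal (C + ‖m₀‖) ^ (2 : ℝ) * ‖f ξ‖ₑ ^ (2 : ℝ)) ?_ ?_ ?_ ?_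
    · refine Eventually.of_forall fun i => ?_
      have := (Lp.stronglyMeasurable f).measurable
      have h1 := (m i).continuous.measurable
      have h2 := m₀.continuous.measurable
      exact (((h1.sub h2).mul this).enorm.pow_const _)
    · filter_upwards [hC] with i hi
      refine ae_of_all _ fun ξ => ?_
      rw [enorm_mul, ENNReal.mul_rpow_of_nonneg _ _ (by norm_num)]
      gcongr
      rw [← ofReal_norm]
      apply ENNReal.ofReal_le_ofReal
      exact (norm_sub_le _ _).trans (add_le_add (hi ξ) (m₀.norm_coe_le_norm ξ))
    · rw [lintegral_const_mul' _ _ (by finiteness)]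
      exact ENNReal.mul_ne_top (by finiteness) hf
    · refine ae_of_all _ fun ξ => ?_
      have h1 : Tendsto (fun i => (m i ξ - m₀ ξ) * f ξ) l (𝓝 ((m₀ ξ - m₀ ξ) * f ξ)) :=
        ((h ξ).sub_const _).mul_const _
      have h2 := (ENNReal.continuous_rpow_const (y := 2)).continuousAt.tendsto.comp h1.enorm
      simpa [Function.comp_def] using h2
  rw [Lp.tendsto_Lp_iff_tendsto_eLpNorm']
  have h3 : (fun i => eLpNorm (⇑(mulOp (m i) f) - ⇑(mulOp m₀ f)) 2 volume) =
      fun i => (∫⁻ ξ, ‖(m i ξ - m₀ ξ) * f ξ‖ₑ ^ (2 : ℝ)) ^ (1 / 2 : ℝ) := by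
    funext i
    rw [eLpNorm_eq_lintegral_rpow_enorm_toReal (by norm_num) (by norm_num)]
    simp only [ENNReal.toReal_ofNat]
    congr 1
    apply lintegral_congr_ae
    filter_upwards [coeFn_mulOp (m i) f, coeFn_mulOp m₀ f] with ξ h₁ h₂
    rw [Pi.sub_apply, h₁, h₂, sub_mul]
  rw [h3]
  have := (ENNReal.continuous_rpow_const (y := 1 / 2)).continuousAt.tendsto.comp key
  simpa [Function.comp_def] using this

/-- The Fourier multiplier with symbol `m`. -/
def mult (m : Symb N) : L2C N →L[ℂ] L2C N :=
  (Lp.fourierTransformₗᵢ (Space N) ℂ).symm.toContinuousLinearEquiv.toContinuousLinearMap ∘L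
    mulOp m ∘L (Lp.fourierTransformₗᵢ (Space N) ℂ).toContinuousLinearEquiv.toContinuousLinearMap

theorem mult_apply (m : Symb N) (f : L2C N) : mult m f = 𝓕⁻ (mulOp m (𝓕 f)) := rfl

theorem fourier_mult (m : Symb N) (f : L2C N) : 𝓕 (mult m f) = mulOp m (𝓕 f) := by
  rw [mult_apply, fourier_fourierInv_eq]

theorem norm_fourierInv (f : L2C N) : ‖(𝓕⁻ f : L2C N)‖ = ‖f‖ :=
  (Lp.fourierTransformₗᵢ (Space N) ℂ).symm.norm_map f

theorem norm_mult_le (m : Symb N) {C : ℝ} (hC : ∀ ξ, ‖m ξ‖ ≤ C) (f : L2C N) :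
    ‖mult m f‖ ≤ C * ‖f‖ := by
  rw [mult_apply, norm_fourierInv]
  simpa using norm_mulOp_le m hC (𝓕 f)

theorem norm_mult_eq (m : Symb N) (hm : ∀ ξ, ‖m ξ‖ = 1) (f : L2C N) : ‖mult m f‖ = ‖f‖ := by
  rw [mult_apply, norm_fourierInv, norm_mulOp_eq m hm, Lp.norm_fourier_eq]

theorem mult_mul (m₁ m₂ : Symb N) (f : L2C N) : mult (m₁ * m₂) f = mult m₁ (mult m₂ f) := by
  rw [mult_apply, mult_apply, fourier_mult, mulOp_mul]

theorem mult_comm (m₁ m₂ : Symb N) (f : L2C N) :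
    mult m₁ (mult m₂ f) = mult m₂ (mult m₁ f) := by
  rw [← mult_mul, ← mult_mul, mul_comm]

theorem mult_add (m₁ m₂ : Symb N) (f : L2C N) : mult (m₁ + m₂) f = mult m₁ f + mult m₂ f := by
  rw [mult_apply, mulOp_add]
  exact (Lp.fourierTransformₗᵢ (Space N) ℂ).symm.map_add _ _

theorem mult_smul (c : ℂ) (m : Symb N) (f : L2C N) : mult (c • m) f = c • mult m f := by
  rw [mult_apply, mulOp_smul]
  exact (Lp.fourierTransformₗᵢ (Space N) ℂ).symm.map_smul _ _

theorem mult_neg (m : Symb N) (f : L2C N) : mult (-m) f = -mult m f := by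
  rw [← neg_one_smul ℂ m, mult_smul, neg_one_smul]

theorem mult_sub (m₁ m₂ : Symb N) (f : L2C N) : mult (m₁ - m₂) f = mult m₁ f - mult m₂ f := by
  rw [sub_eq_add_neg, mult_add, mult_neg, sub_eq_add_neg]

theorem mult_one (f : L2C N) : mult 1 f = f := by
  rw [mult_apply, mulOp_one, fourierInv_fourier_eq]

theorem mult_sum {ι : Type*} (s : Finset ι) (m : ι → Symb N) (f : L2C N) :
    mult (∑ i ∈ s, m i) f = ∑ i ∈ s, mult (m i) f := by
  classical
  induction s using Finset.induction_on with
  | empty =>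
    have := mult_smul 0 (0 : Symb N) f
    simpa using this
  | insert a s ha ih => rw [Finset.sum_insert ha, Finset.sum_insert ha, mult_add, ih]

theorem inner_mult (m : Symb N) (f g : L2C N) : inner ℂ (mult m f) g = inner ℂ f (mult (star m) g) := by
  rw [← Lp.inner_fourier_eq, fourier_mult, inner_mulOp, ← fourier_mult, Lp.inner_fourier_eq]

theorem tendsto_mult {ι : Type*} {l : Filter ι} [l.IsCountablyGenerated] {m : ι → Symb N}
    {m₀ : Symb N} {C : ℝ} (hC : ∀ᶠ i in l, ∀ ξ, ‖m i ξ‖ ≤ C)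
    (h : ∀ ξ, Tendsto (fun i => m i ξ) l (𝓝 (m₀ ξ))) (f : L2C N) :
    Tendsto (fun i => mult (m i) f) l (𝓝 (mult m₀ f)) :=
  ((Lp.fourierTransformₗᵢ (Space N) ℂ).symm.continuous.tendsto _).comp
    (tendsto_mulOp hC h (𝓕 f))

theorem mult_injective (m : Symb N) (hm : ∀ ξ, m ξ ≠ 0) : Function.Injective (mult m) := by
  rw [injective_iff_map_eq_zero]
  intro f hf
  have h0 : mulOp m (𝓕 f) = 0 := by
    rw [← fourier_mult, hf]; exact (Lp.fourierTransformₗᵢ (Space N) ℂ).map_zero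
  have h1 : (𝓕 f : L2C N) = 0 := by
    apply Lp.ext
    filter_upwards [coeFn_mulOp m (𝓕 f), Lp.coeFn_zero ℂ 2 (volume : Measure (Space N))]
      with ξ h₁ h₂
    rw [h0, h₂] at h₁
    rw [h₂]
    simpa [hm ξ] using h₁.symm
  have := Lp.norm_fourier_eq f
  rw [h1, norm_zero] at this
  exact norm_eq_zero.mp this.symm

/-- The bridge to multipliers on Schwartz functions: for symbols of temperate growth the operator on
`L²` preserves the Schwartz space. -/
theorem mult_toLp (m : Symb N) {g : Space N → ℂ} (hg : g.HasTemperateGrowth) (hm : ∀ ξ, m ξ = g ξ)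
    (f : 𝓢(Space N, ℂ)) : mult m (f.toLp 2) = (fourierMultiplierCLM ℂ g f).toLp 2 := by
  rw [mult_apply, SchwartzMap.toLp_fourier_eq, fourierMultiplierCLM_apply,
    ← SchwartzMap.toLp_fourierInv_eq]
  congr 1
  apply Lp.ext
  filter_upwards [coeFn_mulOp m ((𝓕 f).toLp 2), (𝓕 f).coeFn_toLp 2,
    (smulLeftCLM ℂ g (𝓕 f)).coeFn_toLp 2] with ξ h₁ h₂ h₃
  rw [h₁, h₂, h₃, hm, smulLeftCLM_apply_apply hg, smul_eq_mul]

/-! ### Complex conjugation -/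

/-- Complex conjugation on `L²`. -/
def conjL : L2C N →L[ℝ] L2C N :=
  (Complex.conjCLE : ℂ →L[ℝ] ℂ).compLpL 2 volume

theorem coeFn_conjL (f : L2C N) : conjL f =ᵐ[volume] fun x => conj (f x) := by
  filter_upwards [ContinuousLinearMap.coeFn_compLpL (p := 2) (μ := volume)
    (Complex.conjCLE : ℂ →L[ℝ] ℂ) f] with x hx
  rw [conjL, hx]; simp

theorem conjL_conjL (f : L2C N) : conjL (conjL f) = f := by
  apply Lp.ext
  filter_upwards [coeFn_conjL f, coeFn_conjL (conjL f)] with x h₁ h₂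
  rw [h₂, h₁, Complex.conj_conj]

theorem conjL_smul (c : ℂ) (f : L2C N) : conjL (c • f) = conj c • conjL f := by
  apply Lp.ext
  filter_upwards [coeFn_conjL f, coeFn_conjL (c • f), Lp.coeFn_smul c f,
    Lp.coeFn_smul (conj c) (conjL f)] with x h₁ h₂ h₃ h₄
  rw [h₂, h₄, h₃, Pi.smul_apply, Pi.smul_apply, h₁, smul_eq_mul, smul_eq_mul, map_mul]

theorem conjL_mulOp (m : Symb N) (f : L2C N) : conjL (mulOp m f) = mulOp (star m) (conjL f) := by
  apply Lp.ext
  filter_upwards [coeFn_conjL f, coeFn_conjL (mulOp m f), coeFn_mulOp m f,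
    coeFn_mulOp (star m) (conjL f)] with x h₁ h₂ h₃ h₄
  rw [h₂, h₄, h₃, h₁, map_mul]; rfl

/-- The reflection `f ↦ f(-·)` on `L²`. -/
def reflL : L2C N →+ L2C N :=
  Lp.compMeasurePreserving Neg.neg (Measure.measurePreserving_neg volume)

theorem coeFn_reflL (f : L2C N) : reflL f =ᵐ[volume] fun x => f (-x) :=
  Lp.coeFn_compMeasurePreserving f _

theorem continuous_reflL : Continuous (reflL : L2C N → L2C N) :=
  (Lp.isometry_compMeasurePreserving _).continuous

/-! ### Conjugation and reflection under the Fourier transform -/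

theorem dense_schwartz : DenseRange fun f : 𝓢(Space N, ℂ) => (f.toLp 2 : L2C N) :=
  SchwartzMap.denseRange_toLpCLM (p := 2) ENNReal.ofNat_ne_top

/-- Both sides are continuous in `f`, so it suffices to compare them on Schwartz functions, where
the inverse transform is the transform at `-x`. -/
theorem fourierInv_eq_reflL (f : L2C N) : (𝓕⁻ f : L2C N) = reflL (𝓕 f) := by
  refine dense_schwartz.induction_on (p := fun f : L2C N => (𝓕⁻ f : L2C N) = reflL (𝓕 f)) f
    ?_ fun g => ?_
  · exact isClosed_eq (Lp.fourierTransformₗᵢ (Space N) ℂ).symm.continuous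
      (continuous_reflL.comp (Lp.fourierTransformₗᵢ (Space N) ℂ).continuous)
  · rw [SchwartzMap.toLp_fourierInv_eq, SchwartzMap.toLp_fourier_eq]
    apply Lp.ext
    have h := (Measure.measurePreserving_neg (volume : Measure (Space N))).quasiMeasurePreserving.ae
      ((𝓕 g).coeFn_toLp 2 volume).eventually
    filter_upwards [coeFn_reflL ((𝓕 g).toLp 2), (𝓕⁻ g).coeFn_toLp 2, h] with x h₁ h₂ h₃
    rw [h₁, h₂, h₃]
    rfl

theorem fourierInv_reflL (f : L2C N) : (𝓕⁻ (reflL f) : L2C N) = 𝓕 f := by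
  have h : ∀ g : L2C N, (𝓕 (𝓕 g) : L2C N) = reflL g := by
    intro g
    have h1 := fourierInv_eq_reflL (𝓕⁻ g : L2C N)
    rw [fourier_fourierInv_eq] at h1
    have h2 := fourierInv_eq_reflL (𝓕 g : L2C N)
    rw [fourierInv_fourier_eq] at h2
    have h3 : reflL (reflL (𝓕 (𝓕 g) : L2C N)) = 𝓕 (𝓕 g) := by
      apply Lp.ext
      have h := (Measure.measurePreserving_neg
        (volume : Measure (Space N))).quasiMeasurePreserving.ae
        (coeFn_reflL (𝓕 (𝓕 g) : L2C N))
      filter_upwards [coeFn_reflL (reflL (𝓕 (𝓕 g) : L2C N)), h] with x h₁ h₂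
      rw [h₁, h₂, neg_neg]
    rw [← h3, ← h2]
  rw [← h, fourierInv_fourier_eq]

theorem fourier_conjL (f : L2C N) : (𝓕 (conjL f) : L2C N) = conjL (𝓕⁻ f) := by
  refine dense_schwartz.induction_on
    (p := fun f : L2C N => (𝓕 (conjL f) : L2C N) = conjL (𝓕⁻ f)) f ?_ fun g => ?_
  · exact isClosed_eq ((Lp.fourierTransformₗᵢ (Space N) ℂ).continuous.comp conjL.continuous)
      (conjL.continuous.comp (Lp.fourierTransformₗᵢ (Space N) ℂ).symm.continuous)
  · have h1 : conjL (g.toLp 2 : L2C N) =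
        (postcompCLM (𝕜 := ℝ) (Complex.conjCLE : ℂ →L[ℝ] ℂ) g).toLp 2 := by
      apply Lp.ext
      filter_upwards [coeFn_conjL (g.toLp 2 : L2C N), g.coeFn_toLp 2,
        (postcompCLM (𝕜 := ℝ) (Complex.conjCLE : ℂ →L[ℝ] ℂ) g).coeFn_toLp 2] with x h₁ h₂ h₃
      rw [h₁, h₂, h₃]; simp
    rw [h1, SchwartzMap.toLp_fourierInv_eq, SchwartzMap.toLp_fourier_eq]
    apply Lp.ext
    filter_upwards [coeFn_conjL ((𝓕⁻ g).toLp 2 : L2C N), (𝓕⁻ g).coeFn_toLp 2,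
      (𝓕 (postcompCLM (𝕜 := ℝ) (Complex.conjCLE : ℂ →L[ℝ] ℂ) g)).coeFn_toLp 2] with x h₁ h₂ h₃
    rw [h₁, h₂, h₃, fourier_coe, fourierInv_coe, Real.fourier_eq', Real.fourierInv_eq',
      ← integral_conj]
    apply integral_congr_ae
    refine ae_of_all _ fun v => ?_
    simp [← Complex.exp_conj, map_mul, Complex.conj_ofNat]

/-- Hermitian symbols belong to operators that preserve real functions. This applies to `bes` and
`rie`, but not to `kg`, which mixes real and imaginary parts. -/
theorem conjL_mult (m : Symb N) (hm : ∀ ξ, m (-ξ) = conj (m ξ)) (f : L2C N) :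
    conjL (mult m f) = mult m (conjL f) := by
  have h1 : ∀ g : L2C N, mulOp (star m) (reflL g) = reflL (mulOp m g) := by
    intro g
    apply Lp.ext
    have h := (Measure.measurePreserving_neg
      (volume : Measure (Space N))).quasiMeasurePreserving.ae (coeFn_mulOp m g)
    filter_upwards [coeFn_mulOp (star m) (reflL g), coeFn_reflL g, coeFn_reflL (mulOp m g), h]
      with x h₁ h₂ h₃ h₄
    rw [h₁, h₂, h₃, h₄, hm]; rfl
  rw [mult_apply m (conjL f), fourier_conjL]
  have h2 : mulOp m (conjL (𝓕⁻ f : L2C N)) = conjL (reflL (mulOp m (𝓕 f))) := by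
    rw [← h1, conjL_mulOp, star_star, fourierInv_eq_reflL]
  rw [h2]
  have h3 : ∀ g : L2C N, (𝓕⁻ (conjL g) : L2C N) = conjL (𝓕 g) := by
    intro g
    have := fourier_conjL (𝓕 g)
    rw [fourierInv_fourier_eq] at this
    rw [← this, fourierInv_fourier_eq]
  rw [h3]
  congr 1
  rw [← fourierInv_reflL]
  rw [mult_apply]
  congr 1
  apply Lp.ext
  have h := (Measure.measurePreserving_neg
    (volume : Measure (Space N))).quasiMeasurePreserving.ae
    (coeFn_reflL (mulOp m (𝓕 f)))
  filter_upwards [coeFn_reflL (reflL (mulOp m (𝓕 f))), h] with x h₁ h₂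
  rw [h₁, h₂, neg_neg]

end

end SineGordon

namespace SineGordon

noncomputable section

open FourierTransform SchwartzMap LineDeriv
open scoped ComplexConjugate

variable {N : ℕ}

/-! ### Bessel potentials, Riesz transforms and the Klein-Gordon group -/

/-- The symbol `(1 + |2πξ|²)^{1/2}` of `(1 - Δ)^{1/2}`. -/
def jap (ξ : Space N) : ℝ := √(1 + ‖(2 * Real.pi) • ξ‖ ^ 2)

theorem jap_sq (ξ : Space N) : jap ξ ^ 2 = 1 + ‖(2 * Real.pi) • ξ‖ ^ 2 :=
  Real.sq_sqrt (by positivity)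

theorem one_le_jap (ξ : Space N) : 1 ≤ jap ξ := by
  rw [jap, Real.one_le_sqrt]; nlinarith [sq_nonneg ‖(2 * Real.pi) • ξ‖]

theorem jap_pos (ξ : Space N) : 0 < jap ξ := zero_lt_one.trans_le (one_le_jap ξ)

theorem jap_neg (ξ : Space N) : jap (-ξ) = jap ξ := by simp [jap]

theorem continuous_jap : Continuous (jap : Space N → ℝ) := by
  unfold jap; fun_prop

theorem jap_ne (ξ : Space N) : (jap ξ : ℂ) ≠ 0 := by
  exact_mod_cast (jap_pos ξ).ne'

/-- After squaring, the cross term `2|ξ||η|` is dominated by `2 jap ξ jap η`. This is what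
distributes derivatives over a product on the Fourier side. -/
theorem jap_add_le (ξ η : Space N) : jap (ξ + η) ≤ jap ξ + jap η := by
  have h : ‖(2 * Real.pi) • (ξ + η)‖ ≤ ‖(2 * Real.pi) • ξ‖ + ‖(2 * Real.pi) • η‖ := by
    rw [smul_add]; exact norm_add_le _ _
  have h1 := norm_nonneg ((2 * Real.pi) • ξ)
  have h2 := norm_nonneg ((2 * Real.pi) • η)
  have h3 : ‖(2 * Real.pi) • ξ‖ ≤ jap ξ := Real.le_sqrt_of_sq_le (by linarith)
  have h4 : ‖(2 * Real.pi) • η‖ ≤ jap η := Real.le_sqrt_of_sq_le (by linarith)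
  have h5 := norm_nonneg ((2 * Real.pi) • (ξ + η))
  refine abs_le_of_sq_le_sq' ?_ (by linarith [jap_pos ξ, jap_pos η]) |>.2
  rw [jap_sq]
  nlinarith [jap_sq ξ, jap_sq η, mul_le_mul h3 h4 h2 (jap_pos ξ).le]

/-- The symbol of `(1 - Δ)^{-r/2}`. -/
def symB (r : ℕ) : Symb N :=
  BoundedContinuousFunction.ofNormedAddCommGroup (fun ξ => ((jap ξ : ℂ) ^ r)⁻¹)
    (((Complex.continuous_ofReal.comp continuous_jap).pow r).inv₀ fun ξ => pow_ne_zero _ (jap_ne ξ))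
    1 fun ξ => by
      rw [norm_inv, norm_pow, Complex.norm_real, Real.norm_of_nonneg (jap_pos ξ).le]
      exact inv_le_one_of_one_le₀ (one_le_pow₀ (one_le_jap ξ))

theorem symB_apply (r : ℕ) (ξ : Space N) : symB r ξ = ((jap ξ : ℂ) ^ r)⁻¹ := rfl

theorem abs_coord_le_jap (i : Fin N) (ξ : Space N) : |2 * Real.pi * ξ i| ≤ jap ξ := by
  have h : |2 * Real.pi * ξ i| ≤ ‖(2 * Real.pi) • ξ‖ := by
    have := PiLp.norm_apply_le ((2 * Real.pi) • ξ) i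
    simpa using this
  exact h.trans (Real.le_sqrt_of_sq_le (by linarith))

/-- The symbol of `∂_i (1 - Δ)^{-1/2}`. -/
def symD (i : Fin N) : Symb N :=
  BoundedContinuousFunction.ofNormedAddCommGroup
    (fun ξ => 2 * Real.pi * Complex.I * (ξ i : ℝ) * (jap ξ : ℂ)⁻¹)
    (by
      refine Continuous.mul (by fun_prop) ?_
      exact (Complex.continuous_ofReal.comp continuous_jap).inv₀ fun ξ => jap_ne ξ)
    1 fun ξ => by
      have h := abs_coord_le_jap i ξ
      have h1 := jap_pos ξ
      have : ‖2 * Real.pi * Complex.I * (ξ i : ℝ) * (jap ξ : ℂ)⁻¹‖ =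
          |2 * Real.pi * ξ i| * (jap ξ)⁻¹ := by
        simp [abs_mul, abs_of_pos h1]
      rw [this, ← div_eq_mul_inv]
      exact div_le_one_of_le₀ h h1.le

theorem symD_apply (i : Fin N) (ξ : Space N) :
    symD i ξ = 2 * Real.pi * Complex.I * (ξ i : ℝ) * (jap ξ : ℂ)⁻¹ := rfl

/-- The symbol of the Klein-Gordon group `e^{it(1 - Δ)^{1/2}}`. -/
def symU (t : ℝ) : Symb N :=
  BoundedContinuousFunction.ofNormedAddCommGroup
    (fun ξ => Complex.exp (Complex.I * (t * jap ξ : ℝ)))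
    (by have := continuous_jap (N := N); fun_prop)
    1 fun ξ => by rw [Complex.norm_exp_I_mul_ofReal]

theorem symU_apply (t : ℝ) (ξ : Space N) : symU t ξ = Complex.exp (Complex.I * (t * jap ξ : ℝ)) :=
  rfl

/-- The Bessel potential `(1 - Δ)^{-r/2}` on `L²`. -/
def bes (r : ℕ) : L2C N →L[ℂ] L2C N := mult (symB r)

/-- The operator `∂_i (1 - Δ)^{-1/2}` on `L²`. -/
def rie (i : Fin N) : L2C N →L[ℂ] L2C N := mult (symD i)

/-- The unitary group `e^{it(1 - Δ)^{1/2}}` on `L²`. -/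
def kg (t : ℝ) : L2C N →L[ℂ] L2C N := mult (symU t)

theorem bes_bes (r s : ℕ) (f : L2C N) : bes r (bes s f) = bes (r + s) f := by
  have h : (symB r * symB s : Symb N) = symB (r + s) := by
    ext ξ
    simp [symB_apply, pow_add, mul_comm]
  rw [bes, bes, ← mult_mul, h, bes]

theorem bes_zero (f : L2C N) : bes 0 f = f := by
  rw [bes, show (symB 0 : Symb N) = 1 by ext ξ; simp [symB_apply], mult_one]

theorem bes_rie (r : ℕ) (i : Fin N) (f : L2C N) : bes r (rie i f) = rie i (bes r f) :=
  mult_comm _ _ _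

theorem bes_kg (r : ℕ) (t : ℝ) (f : L2C N) : bes r (kg t f) = kg t (bes r f) :=
  mult_comm _ _ _

theorem norm_bes_le (r : ℕ) (f : L2C N) : ‖bes r f‖ ≤ ‖f‖ := by
  simpa only [one_mul, bes] using norm_mult_le (symB r) (C := 1) (fun ξ => by
    rw [symB_apply, norm_inv, norm_pow, Complex.norm_real, Real.norm_of_nonneg (jap_pos ξ).le]
    exact inv_le_one_of_one_le₀ (one_le_pow₀ (one_le_jap ξ))) f

theorem norm_rie_le (i : Fin N) (f : L2C N) : ‖rie i f‖ ≤ ‖f‖ := by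
  simpa only [one_mul, rie] using norm_mult_le (symD i) (C := 1) (fun ξ => by
    have h := abs_coord_le_jap i ξ
    have h1 := jap_pos ξ
    have : ‖symD i ξ‖ = |2 * Real.pi * ξ i| * (jap ξ)⁻¹ := by
      simp [symD_apply, abs_mul, abs_of_pos h1]
    rw [this, ← div_eq_mul_inv]
    exact div_le_one_of_le₀ h h1.le) f

theorem norm_kg (t : ℝ) (f : L2C N) : ‖kg t f‖ = ‖f‖ :=
  norm_mult_eq _ (fun ξ => by rw [symU_apply, Complex.norm_exp_I_mul_ofReal]) f

theorem kg_kg (s t : ℝ) (f : L2C N) : kg s (kg t f) = kg (s + t) f := by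
  have h : (symU s * symU t : Symb N) = symU (s + t) := by
    ext ξ
    simp only [BoundedContinuousFunction.mul_apply, symU_apply]
    rw [← Complex.exp_add]
    push_cast
    ring_nf
  rw [kg, kg, ← mult_mul, h, kg]

theorem kg_zero (f : L2C N) : kg 0 f = f := by
  rw [kg, show (symU 0 : Symb N) = 1 by ext ξ; simp [symU_apply], mult_one]

theorem kg_neg_kg (t : ℝ) (f : L2C N) : kg (-t) (kg t f) = f := by
  rw [kg_kg, neg_add_cancel, kg_zero]

theorem bes_injective (r : ℕ) : Function.Injective (bes r : L2C N → L2C N) :=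
  mult_injective _ fun ξ => inv_ne_zero (pow_ne_zero _ (jap_ne ξ))

theorem conjL_bes (r : ℕ) (f : L2C N) : conjL (bes r f) = bes r (conjL f) :=
  conjL_mult _ (fun ξ => by simp [symB_apply, jap_neg]) f

theorem conjL_rie (i : Fin N) (f : L2C N) : conjL (rie i f) = rie i (conjL f) :=
  conjL_mult _ (fun ξ => by simp [symD_apply, jap_neg, Complex.conj_ofNat]) f

/-- The symbols add up to `(1 + |2πξ|²) / jap² = 1`. The identity recovers a function from itself
and its gradient, and later trades the Laplacian for the Klein-Gordon operator plus a term of lower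
order. -/
theorem bes_two_sub_sum_rie (f : L2C N) : bes 2 f - ∑ i, rie i (rie i f) = f := by
  have h : (symB 2 : Symb N) - ∑ i, symD i * symD i = 1 := by
    ext ξ
    have h1 := jap_ne ξ
    have h2 : (jap ξ : ℂ) ^ 2 = 1 + ∑ i, (2 * Real.pi * (ξ i : ℝ) : ℂ) ^ 2 := by
      rw [← Complex.ofReal_pow, jap_sq, EuclideanSpace.norm_sq_eq]
      push_cast
      congr 1
      apply Finset.sum_congr rfl
      intro i _
      rw [← Complex.ofReal_pow, Real.norm_eq_abs, sq_abs]
      simp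
    have h3 : (∑ i, symD i * symD i : Symb N) ξ =
        -(∑ i, (2 * Real.pi * (ξ i : ℝ) : ℂ) ^ 2) * ((jap ξ : ℂ) ^ 2)⁻¹ := by
      rw [BoundedContinuousFunction.coe_sum, Finset.sum_apply, neg_mul, Finset.sum_mul,
        ← Finset.sum_neg_distrib]
      apply Finset.sum_congr rfl
      intro i _
      rw [BoundedContinuousFunction.mul_apply, symD_apply]
      field_simp
      rw [Complex.I_sq]; ring
    rw [BoundedContinuousFunction.sub_apply, h3, symB_apply, BoundedContinuousFunction.coe_one,
      Pi.one_apply]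
    have h4 : (1 + ∑ i, (2 * Real.pi * (ξ i : ℝ) : ℂ) ^ 2) * ((jap ξ : ℂ) ^ 2)⁻¹ = 1 := by
      rw [← h2]; field_simp
    linear_combination h4
  have h2 := congrArg (fun m => mult m f) h
  simp only [mult_one, mult_sub, mult_sum, mult_mul] at h2
  exact h2

theorem inner_bes (r : ℕ) (f g : L2C N) : inner ℂ (bes r f) g = inner ℂ f (bes r g) := by
  rw [bes, inner_mult]
  congr 3
  ext ξ
  simp [symB_apply]

theorem inner_rie (i : Fin N) (f g : L2C N) : inner ℂ (rie i f) g = -inner ℂ f (rie i g) := by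
  rw [rie, inner_mult, ← inner_neg_right, ← mult_neg]
  congr 3
  ext ξ
  simp [symD_apply]

/-! ### Strong continuity and generator of the Klein-Gordon group -/

theorem continuous_kg (f : L2C N) : Continuous fun t => kg t f := by
  rw [continuous_iff_continuousAt]
  intro t
  refine tendsto_mult (C := 1) (Eventually.of_forall fun s ξ => ?_) (fun ξ => ?_) f
  · rw [symU_apply, Complex.norm_exp_I_mul_ofReal]
  · have : Continuous fun s : ℝ => symU s ξ := by simp only [symU_apply]; fun_prop
    exact this.tendsto t

/-- Strong continuity becomes joint continuity because the group is isometric: the error `f i - f₀`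
keeps its norm. -/
theorem tendsto_kg_apply {ι : Type*} {l : Filter ι} {t : ι → ℝ} {t₀ : ℝ} {f : ι → L2C N}
    {f₀ : L2C N} (ht : Tendsto t l (𝓝 t₀)) (hf : Tendsto f l (𝓝 f₀)) :
    Tendsto (fun i => kg (t i) (f i)) l (𝓝 (kg t₀ f₀)) := by
  have h1 : Tendsto (fun i => kg (t i) f₀) l (𝓝 (kg t₀ f₀)) := ((continuous_kg f₀).tendsto t₀).comp ht
  have h2 : Tendsto (fun i => kg (t i) (f i - f₀)) l (𝓝 0) := by
    rw [tendsto_zero_iff_norm_tendsto_zero]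
    simp only [norm_kg]
    rw [← tendsto_zero_iff_norm_tendsto_zero]
    simpa using hf.sub_const f₀
  simpa using h2.add h1

/-- The range of `bes 1` lies in the domain of the generator: with `j = jap ξ`, the difference
quotient has the symbol `(e^{ihj} - 1)/(hj)`, bounded by `1` and tending to `i`. -/
theorem hasDerivAt_kg_bes (t : ℝ) (f : L2C N) :
    HasDerivAt (fun s => kg s (bes 1 f)) (Complex.I • kg t f) t := by
  rw [hasDerivAt_iff_tendsto_slope_zero]
  have h0 : ∀ h : ℝ, h⁻¹ • (kg (t + h) (bes 1 f) - kg t (bes 1 f)) =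
      kg t (mult (((h⁻¹ : ℝ) : ℂ) • ((symU h - 1) * symB 1)) f) := by
    intro h
    rw [mult_smul, mult_mul, mult_sub, mult_one]
    change _ = kg t ((((h⁻¹ : ℝ) : ℂ)) • (kg h (bes 1 f) - bes 1 f))
    rw [map_smul, map_sub, kg_kg]
    rfl
  simp only [h0]
  have h1 : Complex.I • kg t f = kg t (mult (Complex.I • 1) f) := by
    rw [mult_smul, mult_one, map_smul]
  rw [h1]
  refine ((kg t).continuous.tendsto _).comp ?_
  have hval : ∀ (h : ℝ) (ξ : Space N), ((((h⁻¹ : ℝ) : ℂ)) • ((symU h - 1) * symB 1) : Symb N) ξ =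
      (h : ℂ)⁻¹ * ((Complex.exp (Complex.I * (h * jap ξ : ℝ)) - 1) * (jap ξ : ℂ)⁻¹) := by
    intro h ξ
    simp [symU_apply, symB_apply]
  refine tendsto_mult (C := 1) ?_ ?_ f
  · refine Eventually.of_forall fun h ξ => ?_
    rw [hval, norm_mul, norm_mul, norm_inv, norm_inv, Complex.norm_real, Complex.norm_real]
    have h2 := Real.norm_exp_I_mul_ofReal_sub_one_le (x := h * jap ξ)
    rw [norm_mul] at h2
    have h3 : 0 < ‖jap ξ‖ := norm_pos_iff.mpr (jap_pos ξ).ne'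
    rcases eq_or_ne h 0 with rfl | hh
    · simp
    have h4 : 0 < ‖h‖ := norm_pos_iff.mpr hh
    calc _ ≤ ‖h‖⁻¹ * ((‖h‖ * ‖jap ξ‖) * ‖jap ξ‖⁻¹) := by gcongr
      _ = 1 := by field_simp
  · intro ξ
    have h5 : HasDerivAt (fun h : ℝ => Complex.exp (Complex.I * (h * jap ξ : ℝ)))
        (Complex.I * jap ξ) 0 := by
      have h6 : HasDerivAt (fun h : ℝ => Complex.I * (h * jap ξ : ℝ)) (Complex.I * jap ξ) 0 := by
        have := ((hasDerivAt_id (0 : ℝ)).mul_const (jap ξ)).ofReal_comp.const_mul Complex.I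
        simpa using this
      have := h6.cexp
      simpa using this
    rw [hasDerivAt_iff_tendsto_slope_zero] at h5
    have h7 := h5.mul_const ((jap ξ : ℂ)⁻¹)
    have h8 : Complex.I * jap ξ * (jap ξ : ℂ)⁻¹ = (Complex.I • (1 : Symb N)) ξ := by
      rw [mul_assoc, mul_inv_cancel₀ (jap_ne ξ)]; simp
    rw [h8] at h7
    refine h7.congr fun h => ?_
    rw [hval]
    simp [mul_assoc]

/-- The product rule for the Klein-Gordon group in the space with one derivative less. -/
theorem hasDerivWithinAt_kg {p : ℝ → L2C N} {p' r : L2C N} {I : Set ℝ} {t : ℝ} (c : ℝ)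
    (hp : HasDerivWithinAt p p' I t) (hr : p t = bes 1 r) :
    HasDerivWithinAt (fun s => kg (c * s) (p s)) (kg (c * t) (p' + (c * Complex.I) • r)) I t := by
  rw [hasDerivWithinAt_iff_tendsto_slope] at hp ⊢
  -- The slope splits into the group applied to the slope of `p`, and the slope of the group on the
  -- fixed vector `p t`, which `hr` puts in the domain of the generator.
  have h1 : Tendsto (fun s => kg (c * s) (slope p t s)) (𝓝[I \ {t}] t) (𝓝 (kg (c * t) p')) := by
    refine tendsto_kg_apply ?_ hp
    exact ((continuous_const.mul continuous_id).tendsto t).mono_left nhdsWithin_le_nhds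
  have h2 : HasDerivWithinAt (fun s => kg (c * s) (p t)) ((c : ℂ) • (Complex.I • kg (c * t) r)) I t := by
    rw [hr]
    have h3 := hasDerivAt_kg_bes (c * t) r
    have h4 : HasDerivAt (fun s : ℝ => c * s) c t := by simpa using (hasDerivAt_id t).const_mul c
    have h5 := h3.scomp t h4
    exact h5.hasDerivWithinAt
  rw [hasDerivWithinAt_iff_tendsto_slope] at h2
  have h6 := h1.add h2
  rw [map_add, map_smul, ← smul_smul]
  refine h6.congr fun s => ?_
  simp only [slope, vsub_eq_sub]
  have : ∀ (a : ℝ) (x : L2C N), kg (c * s) (a • x) = a • kg (c * s) x := fun a x => by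
    exact (kg (c * s)).map_smul_of_tower a x
  rw [this, ← smul_add, map_sub]
  congr 1
  abel

end

end SineGordon

namespace SineGordon

noncomputable section

open FourierTransform SchwartzMap LineDeriv
open scoped ComplexConjugate

variable {N : ℕ}

/-! ### Weak derivatives -/

/-- The `i`-th unit vector. -/
abbrev unitVec (i : Fin N) : Space N := EuclideanSpace.single i (1 : ℝ)

/-- `g` is the weak derivative `∂_i v`. -/
abbrev WeakD (i : Fin N) (v g : Space N → ℝ) : Prop := IsWeakDeriv (fun _ : Fin 1 => i) v g

theorem partialD_zero (α : Fin 0 → Fin N) (χ : Space N → ℝ) : partialD α χ = χ := by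
  funext x; simp [partialD]

theorem partialD_one (i : Fin N) (χ : Space N → ℝ) (x : Space N) :
    partialD (fun _ : Fin 1 => i) χ x = fderiv ℝ χ x (unitVec i) := by
  simp [partialD, iteratedFDeriv_one_apply]

theorem partialD_cons {m : ℕ} (i : Fin N) (β : Fin m → Fin N) {χ : Space N → ℝ}
    (hχ : ContDiff ℝ ∞ χ) (x : Space N) :
    partialD (Fin.cons i β : Fin (m + 1) → Fin N) χ x =
      partialD (fun _ : Fin 1 => i) (partialD β χ) x := by
  rw [partialD_one, partialD, iteratedFDeriv_succ_apply_left]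
  have h : DifferentiableAt ℝ (iteratedFDeriv ℝ m χ) x :=
    (hχ.differentiable_iteratedFDeriv (by exact_mod_cast ENat.natCast_lt_top m)) x
  have h2 := h.hasFDerivAt.continuousMultilinear_apply_const
    (fun j => (EuclideanSpace.single (β j) (1 : ℝ) : Space N))
  have h3 : partialD β χ = fun y => iteratedFDeriv ℝ m χ y
    fun j => EuclideanSpace.single (β j) (1 : ℝ) := rfl
  rw [h3, h2.fderiv]
  rfl

theorem IsTest.partialD {m : ℕ} (β : Fin m → Fin N) {χ : Space N → ℝ} (hχ : IsTest χ) :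
    IsTest (partialD β χ) := by
  constructor
  · have h : ContDiff ℝ ∞ (iteratedFDeriv ℝ m χ) :=
      hχ.1.iteratedFDeriv_right (m := ∞) (by exact le_of_eq (by norm_cast))
    exact (ContinuousMultilinearMap.apply ℝ (fun _ : Fin m => Space N) ℝ
      (fun j => EuclideanSpace.single (β j) (1 : ℝ))).contDiff.comp h
  · exact (hχ.2.iteratedFDeriv (𝕜 := ℝ) m).mono' fun x hx => by
      apply subset_tsupport
      intro h0
      apply hx
      simp [SineGordon.partialD, h0]

theorem IsTest.continuous {χ : Space N → ℝ} (hχ : IsTest χ) : Continuous χ := hχ.1.continuous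

theorem IsTest.integrable_mul {χ v : Space N → ℝ} (hχ : IsTest χ) (hv : LocallyIntegrable v volume) :
    Integrable (fun x => v x * χ x) volume := by
  have := hv.integrable_smul_left_of_hasCompactSupport hχ.continuous hχ.2
  simpa [mul_comm] using this

theorem IsTest.memLp {χ : Space N → ℝ} (hχ : IsTest χ) (p : ℝ≥0∞) : MemLp χ p volume :=
  hχ.continuous.memLp_of_hasCompactSupport hχ.2

theorem IsWeakDeriv.unique {m : ℕ} {α : Fin m → Fin N} {v g g' : Space N → ℝ}
    (h : IsWeakDeriv α v g) (h' : IsWeakDeriv α v g') : g =ᵐ[volume] g' := by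
  refine ae_eq_of_integral_contDiff_smul_eq h.2.1 h'.2.1 fun χ h1 h2 => ?_
  have e := (h.2.2 χ ⟨h1, h2⟩).symm.trans (h'.2.2 χ ⟨h1, h2⟩)
  have e' := mul_left_cancel₀ (pow_ne_zero m (by norm_num : (-1 : ℝ) ≠ 0)) e
  simpa [mul_comm] using e'

theorem weakDerivNorm_eq {m : ℕ} {α : Fin m → Fin N} {v g : Space N → ℝ}
    (h : IsWeakDeriv α v g) : weakDerivNorm α v = eLpNorm g 2 volume := by
  apply le_antisymm
  · exact iInf₂_le g h
  · exact le_iInf₂ fun g' h' => (eLpNorm_congr_ae (h.unique h')).le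

theorem IsWeakDeriv.congr {m : ℕ} {α : Fin m → Fin N} {v v' g g' : Space N → ℝ}
    (h : IsWeakDeriv α v g) (hv : v =ᵐ[volume] v') (hg : g =ᵐ[volume] g') :
    IsWeakDeriv α v' g' := by
  refine ⟨h.1.congr hv, h.2.1.congr hg, fun χ hχ => ?_⟩
  rw [← integral_congr_ae (hv.mono fun x hx => by simp only [hx] : (fun x => v x * SineGordon.partialD α χ x)
    =ᵐ[volume] fun x => v' x * SineGordon.partialD α χ x),
    ← integral_congr_ae (hg.mono fun x hx => by simp only [hx] : (fun x => g x * χ x)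
    =ᵐ[volume] fun x => g' x * χ x)]
  exact h.2.2 χ hχ

theorem IsWeakDeriv.add {m : ℕ} {α : Fin m → Fin N} {v v' g g' : Space N → ℝ}
    (h : IsWeakDeriv α v g) (h' : IsWeakDeriv α v' g') :
    IsWeakDeriv α (v + v') (g + g') := by
  refine ⟨h.1.add h'.1, h.2.1.add h'.2.1, fun χ hχ => ?_⟩
  simp only [Pi.add_apply, add_mul]
  rw [integral_add ((hχ.partialD α).integrable_mul h.1) ((hχ.partialD α).integrable_mul h'.1),
    integral_add (hχ.integrable_mul h.2.1) (hχ.integrable_mul h'.2.1), h.2.2 χ hχ, h'.2.2 χ hχ]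
  ring

theorem IsWeakDeriv.const_smul {m : ℕ} {α : Fin m → Fin N} {v g : Space N → ℝ}
    (c : ℝ) (h : IsWeakDeriv α v g) : IsWeakDeriv α (c • v) (c • g) := by
  refine ⟨h.1.smul c, h.2.1.smul c, fun χ hχ => ?_⟩
  simp only [Pi.smul_apply, smul_eq_mul, mul_assoc, integral_const_mul]
  rw [h.2.2 χ hχ]; ring

theorem IsWeakDeriv.sub {m : ℕ} {α : Fin m → Fin N} {v v' g g' : Space N → ℝ}
    (h : IsWeakDeriv α v g) (h' : IsWeakDeriv α v' g') :
    IsWeakDeriv α (v - v') (g - g') := by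
  have := h.add (h'.const_smul (-1))
  simpa [sub_eq_add_neg] using this

/-- Together with its converse below, this reduces derivatives of order `m + 1` to derivatives of
order `m` of a first derivative: derivatives of test functions are test functions. -/
theorem IsWeakDeriv.cons {m : ℕ} {i : Fin N} {β : Fin m → Fin N} {v a g : Space N → ℝ}
    (h : WeakD i v a) (h' : IsWeakDeriv β a g) :
    IsWeakDeriv (Fin.cons i β : Fin (m + 1) → Fin N) v g := by
  refine ⟨h.1, h'.2.1, fun χ hχ => ?_⟩
  simp only [partialD_cons i β hχ.1]
  rw [h.2.2 _ (hχ.partialD β), h'.2.2 χ hχ]; ring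

theorem IsWeakDeriv.of_cons {m : ℕ} {i : Fin N} {β : Fin m → Fin N} {v a g : Space N → ℝ}
    (h : WeakD i v a) (h' : IsWeakDeriv (Fin.cons i β : Fin (m + 1) → Fin N) v g) :
    IsWeakDeriv β a g := by
  refine ⟨h.2.1, h'.2.1, fun χ hχ => ?_⟩
  have e := h'.2.2 χ hχ
  simp only [partialD_cons i β hχ.1] at e
  rw [h.2.2 _ (hχ.partialD β)] at e
  linear_combination -e

theorem isWeakDeriv_zero_iff {α : Fin 0 → Fin N} {v g : Space N → ℝ} :
    IsWeakDeriv α v g ↔ LocallyIntegrable v volume ∧ v =ᵐ[volume] g := by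
  constructor
  · intro h
    refine ⟨h.1, ae_eq_of_integral_contDiff_smul_eq h.1 h.2.1 fun χ h1 h2 => ?_⟩
    have := h.2.2 χ ⟨h1, h2⟩
    rw [partialD_zero] at this
    simpa [mul_comm] using this
  · rintro ⟨h1, h2⟩
    refine ⟨h1, h1.congr h2, fun χ hχ => ?_⟩
    rw [partialD_zero, pow_zero, one_mul]
    exact integral_congr_ae (h2.mono fun x hx => by simp only [hx])

/-! ### Real functions as elements of the complex `L²` space -/

/-- The real part of an element of `L²`, as a function. -/
def reF (f : L2C N) : Space N → ℝ := fun x => (f x).re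

/-- `v` is the real function in `H^s` with `(1 - Δ)^{s/2} v = y`. -/
def Rep (s : ℕ) (v : Space N → ℝ) (y : L2C N) : Prop :=
  (fun x => (v x : ℂ)) =ᵐ[volume] bes s y

theorem conjL_eq_of_real {f : L2C N} {v : Space N → ℝ} (h : (fun x => (v x : ℂ)) =ᵐ[volume] f) :
    conjL f = f := by
  apply Lp.ext
  filter_upwards [coeFn_conjL f, h] with x h₁ h₂
  rw [h₁, ← h₂, Complex.conj_ofReal]

theorem reF_eq {f : L2C N} (h : conjL f = f) : (fun x => (reF f x : ℂ)) =ᵐ[volume] f := by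
  filter_upwards [coeFn_conjL f] with x h₁
  rw [h] at h₁
  exact Complex.conj_eq_iff_re.mp h₁.symm

/-- `bes s` commutes with conjugation and is injective, so reality passes from the function to its
representative. -/
theorem Rep.conj {s : ℕ} {v : Space N → ℝ} {y : L2C N} (h : Rep s v y) : conjL y = y := by
  have := conjL_eq_of_real h
  rw [conjL_bes] at this
  exact bes_injective s this

theorem rep_reF {s : ℕ} {y : L2C N} (h : conjL y = y) : Rep s (reF (bes s y)) y :=
  reF_eq (by rw [conjL_bes, h])

theorem Rep.unique {s : ℕ} {v : Space N → ℝ} {y y' : L2C N} (h : Rep s v y) (h' : Rep s v y') :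
    y = y' :=
  bes_injective s (Lp.ext (h.symm.trans h'))

theorem Rep.congr {s : ℕ} {v v' : Space N → ℝ} {y : L2C N} (h : Rep s v y)
    (hv : v =ᵐ[volume] v') : Rep s v' y :=
  EventuallyEq.trans (hv.mono fun x hx => by simp only [hx]) h

theorem Rep.ae_eq {s : ℕ} {v v' : Space N → ℝ} {y : L2C N} (h : Rep s v y) (h' : Rep s v' y) :
    v =ᵐ[volume] v' :=
  (EventuallyEq.trans h (EventuallyEq.symm h')).mono fun _ hx => Complex.ofReal_injective hx

theorem Rep.add {s : ℕ} {v v' : Space N → ℝ} {y y' : L2C N} (h : Rep s v y) (h' : Rep s v' y') :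
    Rep s (v + v') (y + y') := by
  rw [Rep, map_add]
  filter_upwards [h, h', Lp.coeFn_add (bes s y) (bes s y')] with x h₁ h₂ h₃
  rw [h₃, Pi.add_apply, Pi.add_apply, ← h₁, ← h₂, Complex.ofReal_add]

theorem Rep.smul {s : ℕ} {v : Space N → ℝ} {y : L2C N} (c : ℝ) (h : Rep s v y) :
    Rep s (c • v) (c • y) := by
  have e : bes s (c • y) = c • bes s y := (bes s).map_smul_of_tower c y
  rw [Rep, e]
  filter_upwards [h, Lp.coeFn_smul c (bes s y)] with x h₁ h₃
  rw [h₃, Pi.smul_apply, Pi.smul_apply, ← h₁]; simp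

theorem Rep.neg {s : ℕ} {v : Space N → ℝ} {y : L2C N} (h : Rep s v y) : Rep s (-v) (-y) := by
  simpa using h.smul (-1)

theorem Rep.sub {s : ℕ} {v v' : Space N → ℝ} {y y' : L2C N} (h : Rep s v y) (h' : Rep s v' y') :
    Rep s (v - v') (y - y') := by
  simpa [sub_eq_add_neg] using h.add h'.neg

theorem Rep.mono {s r : ℕ} {v : Space N → ℝ} {y : L2C N} (h : Rep (s + r) v y) :
    Rep s v (bes r y) := by
  rw [Rep, bes_bes]; exact h

theorem Rep.zero (s : ℕ) : Rep s (0 : Space N → ℝ) 0 := by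
  rw [Rep, map_zero]
  filter_upwards [Lp.coeFn_zero ℂ 2 (volume : Measure (Space N))] with x hx
  rw [hx]; simp

theorem Rep.memLp {s : ℕ} {v : Space N → ℝ} {y : L2C N} (h : Rep s v y) : MemLp v 2 volume := by
  have h1 : MemLp (fun x => (v x : ℂ)) 2 volume := (memLp_congr_ae h).mpr (Lp.memLp _)
  exact h1.re

theorem Rep.eLpNorm_eq {s : ℕ} {v : Space N → ℝ} {y : L2C N} (h : Rep s v y) :
    eLpNorm v 2 volume = ENNReal.ofReal ‖bes s y‖ := by
  rw [ofReal_norm, Lp.enorm_def, ← eLpNorm_congr_ae h]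
  exact eLpNorm_congr_norm_ae (ae_of_all _ fun x => by simp)

theorem exists_rep_zero {v : Space N → ℝ} (h : MemLp v 2 volume) : ∃ y, Rep 0 v y := by
  refine ⟨(h.ofReal (K := ℂ)).toLp _, ?_⟩
  rw [Rep, bes_zero]
  exact ((h.ofReal (K := ℂ)).coeFn_toLp).symm

theorem Rep.locallyIntegrable {s : ℕ} {v : Space N → ℝ} {y : L2C N} (h : Rep s v y) :
    LocallyIntegrable v volume :=
  h.memLp.locallyIntegrable (by norm_num)

/-! ### Schwartz functions -/

theorem hasTemperateGrowth_jap_rpow (r : ℝ) :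
    (fun ξ : Space N => (((1 + ‖(2 * Real.pi) • ξ‖ ^ 2) ^ r : ℝ) : ℂ)).HasTemperateGrowth := by
  have h1 : (fun ξ : Space N => (2 * Real.pi) • ξ).HasTemperateGrowth :=
    ((2 * Real.pi) • ContinuousLinearMap.id ℝ (Space N)).hasTemperateGrowth
  exact Function.Complex.hasTemperateGrowth_ofReal.comp
    ((Function.hasTemperateGrowth_one_add_norm_sq_rpow (Space N) r).comp h1)

theorem jap_pow_eq_rpow (r : ℕ) (ξ : Space N) :
    jap ξ ^ r = (1 + ‖(2 * Real.pi) • ξ‖ ^ 2) ^ ((r : ℝ) / 2) := by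
  rw [jap, Real.sqrt_eq_rpow, ← Real.rpow_natCast, ← Real.rpow_mul (by positivity)]
  congr 1; ring

theorem symB_eq_rpow (r : ℕ) (ξ : Space N) :
    symB r ξ = (((1 + ‖(2 * Real.pi) • ξ‖ ^ 2) ^ (-((r : ℝ) / 2)) : ℝ) : ℂ) := by
  rw [Real.rpow_neg (by positivity), ← jap_pow_eq_rpow, symB_apply]
  push_cast; rfl

/-- The Bessel potential on Schwartz functions. -/
theorem exists_schwartz_bes (r : ℕ) (f : 𝓢(Space N, ℂ)) :
    ∃ g : 𝓢(Space N, ℂ), bes r (f.toLp 2) = g.toLp 2 :=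
  ⟨_, mult_toLp (symB r) (hasTemperateGrowth_jap_rpow _) (symB_eq_rpow r) f⟩

/-- Schwartz functions are in the range of the Bessel potentials. -/
theorem exists_schwartz_eq_bes (r : ℕ) (f : 𝓢(Space N, ℂ)) :
    ∃ g : 𝓢(Space N, ℂ), f.toLp 2 = bes r (g.toLp 2) := by
  refine ⟨fourierMultiplierCLM ℂ (fun ξ : Space N =>
    (((1 + ‖(2 * Real.pi) • ξ‖ ^ 2) ^ ((r : ℝ) / 2) : ℝ) : ℂ)) f, ?_⟩
  rw [bes, mult_toLp (symB r) (hasTemperateGrowth_jap_rpow _) (symB_eq_rpow r),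
    fourierMultiplierCLM_fourierMultiplierCLM_apply (hasTemperateGrowth_jap_rpow _)
      (hasTemperateGrowth_jap_rpow _)]
  congr 1
  have : ((fun ξ : Space N => (((1 + ‖(2 * Real.pi) • ξ‖ ^ 2) ^ (-((r : ℝ) / 2)) : ℝ) : ℂ)) *
    fun ξ : Space N => (((1 + ‖(2 * Real.pi) • ξ‖ ^ 2) ^ ((r : ℝ) / 2) : ℝ) : ℂ)) = fun _ => 1 := by
    funext ξ
    rw [Pi.mul_apply, ← Complex.ofReal_mul, ← Real.rpow_add (by positivity)]
    simp
  rw [this, fourierMultiplierCLM_const]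
  simp

theorem rie_toLp (i : Fin N) (f : 𝓢(Space N, ℂ)) :
    rie i (f.toLp 2) = bes 1 ((∂_{unitVec i} f).toLp 2) := by
  have h : 𝓕 (rie i (f.toLp 2 : L2C N)) = 𝓕 (bes 1 ((∂_{unitVec i} f).toLp 2 : L2C N)) := by
    rw [rie, bes, fourier_mult, fourier_mult, SchwartzMap.toLp_fourier_eq,
      SchwartzMap.toLp_fourier_eq, fourier_lineDerivOp_eq]
    apply Lp.ext
    have hg : (fun x : Space N => inner ℝ x (unitVec i)).HasTemperateGrowth :=
      Function.hasTemperateGrowth_inner_left _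
    filter_upwards [coeFn_mulOp (symD i) ((𝓕 f).toLp 2), (𝓕 f).coeFn_toLp 2,
      coeFn_mulOp (symB 1) (((2 * Real.pi * Complex.I) •
        smulLeftCLM ℂ (inner ℝ · (unitVec i)) (𝓕 f)).toLp 2),
      ((2 * Real.pi * Complex.I) •
        smulLeftCLM ℂ (inner ℝ · (unitVec i)) (𝓕 f)).coeFn_toLp 2] with ξ h₁ h₂ h₃ h₄
    rw [h₁, h₃, h₂, h₄, symD_apply, symB_apply, _root_.smul_apply,
      smulLeftCLM_apply_apply hg]
    simp only [EuclideanSpace.inner_single_right, Complex.real_smul, smul_eq_mul, pow_one]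
    simp
    ring
  exact (Lp.fourierTransformₗᵢ (Space N) ℂ).injective h

theorem rie_eq_of_toLp_eq_bes {i : Fin N} {κ : 𝓢(Space N, ℂ)} {f : L2C N}
    (h : κ.toLp 2 = bes 1 f) : (∂_{unitVec i} κ).toLp 2 = rie i f := by
  apply bes_injective 1
  rw [← rie_toLp, h, bes_rie]

/-- The pairing of an element of `L²` with a Schwartz function. -/
theorem inner_toLp_eq (θ : 𝓢(Space N, ℂ)) {v : Space N → ℝ} {f : L2C N}
    (h : (fun x => (v x : ℂ)) =ᵐ[volume] f) :
    inner ℂ (θ.toLp 2) f = ∫ x, conj (θ x) * (v x : ℂ) := by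
  rw [L2.inner_def]
  apply integral_congr_ae
  filter_upwards [θ.coeFn_toLp 2, h] with x h₁ h₂
  rw [h₁, ← h₂]
  simp [mul_comm]

/-- A test function as a complex-valued Schwartz function. -/
def IsTest.toSchwartz {χ : Space N → ℝ} (hχ : IsTest χ) : 𝓢(Space N, ℂ) :=
  HasCompactSupport.toSchwartzMap (f := fun x => (χ x : ℂ))
    (hχ.2.comp_left (g := fun r : ℝ => (r : ℂ)) rfl)
    (Complex.ofRealCLM.contDiff.comp hχ.1)

theorem IsTest.toSchwartz_apply {χ : Space N → ℝ} (hχ : IsTest χ) (x : Space N) :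
    hχ.toSchwartz x = (χ x : ℂ) := rfl

theorem IsTest.lineDeriv_toSchwartz {χ : Space N → ℝ} (hχ : IsTest χ) (i : Fin N) (x : Space N) :
    (∂_{unitVec i} hχ.toSchwartz) x = (SineGordon.partialD (fun _ : Fin 1 => i) χ x : ℂ) := by
  rw [lineDerivOp_apply_eq_fderiv, partialD_one]
  have h : HasFDerivAt (hχ.toSchwartz) (Complex.ofRealCLM.comp (fderiv ℝ χ x)) x :=
    Complex.ofRealCLM.hasFDerivAt.comp x
      ((hχ.1.differentiable (by simp)) x).hasFDerivAt
  rw [h.fderiv]; rfl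

theorem inner_toSchwartz {χ : Space N → ℝ} (hχ : IsTest χ) {v : Space N → ℝ} {f : L2C N}
    (h : (fun x => (v x : ℂ)) =ᵐ[volume] f) :
    inner ℂ (hχ.toSchwartz.toLp 2) f = ((∫ x, v x * χ x : ℝ) : ℂ) := by
  rw [inner_toLp_eq _ h, ← integral_complex_ofReal]
  simp [IsTest.toSchwartz_apply, mul_comm]

theorem inner_lineDeriv_toSchwartz {χ : Space N → ℝ} (hχ : IsTest χ) (i : Fin N)
    {v : Space N → ℝ} {f : L2C N} (h : (fun x => (v x : ℂ)) =ᵐ[volume] f) :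
    inner ℂ ((∂_{unitVec i} hχ.toSchwartz).toLp 2) f =
      ((∫ x, v x * partialD (fun _ : Fin 1 => i) χ x : ℝ) : ℂ) := by
  rw [inner_toLp_eq _ h, ← integral_complex_ofReal]
  simp [IsTest.lineDeriv_toSchwartz, mul_comm]

/-! ### Agreement of weak derivatives with Fourier multipliers -/

/-- The functions in the range of the Bessel potential of order one are weakly differentiable. -/
theorem weakD_of_rep {i : Fin N} {v g : Space N → ℝ} {y : L2C N} (hv : Rep 1 v y)
    (hg : (fun x => (g x : ℂ)) =ᵐ[volume] rie i y) : WeakD i v g := by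
  have hg0 : Rep 0 g (rie i y) := by rw [Rep, bes_zero]; exact hg
  refine ⟨hv.locallyIntegrable, hg0.locallyIntegrable, fun χ hχ => ?_⟩
  have h1 := inner_lineDeriv_toSchwartz hχ i hv
  have h2 := inner_toSchwartz hχ hg
  -- Moving `bes 1` to the test function turns its derivative into `rie i`, whose skew-adjointness
  -- is the integration by parts.
  rw [← inner_bes, ← rie_toLp, inner_rie, h2] at h1
  rw [pow_one, neg_one_mul]
  exact_mod_cast h1.symm

/-- One derivative of a function in `H^{s+1}`. -/
theorem Rep.weakD {s : ℕ} {v : Space N → ℝ} {y : L2C N} (h : Rep (s + 1) v y) (i : Fin N) :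
    WeakD i v (reF (bes s (rie i y))) ∧ Rep s (reF (bes s (rie i y))) (rie i y) := by
  have hc : conjL (rie i y) = rie i y := by rw [conjL_rie, h.conj]
  have h2 := rep_reF (s := s) hc
  refine ⟨weakD_of_rep (y := bes s y) ?_ ?_, h2⟩
  · rw [Rep, bes_bes, add_comm]; exact h
  · rw [← bes_rie]; exact h2

/-- A smooth cutoff sequence. -/
theorem exists_cutoff : ∃ η : ℕ → Space N → ℝ, ∃ C : ℝ, (∀ n, IsTest (η n)) ∧
    (∀ n x, |η n x| ≤ 1) ∧ (∀ x, Tendsto (fun n => η n x) atTop (𝓝 1)) ∧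
    (∀ n x i, |fderiv ℝ (η n) x (unitVec i)| ≤ C) ∧
    (∀ x i, Tendsto (fun n => fderiv ℝ (η n) x (unitVec i)) atTop (𝓝 0)) := by
  -- One fixed bump is dilated by the factors `c n = 1/(n+1)`, so its gradients are `O(1/n)`
  -- uniformly in `x`.
  let b : ContDiffBump (0 : Space N) := ⟨1, 2, one_pos, by norm_num⟩
  have hb : IsTest (b : Space N → ℝ) := ⟨b.contDiff, b.hasCompactSupport⟩
  obtain ⟨C, hC⟩ := (hb.2.fderiv (𝕜 := ℝ)).exists_bound_of_continuous
    (hb.1.continuous_fderiv (by simp))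
  have hC0 : 0 ≤ C := (norm_nonneg _).trans (hC 0)
  let c : ℕ → ℝ := fun n => ((n : ℝ) + 1)⁻¹
  have hc : ∀ n, 0 < c n := fun n => by positivity
  have hc1 : ∀ n, c n ≤ 1 := fun n => inv_le_one_of_one_le₀ (by
    have : (0 : ℝ) ≤ n := n.cast_nonneg
    linarith)
  have hct : Tendsto c atTop (𝓝 0) := tendsto_inv_atTop_zero.comp
    (tendsto_atTop_add_const_right _ _ tendsto_natCast_atTop_atTop)
  have hd : ∀ n x, fderiv ℝ (fun y => b (c n • y)) x = c n • fderiv ℝ b (c n • x) := fun n x => by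
    have h1 : HasFDerivAt (fun y : Space N => c n • y) (c n • ContinuousLinearMap.id ℝ _) x :=
      (hasFDerivAt_id x).const_smul (c n)
    have h2 : HasFDerivAt (b : Space N → ℝ) (fderiv ℝ b (c n • x)) (c n • x) :=
      ((hb.1.differentiable (by simp)) _).hasFDerivAt
    have h3 : HasFDerivAt (fun y => b (c n • y))
        ((fderiv ℝ b (c n • x)).comp (c n • ContinuousLinearMap.id ℝ _)) x := h2.comp x h1
    rw [h3.fderiv]
    ext y; simp
  have hu : ∀ i : Fin N, ‖(unitVec i : Space N)‖ = 1 := fun i => by simp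
  have hbd : ∀ n x i, |fderiv ℝ (fun y => b (c n • y)) x (unitVec i)| ≤ c n * C := fun n x i => by
    rw [hd, ← Real.norm_eq_abs]
    refine (ContinuousLinearMap.le_opNorm _ _).trans ?_
    rw [hu, mul_one, norm_smul, Real.norm_of_nonneg (hc n).le]
    exact mul_le_mul_of_nonneg_left (hC _) (hc n).le
  refine ⟨fun n x => b (c n • x), C, fun n => ⟨?_, ?_⟩, fun n x => ?_, fun x => ?_,
    fun n x i => ?_, fun x i => ?_⟩
  · exact b.contDiff.comp (contDiff_const_smul (c n))
  · exact hb.2.comp_smul (hc n).ne'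
  · rw [abs_of_nonneg b.nonneg]; exact b.le_one
  · have h1 : Tendsto (fun n => c n • x) atTop (𝓝 0) := by simpa using hct.smul_const x
    have h2 : Tendsto (b : Space N → ℝ) (𝓝 0) (𝓝 (b 0)) := hb.continuous.tendsto 0
    have h3 : b (0 : Space N) = 1 := b.one_of_mem_closedBall (by simp [b])
    rw [h3] at h2
    exact h2.comp h1
  · exact (hbd n x i).trans (by nlinarith [hc1 n])
  · rw [tendsto_zero_iff_abs_tendsto_zero]
    refine squeeze_zero (fun n => abs_nonneg _) (fun n => hbd n x i) ?_
    simpa using hct.mul_const C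

/-- In the definition of weak derivatives one can test with smooth functions in `H¹`. -/
theorem WeakD.integral_smooth {i : Fin N} {v g θ : Space N → ℝ} (h : WeakD i v g)
    (hv : MemLp v 2 volume) (hg : MemLp g 2 volume) (hθ : ContDiff ℝ ∞ θ) (hθ2 : MemLp θ 2 volume)
    (hθd : MemLp (fun x => fderiv ℝ θ x (unitVec i)) 2 volume) :
    ∫ x, v x * fderiv ℝ θ x (unitVec i) = -∫ x, g x * θ x := by
  obtain ⟨η, C, hη, hη1, hηt, hηd, hηdt⟩ := exists_cutoff (N := N)
  have hd : ∀ n x, fderiv ℝ (fun y => η n y * θ y) x (unitVec i) =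
      η n x * fderiv ℝ θ x (unitVec i) + θ x * fderiv ℝ (η n) x (unitVec i) := fun n x => by
    rw [fderiv_fun_mul (((hη n).1.differentiable (by simp)) x) ((hθ.differentiable (by simp)) x)]
    simp
  have htest : ∀ n, IsTest fun x => η n x * θ x := fun n =>
    ⟨(hη n).1.mul hθ, (hη n).2.mul_right⟩
  -- The test function is `η n * θ`. The extra term carries the gradient of the cutoff, bounded and
  -- tending to `0`, so dominated convergence removes it.
  have e : ∀ n, ∫ x, v x * (η n x * fderiv ℝ θ x (unitVec i) +
      θ x * fderiv ℝ (η n) x (unitVec i)) = -∫ x, g x * (η n x * θ x) := fun n => by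
    have := h.2.2 _ (htest n)
    simp only [partialD_one, hd, pow_one, neg_one_mul] at this
    exact this
  have i1 : Integrable (fun x => |v x| * |fderiv ℝ θ x (unitVec i)|) volume :=
    hv.abs.integrable_mul hθd.abs
  have i2 : Integrable (fun x => |v x| * |θ x|) volume := hv.abs.integrable_mul hθ2.abs
  have i3 : Integrable (fun x => |g x| * |θ x|) volume := hg.abs.integrable_mul hθ2.abs
  have l1 : Tendsto (fun n => ∫ x, v x * (η n x * fderiv ℝ θ x (unitVec i) +
      θ x * fderiv ℝ (η n) x (unitVec i))) atTop
      (𝓝 (∫ x, v x * fderiv ℝ θ x (unitVec i))) := by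
    refine tendsto_integral_of_dominated_convergence
      (fun x => |v x| * |fderiv ℝ θ x (unitVec i)| + C * (|v x| * |θ x|)) (fun n => ?_)
      (i1.add (i2.const_mul C)) (fun n => ae_of_all _ fun x => ?_) (ae_of_all _ fun x => ?_)
    · have hm : Continuous fun x => η n x * fderiv ℝ θ x (unitVec i) +
          θ x * fderiv ℝ (η n) x (unitVec i) := by
        have h1 := (hη n).continuous
        have h2 : Continuous fun x => fderiv ℝ θ x (unitVec i) :=
          (hθ.continuous_fderiv (by simp)).clm_apply continuous_const
        have h3 : Continuous fun x => fderiv ℝ (η n) x (unitVec i) :=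
          ((hη n).1.continuous_fderiv (by simp)).clm_apply continuous_const
        exact (h1.mul h2).add (hθ.continuous.mul h3)
      exact hv.1.mul hm.aestronglyMeasurable
    · rw [Real.norm_eq_abs, abs_mul]
      have a1 := hη1 n x
      have a2 := hηd n x i
      have : |η n x * fderiv ℝ θ x (unitVec i) + θ x * fderiv ℝ (η n) x (unitVec i)| ≤
          |fderiv ℝ θ x (unitVec i)| + C * |θ x| := by
        refine (abs_add_le _ _).trans ?_
        rw [abs_mul, abs_mul]
        nlinarith [abs_nonneg (fderiv ℝ θ x (unitVec i)), abs_nonneg (θ x)]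
      calc _ ≤ |v x| * (|fderiv ℝ θ x (unitVec i)| + C * |θ x|) := by gcongr
        _ = _ := by ring
    · have := (((hηt x).mul_const (fderiv ℝ θ x (unitVec i))).add
        ((hηdt x i).const_mul (θ x))).const_mul (v x)
      simpa using this
  have l2 : Tendsto (fun n => -∫ x, g x * (η n x * θ x)) atTop (𝓝 (-∫ x, g x * θ x)) := by
    refine (tendsto_integral_of_dominated_convergence (fun x => |g x| * |θ x|) (fun n => ?_) i3
      (fun n => ae_of_all _ fun x => ?_) (ae_of_all _ fun x => ?_)).neg
    · exact hg.1.mul ((hη n).continuous.mul hθ.continuous).aestronglyMeasurable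
    · rw [Real.norm_eq_abs, abs_mul, abs_mul]
      have a1 := hη1 n x
      have : |η n x| * |θ x| ≤ |θ x| := by nlinarith [abs_nonneg (θ x)]
      gcongr
    · simpa using ((hηt x).mul_const (θ x)).const_mul (g x)
  simp only [e] at l1
  exact tendsto_nhds_unique l1 l2

/-- Schwartz functions lack compact support and are complex, hence the use of
`WeakD.integral_smooth` on real and imaginary parts. -/
theorem WeakD.inner_lineDeriv {i : Fin N} {v g : Space N → ℝ} {f k : L2C N} (h : WeakD i v g)
    (hv : (fun x => (v x : ℂ)) =ᵐ[volume] f) (hg : (fun x => (g x : ℂ)) =ᵐ[volume] k)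
    (θ : 𝓢(Space N, ℂ)) :
    inner ℂ ((∂_{unitVec i} θ).toLp 2) f = -inner ℂ (θ.toLp 2) k := by
  have hv2 : MemLp v 2 volume := Rep.memLp (s := 0) (y := f) (by rwa [Rep, bes_zero])
  have hg2 : MemLp g 2 volume := Rep.memLp (s := 0) (y := k) (by rwa [Rep, bes_zero])
  rw [inner_toLp_eq _ hv, inner_toLp_eq _ hg]
  have key : ∀ L : ℂ →L[ℝ] ℝ, ∫ x, v x * L ((∂_{unitVec i} θ) x) = -∫ x, g x * L (θ x) := by
    intro L
    have hd : ∀ x, fderiv ℝ (fun x => L (θ x)) x (unitVec i) = L ((∂_{unitVec i} θ) x) := fun x => by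
      rw [lineDerivOp_apply_eq_fderiv]
      have h1 : HasFDerivAt (fun x => L (θ x)) (L.comp (fderiv ℝ θ x)) x :=
        L.hasFDerivAt.comp x (θ.hasFDerivAt x)
      rw [h1.fderiv]; rfl
    have := h.integral_smooth (θ := fun x => L (θ x)) hv2 hg2 (L.contDiff.comp (θ.smooth _))
      (L.comp_memLp' (θ.memLp 2)) (by
        simp only [hd]; exact L.comp_memLp' ((∂_{unitVec i} θ).memLp 2))
    simpa only [hd] using this
  have hInt : ∀ (w : Space N → ℝ) (κ : 𝓢(Space N, ℂ)), MemLp w 2 volume →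
      Integrable (fun x => conj (κ x) * (w x : ℂ)) volume := fun w κ hw => by
    have h1 : MemLp (fun x => conj (κ x)) 2 volume :=
      (Complex.conjCLE : ℂ →L[ℝ] ℂ).comp_memLp' (κ.memLp 2)
    exact h1.integrable_mul (hw.ofReal (K := ℂ))
  apply Complex.ext
  · have h1 := key Complex.reCLM
    rw [← Complex.reCLM_apply, ← Complex.reCLM_apply, map_neg,
      ← ContinuousLinearMap.integral_comp_comm _ (hInt _ _ hv2),
      ← ContinuousLinearMap.integral_comp_comm _ (hInt _ _ hg2)]
    simpa [mul_comm] using h1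
  · have h1 := key Complex.imCLM
    rw [← Complex.imCLM_apply, ← Complex.imCLM_apply, map_neg,
      ← ContinuousLinearMap.integral_comp_comm _ (hInt _ _ hv2),
      ← ContinuousLinearMap.integral_comp_comm _ (hInt _ _ hg2)]
    simpa [mul_comm, integral_neg, neg_eq_iff_eq_neg] using h1

/-- A function in `L²` with weak derivatives in `L²` is in `H¹`. -/
theorem exists_rep_one {v : Space N → ℝ} {g : Fin N → Space N → ℝ} {f : L2C N} {k : Fin N → L2C N}
    (hv : (fun x => (v x : ℂ)) =ᵐ[volume] f) (hg : ∀ i, (fun x => (g i x : ℂ)) =ᵐ[volume] k i)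
    (h : ∀ i, WeakD i v (g i)) : Rep 1 v (bes 1 f - ∑ i, rie i (k i)) := by
  rw [Rep]
  -- Formally `(1 - Δ)⁻¹ (v - ∑ ∂ᵢ gᵢ) = v`. This is checked against Schwartz functions `χ`, the
  -- derivatives being moved to `κ = (1 - Δ)⁻¹ χ`, which is again a Schwartz function.
  suffices hh : bes 1 (bes 1 f - ∑ i, rie i (k i)) = f by rw [hh]; exact hv
  refine dense_schwartz.eq_of_inner_right (𝕜 := ℂ) (fun χ => ?_)
  obtain ⟨κ, hκ⟩ := exists_schwartz_bes 2 χ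
  rw [← bes_bes 1 1] at hκ
  have e1 : ∀ i, (∂_{unitVec i} κ : 𝓢(Space N, ℂ)).toLp 2 = rie i (bes 1 (χ.toLp 2)) := fun i =>
    rie_eq_of_toLp_eq_bes hκ.symm
  have e2 : ∀ i, (∂_{unitVec i} (∂_{unitVec i} κ : 𝓢(Space N, ℂ)) : 𝓢(Space N, ℂ)).toLp 2 = rie i (rie i (χ.toLp 2)) := fun i =>
    rie_eq_of_toLp_eq_bes ((e1 i).trans (bes_rie 1 i _).symm)
  rw [← inner_bes, inner_sub_right, inner_sum]
  have e3 : ∀ i, inner ℂ (bes 1 (χ.toLp 2)) (rie i (k i)) = inner ℂ (rie i (rie i (χ.toLp 2))) f :=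
      fun i => by
    have h1 := (h i).inner_lineDeriv hv (hg i) (∂_{unitVec i} κ)
    rw [e2, e1, inner_rie i (bes 1 _) (k i)] at h1
    rw [h1, neg_neg]
  simp only [e3]
  rw [← inner_bes, bes_bes, ← sum_inner, ← inner_sub_left]
  rw [bes_two_sub_sum_rie]

/-- A function in `H^s` with weak derivatives in `H^s` is in `H^{s+1}`. -/
theorem rep_succ {s : ℕ} {v : Space N → ℝ} {g : Fin N → Space N → ℝ} {γ : L2C N}
    {β : Fin N → L2C N} (hv : Rep s v γ) (hg : ∀ i, Rep s (g i) (β i))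
    (h : ∀ i, WeakD i v (g i)) : Rep (s + 1) v (bes 1 γ - ∑ i, rie i (β i)) := by
  have h1 := exists_rep_one hv hg h
  have : bes 1 (bes s γ) - ∑ i, rie i (bes s (β i)) = bes s (bes 1 γ - ∑ i, rie i (β i)) := by
    rw [map_sub, map_sum, bes_bes, bes_bes, add_comm]
    simp only [bes_rie]
  rw [this] at h1
  rw [Rep] at h1 ⊢
  rwa [bes_bes, add_comm] at h1

end

end SineGordon

namespace SineGordon

noncomputable section

variable {N : ℕ}

/-! ### The Sobolev norms -/

theorem weakDerivNorm_cons {m : ℕ} {i : Fin N} {v a : Space N → ℝ} (h : WeakD i v a)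
    (β : Fin m → Fin N) :
    weakDerivNorm (Fin.cons i β : Fin (m + 1) → Fin N) v = weakDerivNorm β a := by
  unfold weakDerivNorm
  have e : ∀ g, IsWeakDeriv (Fin.cons i β : Fin (m + 1) → Fin N) v g ↔ IsWeakDeriv β a g :=
    fun g => ⟨fun h' => IsWeakDeriv.of_cons h h', fun h' => IsWeakDeriv.cons h h'⟩
  simp only [e]

theorem orderNormSq_succ {v : Space N → ℝ} {a : Fin N → Space N → ℝ} (h : ∀ i, WeakD i v (a i))
    (m : ℕ) : orderNormSq (m + 1) v = ∑ i, orderNormSq m (a i) := by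
  unfold orderNormSq
  rw [← Fintype.sum_prod_type']
  refine (Fintype.sum_equiv (Fin.consEquiv fun _ : Fin (m + 1) => Fin N) _ _ fun p => ?_).symm
  rw [← weakDerivNorm_cons (h p.1) p.2]
  rfl

theorem orderNormSq_congr {v w : Space N → ℝ} (h : v =ᵐ[volume] w) (m : ℕ) :
    orderNormSq m v = orderNormSq m w := by
  unfold orderNormSq weakDerivNorm
  have e : ∀ (α : Fin m → Fin N) g, IsWeakDeriv α v g ↔ IsWeakDeriv α w g :=
    fun α g => ⟨fun h' => h'.congr h (ae_eq_refl _), fun h' => h'.congr h.symm (ae_eq_refl _)⟩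
  simp only [e]

theorem hNorm_congr {v w : Space N → ℝ} (h : v =ᵐ[volume] w) (s : ℕ) :
    hNorm s v = hNorm s w := by
  unfold hNorm
  simp only [orderNormSq_congr h]

theorem MemH.congr {s : ℕ} {v w : Space N → ℝ} (hv : MemH s v) (h : v =ᵐ[volume] w) : MemH s w :=
  fun m hm α => let ⟨g, h1, h2⟩ := hv m hm α; ⟨g, h1.congr h (ae_eq_refl _), h2⟩

theorem hNorm_sq (s : ℕ) (v : Space N → ℝ) :
    hNorm s v ^ 2 = ∑ m ∈ Finset.range (s + 1), orderNormSq m v := by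
  rw [hNorm, ← ENNReal.rpow_natCast, ← ENNReal.rpow_mul]
  norm_num

theorem hNorm_mono {r s : ℕ} (h : r ≤ s) (v : Space N → ℝ) : hNorm r v ≤ hNorm s v := by
  unfold hNorm
  gcongr

theorem MemH.mono {r s : ℕ} (h : r ≤ s) {v : Space N → ℝ} (hv : MemH s v) : MemH r v :=
  fun m hm α => hv m (hm.trans h) α

theorem hNorm_weakD_le {v : Space N → ℝ} {a : Fin N → Space N → ℝ} (h : ∀ i, WeakD i v (a i))
    (s : ℕ) (i : Fin N) : hNorm s (a i) ≤ hNorm (s + 1) v := by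
  unfold hNorm
  gcongr
  rw [Finset.sum_range_succ' _ (s + 1)]
  refine le_add_right (Finset.sum_le_sum fun m _ => ?_)
  rw [orderNormSq_succ h]
  exact Finset.single_le_sum (f := fun i => orderNormSq m (a i)) (fun _ _ => zero_le) (Finset.mem_univ i)

/-- A derivative lowers the order by one and applies `rie` to the representative; `rie` is a
contraction, so norms do not grow. -/
theorem Rep.exists_weakDeriv {m : ℕ} : ∀ {s : ℕ} {v : Space N → ℝ} {y : L2C N}, m ≤ s →
    Rep s v y → ∀ α : Fin m → Fin N, ∃ g z, IsWeakDeriv α v g ∧ Rep (s - m) g z ∧ ‖z‖ ≤ ‖y‖ := by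
  induction m with
  | zero =>
    intro s v y _ h α
    exact ⟨v, y, isWeakDeriv_zero_iff.mpr ⟨h.locallyIntegrable, ae_eq_refl _⟩, h, le_rfl⟩
  | succ m ih =>
    intro s v y hs h α
    obtain ⟨s, rfl⟩ : ∃ r, s = r + 1 := ⟨s - 1, by omega⟩
    obtain ⟨h1, h2⟩ := h.weakD (α 0)
    obtain ⟨g, z, hg, hz, hn⟩ := ih (by omega) h2 (Fin.tail α)
    refine ⟨g, z, ?_, by rwa [Nat.add_sub_add_right], hn.trans (norm_rie_le _ _)⟩
    have := IsWeakDeriv.cons h1 hg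
    rwa [Fin.cons_self_tail] at this

theorem Rep.memH {s : ℕ} {v : Space N → ℝ} {y : L2C N} (h : Rep s v y) : MemH s v :=
  fun _ hm α => let ⟨g, _, h1, h2, _⟩ := h.exists_weakDeriv hm α; ⟨g, h1, h2.memLp⟩

/-- The number of partial derivatives of order at most `s`. -/
def cUp (N s : ℕ) : ℕ := ∑ m ∈ Finset.range (s + 1), N ^ m

theorem one_le_cUp (N s : ℕ) : 1 ≤ cUp N s := by
  rw [cUp, Finset.sum_range_succ']
  simp

theorem Rep.hNorm_le {s : ℕ} {v : Space N → ℝ} {y : L2C N} (h : Rep s v y) :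
    hNorm s v ≤ ENNReal.ofReal (cUp N s * ‖y‖) := by
  have h1 : ∀ m ∈ Finset.range (s + 1), orderNormSq m v ≤ (N ^ m : ℕ) * ENNReal.ofReal ‖y‖ ^ 2 := by
    intro m hm
    have hm' : m ≤ s := by simpa [Nat.lt_succ_iff] using hm
    have h2 : ∀ α : Fin m → Fin N, weakDerivNorm α v ^ 2 ≤ ENNReal.ofReal ‖y‖ ^ 2 := fun α => by
      obtain ⟨g, z, hg, hz, hn⟩ := h.exists_weakDeriv hm' α
      rw [weakDerivNorm_eq hg, hz.eLpNorm_eq]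
      gcongr
      exact (norm_bes_le _ _).trans hn
    refine (Finset.sum_le_sum fun α _ => h2 α).trans ?_
    rw [Finset.sum_const, nsmul_eq_mul, Finset.card_univ, Fintype.card_fun, Fintype.card_fin,
      Fintype.card_fin]
  have h3 : hNorm s v ^ 2 ≤ (cUp N s * ENNReal.ofReal ‖y‖) ^ 2 := by
    rw [hNorm_sq]
    refine (Finset.sum_le_sum h1).trans ?_
    rw [← Finset.sum_mul, ← Nat.cast_sum, mul_pow]
    gcongr
    change ((cUp N s : ℕ) : ℝ≥0∞) ≤ _
    exact_mod_cast Nat.le_self_pow (by norm_num) _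
  rw [ENNReal.ofReal_mul (by positivity), ENNReal.ofReal_natCast]
  exact (ENNReal.pow_le_pow_left_iff (by norm_num)).mp h3

/-- The constant bounding the norm of the Bessel potential space by the Sobolev norm. -/
def cLo (N s : ℕ) : ℝ := (1 + N : ℝ) ^ s

theorem cLo_pos (N s : ℕ) : 0 < cLo N s := by unfold cLo; positivity

/-- Induction on `s` through `rep_succ`: the function and its `N` first derivatives each contribute
the previous constant, whence the factor `1 + N` at each step. -/
theorem MemH.exists_rep {s : ℕ} : ∀ {v : Space N → ℝ}, MemH s v → ∃ y, Rep s v y ∧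
    ENNReal.ofReal ‖y‖ ≤ ENNReal.ofReal (cLo N s) * hNorm s v := by
  induction s with
  | zero =>
    intro v h
    obtain ⟨g, hg, hg2⟩ := h 0 le_rfl Fin.elim0
    rw [isWeakDeriv_zero_iff] at hg
    obtain ⟨y, hy⟩ := exists_rep_zero hg2
    have hy' := hy.congr hg.2.symm
    refine ⟨y, hy', ?_⟩
    have e := hy'.eLpNorm_eq
    rw [bes_zero] at e
    rw [← e, cLo, pow_zero, ENNReal.ofReal_one, one_mul]
    rw [← ENNReal.pow_le_pow_left_iff two_ne_zero, hNorm_sq, Finset.sum_range_one]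
    unfold orderNormSq
    rw [Fintype.sum_unique, weakDerivNorm_eq (isWeakDeriv_zero_iff.mpr ⟨hg.1, ae_eq_refl _⟩)]
  | succ s ih =>
    intro v h
    have h1 : ∀ i, ∃ a, WeakD i v a ∧ MemLp a 2 volume := fun i => h 1 (by omega) _
    choose a ha _ using h1
    have h2 : ∀ i, MemH s (a i) := fun i m hm β => by
      obtain ⟨g, hg, hg2⟩ := h (m + 1) (by omega) (Fin.cons i β)
      exact ⟨g, IsWeakDeriv.of_cons (ha i) hg, hg2⟩
    obtain ⟨γ, hγ, hγn⟩ := ih (h.mono (Nat.le_succ s))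
    choose β hβ hβn using fun i => ih (h2 i)
    refine ⟨_, rep_succ hγ hβ ha, ?_⟩
    have n1 : ‖bes 1 γ - ∑ i, rie i (β i)‖ ≤ ‖γ‖ + ∑ i, ‖β i‖ :=
      (norm_sub_le _ _).trans (add_le_add (norm_bes_le _ _)
        ((norm_sum_le _ _).trans (Finset.sum_le_sum fun i _ => norm_rie_le _ _)))
    refine (ENNReal.ofReal_le_ofReal n1).trans ?_
    rw [ENNReal.ofReal_add (norm_nonneg _) (Finset.sum_nonneg fun _ _ => norm_nonneg _),
      ENNReal.ofReal_sum_of_nonneg fun _ _ => norm_nonneg _]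
    calc _ ≤ ENNReal.ofReal (cLo N s) * hNorm (s + 1) v +
        ∑ _i : Fin N, ENNReal.ofReal (cLo N s) * hNorm (s + 1) v := by
          gcongr with i
          · exact hγn.trans (by gcongr; exact hNorm_mono (Nat.le_succ s) v)
          · exact (hβn i).trans (by gcongr; exact hNorm_weakD_le ha s i)
      _ = ENNReal.ofReal (cLo N (s + 1)) * hNorm (s + 1) v := by
        rw [Finset.sum_const, nsmul_eq_mul, Finset.card_univ, Fintype.card_fin, cLo, cLo, pow_succ,
          ENNReal.ofReal_mul (by positivity),
          ENNReal.ofReal_add zero_le_one (by positivity), ENNReal.ofReal_one,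
          ENNReal.ofReal_natCast]
        ring

theorem Rep.norm_le {s : ℕ} {v : Space N → ℝ} {y : L2C N} (h : Rep s v y) :
    ENNReal.ofReal ‖y‖ ≤ ENNReal.ofReal (cLo N s) * hNorm s v := by
  obtain ⟨y', hy', hn⟩ := h.memH.exists_rep
  rwa [h.unique hy']

theorem memH_iff {s : ℕ} {v : Space N → ℝ} : MemH s v ↔ ∃ y, Rep s v y :=
  ⟨fun h => let ⟨y, hy, _⟩ := h.exists_rep; ⟨y, hy⟩, fun ⟨_, hy⟩ => hy.memH⟩

theorem MemH.add {s : ℕ} {v w : Space N → ℝ} (hv : MemH s v) (hw : MemH s w) : MemH s (v + w) := by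
  rw [memH_iff] at *
  obtain ⟨y, hy⟩ := hv
  obtain ⟨z, hz⟩ := hw
  exact ⟨_, hy.add hz⟩

theorem MemH.smul {s : ℕ} {v : Space N → ℝ} (c : ℝ) (hv : MemH s v) : MemH s (c • v) := by
  rw [memH_iff] at *
  obtain ⟨y, hy⟩ := hv
  exact ⟨_, hy.smul c⟩

theorem MemH.neg {s : ℕ} {v : Space N → ℝ} (hv : MemH s v) : MemH s (-v) := by
  simpa using hv.smul (-1)

theorem MemH.sub {s : ℕ} {v w : Space N → ℝ} (hv : MemH s v) (hw : MemH s w) : MemH s (v - w) := by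
  simpa [sub_eq_add_neg] using hv.add hw.neg

/-- Convergence in `H^s` of functions is convergence in the Bessel potential space. -/
theorem tendsto_hNorm_iff {ι : Type*} {l : Filter ι} {s : ℕ} {v : ι → Space N → ℝ}
    {y : ι → L2C N} (h : ∀ᶠ i in l, Rep s (v i) (y i)) :
    Tendsto (fun i => hNorm s (v i)) l (𝓝 0) ↔ Tendsto y l (𝓝 0) := by
  constructor
  · intro h1
    rw [tendsto_zero_iff_norm_tendsto_zero]
    have h2 : Tendsto (fun i => ENNReal.ofReal ‖y i‖) l (𝓝 0) := by
      refine tendsto_of_tendsto_of_tendsto_of_le_of_le' tendsto_const_nhds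
        (h := fun i => ENNReal.ofReal (cLo N s) * hNorm s (v i)) ?_
        (Eventually.of_forall fun _ => zero_le) (h.mono fun i hi => hi.norm_le)
      simpa using ENNReal.Tendsto.const_mul h1 (Or.inr ENNReal.ofReal_ne_top)
    have h3 := (ENNReal.tendsto_toReal ENNReal.zero_ne_top).comp h2
    simpa [Function.comp_def] using h3
  · intro h1
    refine tendsto_of_tendsto_of_tendsto_of_le_of_le' tendsto_const_nhds
        (h := fun i => ENNReal.ofReal (cUp N s * ‖y i‖)) ?_
        (Eventually.of_forall fun _ => zero_le) (h.mono fun i hi => hi.hNorm_le)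
    have := (ENNReal.continuous_ofReal.tendsto _).comp (h1.norm.const_mul (cUp N s : ℝ))
    simpa [Function.comp_def] using this

/-! ### The spaces `H_sin^k` -/

/-- The gradient of `v` is in `H^s`, with `(1 - Δ)^{s/2} ∂_i v = α i`. -/
def GradRep (s : ℕ) (v : Space N → ℝ) (α : Fin N → L2C N) : Prop :=
  ∀ i, WeakD i v (reF (bes s (α i))) ∧ conjL (α i) = α i

theorem GradRep.rep {s : ℕ} {v : Space N → ℝ} {α : Fin N → L2C N} (h : GradRep s v α) (i : Fin N) :
    Rep s (reF (bes s (α i))) (α i) := rep_reF (h i).2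

theorem gradRep_of {s : ℕ} {v : Space N → ℝ} {a : Fin N → Space N → ℝ} {α : Fin N → L2C N}
    (h : ∀ i, WeakD i v (a i)) (h' : ∀ i, Rep s (a i) (α i)) : GradRep s v α := fun i =>
  ⟨(h i).congr (ae_eq_refl _) ((h' i).ae_eq (rep_reF (h' i).conj)), (h' i).conj⟩

theorem GradRep.add {s : ℕ} {v w : Space N → ℝ} {α β : Fin N → L2C N} (h : GradRep s v α)
    (h' : GradRep s w β) : GradRep s (v + w) (α + β) :=
  gradRep_of (fun i => (h i).1.add (h' i).1) fun i => (h.rep i).add (h'.rep i)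

theorem GradRep.sub {s : ℕ} {v w : Space N → ℝ} {α β : Fin N → L2C N} (h : GradRep s v α)
    (h' : GradRep s w β) : GradRep s (v - w) (α - β) :=
  gradRep_of (fun i => (h i).1.sub (h' i).1) fun i => (h.rep i).sub (h'.rep i)

theorem GradRep.mono {s r : ℕ} {v : Space N → ℝ} {α : Fin N → L2C N} (h : GradRep (s + r) v α) :
    GradRep s v fun i => bes r (α i) :=
  gradRep_of (fun i => (h i).1) fun i => (h.rep i).mono

theorem Rep.gradRep {s : ℕ} {v : Space N → ℝ} {y : L2C N} (h : Rep (s + 1) v y) :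
    GradRep s v fun i => rie i y :=
  gradRep_of (fun i => (h.weakD i).1) fun i => (h.weakD i).2

/-- Only the gradient is given a representative, since a function of `H_sin`, for instance the
constant `π`, need not be in `L²`. -/
theorem memHsin_iff {s : ℕ} {v : Space N → ℝ} : MemHsin (s + 1) v ↔
    LocallyIntegrable v volume ∧ (∃ α, GradRep s v α) ∧
      MemLp (fun x => Real.sin (v x)) 2 volume := by
  constructor
  · rintro ⟨h1, h2, h3⟩
    refine ⟨h1, ?_, h3⟩
    have h4 : ∀ i, ∃ a, WeakD i v a ∧ MemLp a 2 volume := fun i => h2 1 le_rfl (by omega) _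
    choose a ha _ using h4
    have h5 : ∀ i, MemH s (a i) := fun i m hm β => by
      obtain ⟨g, hg, hg2⟩ := h2 (m + 1) (by omega) (by omega) (Fin.cons i β)
      exact ⟨g, IsWeakDeriv.of_cons (ha i) hg, hg2⟩
    choose α hα using fun i => memH_iff.mp (h5 i)
    exact ⟨α, gradRep_of ha hα⟩
  · rintro ⟨h1, ⟨α, hα⟩, h3⟩
    refine ⟨h1, fun m hm hms β => ?_, h3⟩
    obtain ⟨m, rfl⟩ : ∃ r, m = r + 1 := ⟨m - 1, by omega⟩
    obtain ⟨g, hg, hg2⟩ := (hα.rep (β 0)).memH m (by omega) (Fin.tail β)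
    refine ⟨g, ?_, hg2⟩
    have := IsWeakDeriv.cons (hα (β 0)).1 hg
    rwa [Fin.cons_self_tail] at this

theorem dsin_sq {s : ℕ} {v w : Space N → ℝ} {a : Fin N → Space N → ℝ}
    (h : ∀ i, WeakD i (v - w) (a i)) : dsin (s + 1) v w ^ 2 =
      eLpNorm (fun x => Real.sin (v x - w x)) 2 volume ^ 2 + ∑ i, hNorm s (a i) ^ 2 := by
  rw [dsin, ← ENNReal.rpow_natCast, ← ENNReal.rpow_mul]
  norm_num
  congr 1
  simp only [hNorm_sq]
  rw [Finset.sum_comm, Finset.range_eq_Ico, ← Finset.Ico_add_one_right_eq_Icc,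
    show (1 : ℕ) = 0 + 1 from rfl, ← Finset.sum_Ico_add' (fun m => orderNormSq m (v - w)) 0 (s + 1) 1]
  exact Finset.sum_congr rfl fun m _ => orderNormSq_succ h m

theorem eLpNorm_sin_le_dsin (k : ℕ) (v w : Space N → ℝ) :
    eLpNorm (fun x => Real.sin (v x - w x)) 2 volume ≤ dsin k v w := by
  have : eLpNorm (fun x => Real.sin (v x - w x)) 2 volume =
      (eLpNorm (fun x => Real.sin (v x - w x)) 2 volume ^ 2) ^ (1 / 2 : ℝ) := by
    rw [← ENNReal.rpow_natCast, ← ENNReal.rpow_mul]; norm_num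
  rw [this, dsin]
  gcongr
  exact le_add_right le_rfl

theorem hNorm_le_dsin {s : ℕ} {v w : Space N → ℝ} {a : Fin N → Space N → ℝ}
    (h : ∀ i, WeakD i (v - w) (a i)) (i : Fin N) : hNorm s (a i) ≤ dsin (s + 1) v w := by
  rw [← ENNReal.pow_le_pow_left_iff two_ne_zero, dsin_sq h]
  refine le_add_left ?_
  exact Finset.single_le_sum (f := fun i => hNorm s (a i) ^ 2) (fun _ _ => zero_le) (Finset.mem_univ i)

theorem dsin_le {s : ℕ} {v w : Space N → ℝ} {a : Fin N → Space N → ℝ}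
    (h : ∀ i, WeakD i (v - w) (a i)) : dsin (s + 1) v w ≤
      eLpNorm (fun x => Real.sin (v x - w x)) 2 volume + ∑ i, hNorm s (a i) := by
  rw [← ENNReal.pow_le_pow_left_iff two_ne_zero, dsin_sq h]
  have h1 : ∀ t : Finset (Fin N), ∑ i ∈ t, hNorm s (a i) ^ 2 ≤ (∑ i ∈ t, hNorm s (a i)) ^ 2 := by
    intro t
    classical
    induction t using Finset.induction_on with
    | empty => simp
    | insert j t hj ih =>
      rw [Finset.sum_insert hj, Finset.sum_insert hj, add_sq]
      calc _ ≤ hNorm s (a j) ^ 2 + (∑ i ∈ t, hNorm s (a i)) ^ 2 := by gcongr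
        _ ≤ _ := by gcongr; exact le_add_right le_rfl
  calc _ ≤ eLpNorm (fun x => Real.sin (v x - w x)) 2 volume ^ 2 + (∑ i, hNorm s (a i)) ^ 2 := by
        gcongr; exact h1 _
    _ ≤ _ := by rw [add_sq]; gcongr; exact le_add_right le_rfl

theorem GradRep.norm_le_dsin {s : ℕ} {v w : Space N → ℝ} {α : Fin N → L2C N}
    (h : GradRep s (v - w) α) (i : Fin N) :
    ENNReal.ofReal ‖α i‖ ≤ ENNReal.ofReal (cLo N s) * dsin (s + 1) v w := by
  refine (h.rep i).norm_le.trans ?_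
  gcongr
  exact hNorm_le_dsin (fun i => (h i).1) i

theorem GradRep.dsin_le {s : ℕ} {v w : Space N → ℝ} {α : Fin N → L2C N}
    (h : GradRep s (v - w) α) : dsin (s + 1) v w ≤
      eLpNorm (fun x => Real.sin (v x - w x)) 2 volume + ENNReal.ofReal (cUp N s * ∑ i, ‖α i‖) := by
  refine (SineGordon.dsin_le fun i => (h i).1).trans ?_
  gcongr
  rw [Finset.mul_sum, ENNReal.ofReal_sum_of_nonneg fun _ _ => by positivity]
  exact Finset.sum_le_sum fun i _ => (h.rep i).hNorm_le

end

end SineGordon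

namespace SineGordon

noncomputable section

open FourierTransform SchwartzMap LineDeriv
open scoped ComplexConjugate

variable {N : ℕ}

/-! ### Products in Sobolev spaces -/

theorem ofReal_norm_sq_eq_lintegral (f : L2C N) :
    ENNReal.ofReal ‖f‖ ^ 2 = ∫⁻ x, ‖f x‖ₑ ^ 2 := by
  rw [ofReal_norm, Lp.enorm_def, eLpNorm_eq_lintegral_rpow_enorm_toReal (by norm_num) (by norm_num),
    ← ENNReal.rpow_natCast, ← ENNReal.rpow_mul]
  norm_num

theorem sq_lintegral_mul_le {α : Type*} [MeasurableSpace α] {μ : Measure α} {w h : α → ℝ≥0∞}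
    (hw : AEMeasurable w μ) (hh : AEMeasurable h μ) :
    (∫⁻ t, w t * h t ∂μ) ^ 2 ≤ (∫⁻ t, w t ^ 2 ∂μ) * ∫⁻ t, h t ^ 2 ∂μ := by
  have := ENNReal.lintegral_mul_le_Lp_mul_Lq μ Real.HolderConjugate.two_two hw hh
  simp only [Pi.mul_apply] at this
  calc _ ≤ ((∫⁻ t, w t ^ (2 : ℝ) ∂μ) ^ (1 / 2 : ℝ) * (∫⁻ t, h t ^ (2 : ℝ) ∂μ) ^ (1 / 2 : ℝ)) ^ 2 := by
        gcongr
    _ = _ := by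
        rw [mul_pow, ← ENNReal.rpow_natCast, ← ENNReal.rpow_natCast, ← ENNReal.rpow_mul,
          ← ENNReal.rpow_mul]
        norm_num

/-- Cauchy-Schwarz for the splitting `w h = w^{1/2} · (w^{1/2} h)`. -/
theorem sq_lintegral_weight_le {α : Type*} [MeasurableSpace α] {μ : Measure α} {w h : α → ℝ≥0∞}
    (hw : AEMeasurable w μ) (hh : AEMeasurable h μ) :
    (∫⁻ t, w t * h t ∂μ) ^ 2 ≤ (∫⁻ t, w t ∂μ) * ∫⁻ t, w t * h t ^ 2 ∂μ := by
  have hr : ∀ x : ℝ≥0∞, x ^ (1 / 2 : ℝ) * x ^ (1 / 2 : ℝ) = x := fun x => by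
    rw [← ENNReal.rpow_add_of_nonneg _ _ (by norm_num) (by norm_num)]; norm_num
  have := sq_lintegral_mul_le (hw.pow_const (1 / 2 : ℝ)) ((hw.pow_const (1 / 2 : ℝ)).mul hh)
  simp only [Pi.mul_apply, ← mul_assoc, hr, sq, mul_mul_mul_comm _ (h _)] at this ⊢
  exact this

/-- A form of Young's inequality. -/
theorem lintegral_sq_lintegral_le {α β : Type*} [MeasurableSpace α] [MeasurableSpace β]
    {μ : Measure α} {ν : Measure β} [SFinite μ] [SFinite ν] {w : α → ℝ≥0∞} {h : β → α → ℝ≥0∞}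
    (hw : Measurable w) (hh : Measurable (Function.uncurry h)) {A : ℝ≥0∞}
    (hA : ∀ t, ∫⁻ ξ, h ξ t ^ 2 ∂ν ≤ A) :
    ∫⁻ ξ, (∫⁻ t, w t * h ξ t ∂μ) ^ 2 ∂ν ≤ (∫⁻ t, w t ∂μ) ^ 2 * A := by
  have h1 : ∀ ξ, Measurable (h ξ) := fun ξ => hh.comp measurable_prodMk_left
  have h2 : Measurable (Function.uncurry fun ξ t => w t * h ξ t ^ 2) :=
    (hw.comp measurable_snd).mul (hh.pow_const 2)
  -- Weighted Cauchy-Schwarz in `t`, then Tonelli, so that `A` can be used for each fixed `t`.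
  calc _ ≤ ∫⁻ ξ, (∫⁻ t, w t ∂μ) * ∫⁻ t, w t * h ξ t ^ 2 ∂μ ∂ν :=
        lintegral_mono fun ξ => sq_lintegral_weight_le hw.aemeasurable (h1 ξ).aemeasurable
    _ = (∫⁻ t, w t ∂μ) * ∫⁻ t, ∫⁻ ξ, w t * h ξ t ^ 2 ∂ν ∂μ := by
        rw [lintegral_lintegral_swap (f := fun t ξ => w t * h ξ t ^ 2)
          (h2.comp measurable_swap).aemeasurable]
        exact lintegral_const_mul _ h2.lintegral_prod_right'
    _ ≤ (∫⁻ t, w t ∂μ) * ∫⁻ t, w t * A ∂μ := by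
        gcongr with t
        have h3 : Measurable fun ξ => h ξ t ^ 2 :=
          (hh.comp (measurable_id.prodMk measurable_const)).pow_const 2
        rw [lintegral_const_mul _ h3]
        gcongr
        exact hA t
    _ = _ := by
        rw [lintegral_mul_const _ hw]; ring

/-- The square of the `L²` norm of `(1 + |2πξ|²)^{-s/2}`. -/
def japInt (N s : ℕ) : ℝ≥0∞ := ∫⁻ ξ : Space N, ENNReal.ofReal ((jap ξ ^ s)⁻¹) ^ 2

/-- The integrand decays like `|ξ|^{-2s}`, which is integrable at infinity if `N < 2s`. The
dimensional condition of the product estimates comes from here. -/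
theorem japInt_lt_top {s : ℕ} (h : N < 2 * s) : japInt N s < ⊤ := by
  have h0 : (Module.finrank ℝ (Space N) : ℝ) < ((2 * s : ℕ) : ℝ) := by
    simpa using (by exact_mod_cast h : (N : ℝ) < ((2 * s : ℕ) : ℝ))
  have h1 := integrable_rpow_neg_one_add_norm_sq (μ := (volume : Measure (Space N))) h0
  have h2 := h1.comp_smul (R := 2 * Real.pi) (by positivity)
  have h3 := h2.lintegral_lt_top
  refine lt_of_le_of_lt (lintegral_mono fun ξ => ?_) h3
  rw [← ENNReal.ofReal_pow (by have := jap_pos ξ; positivity)]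
  apply ENNReal.ofReal_le_ofReal
  rw [inv_pow, ← pow_mul, jap_pow_eq_rpow, ← Real.rpow_neg (by positivity)]
  apply le_of_eq
  congr 1
  push_cast; ring

/-- The larger of `p` and `q` absorbs `x ^ c` at the price `2 ^ c`, and its remaining inverse powers
are bounded by those of the smaller one. Each resulting term depends on a single frequency, as
Young's inequality requires. -/
theorem kernel_le {a b c : ℕ} (hca : c ≤ a) (hcb : c ≤ b) {x p q : ℝ} (hp : 1 ≤ p) (hq : 1 ≤ q)
    (hx : 0 ≤ x) (h : x ≤ p + q) :
    x ^ c * ((p ^ a)⁻¹ * (q ^ b)⁻¹) ≤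
      2 ^ c * ((p ^ (a + b - c))⁻¹ + (q ^ (a + b - c))⁻¹) := by
  have hp0 : 0 < p := by linarith
  have hq0 : 0 < q := by linarith
  obtain ⟨a', rfl⟩ := Nat.exists_eq_add_of_le hca
  obtain ⟨b', rfl⟩ := Nat.exists_eq_add_of_le hcb
  rw [show c + a' + (c + b') - c = c + a' + b' by omega]
  rcases le_total p q with hpq | hpq
  · have h1 : x ^ c ≤ 2 ^ c * q ^ c := by rw [← mul_pow]; gcongr; linarith
    have h2 : (q ^ b')⁻¹ ≤ (p ^ b')⁻¹ := by gcongr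
    calc _ ≤ (2 ^ c * q ^ c) * ((p ^ (c + a'))⁻¹ * (q ^ (c + b'))⁻¹) := by gcongr
      _ = 2 ^ c * ((p ^ (c + a'))⁻¹ * (q ^ b')⁻¹) := by rw [pow_add q]; field_simp
      _ ≤ 2 ^ c * ((p ^ (c + a'))⁻¹ * (p ^ b')⁻¹) := by gcongr
      _ = 2 ^ c * ((p ^ (c + a' + b'))⁻¹ + 0) := by rw [pow_add p (c + a'), mul_inv, add_zero]
      _ ≤ _ := by gcongr; positivity
  · have h1 : x ^ c ≤ 2 ^ c * p ^ c := by rw [← mul_pow]; gcongr; linarith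
    calc _ ≤ (2 ^ c * p ^ c) * ((p ^ (c + a'))⁻¹ * (q ^ (c + b'))⁻¹) := by gcongr
      _ = 2 ^ c * ((p ^ a')⁻¹ * (q ^ (c + b'))⁻¹) := by rw [pow_add p]; field_simp
      _ ≤ 2 ^ c * ((q ^ a')⁻¹ * (q ^ (c + b'))⁻¹) := by gcongr
      _ = 2 ^ c * (0 + (q ^ (c + a' + b'))⁻¹) := by
          rw [show c + a' + b' = a' + (c + b') by omega, pow_add q a', mul_inv, zero_add]
      _ ≤ _ := by gcongr; positivity

/-- The Fourier transform of a product of Schwartz functions. -/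
theorem fourier_mul_apply (F G : 𝓢(Space N, ℂ)) (ξ : Space N) :
    𝓕 (pairing (ContinuousLinearMap.mul ℂ ℂ) F G) ξ = ∫ t, 𝓕 F (-t) * 𝓕 G (ξ + t) := by
  have hinv : ∀ (H : 𝓢(Space N, ℂ)) (x : Space N), 𝓕⁻ H x = 𝓕 H (-x) := fun H x => rfl
  have h1 : SchwartzMap.convolution (ContinuousLinearMap.mul ℂ ℂ) (𝓕⁻ F) (𝓕⁻ G) =
      𝓕⁻ (pairing (ContinuousLinearMap.mul ℂ ℂ) F G) := by
    have h2 := fourier_convolution (ContinuousLinearMap.mul ℂ ℂ) (𝓕⁻ F) (𝓕⁻ G)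
    rw [fourier_fourierInv_eq, fourier_fourierInv_eq] at h2
    rw [← h2, fourierInv_fourier_eq]
  have h3 := convolution_apply (ContinuousLinearMap.mul ℂ ℂ) (𝓕⁻ F) (𝓕⁻ G) (-ξ)
  rw [h1, hinv, neg_neg] at h3
  rw [h3, MeasureTheory.convolution]
  congr 1
  funext t
  rw [hinv, ContinuousLinearMap.mul_apply', hinv]
  congr 2
  abel

/-- The identity holds almost everywhere by the definition of the multiplier, and everywhere by
continuity. -/
theorem norm_fourier_bes {r : ℕ} {f F : 𝓢(Space N, ℂ)} (h : bes r (f.toLp 2) = F.toLp 2)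
    (ξ : Space N) : 𝓕 F ξ = ((jap ξ : ℂ) ^ r)⁻¹ * 𝓕 f ξ := by
  have h1 := congrArg (fun g : L2C N => (𝓕 g : L2C N)) h
  simp only [bes, fourier_mult, SchwartzMap.toLp_fourier_eq] at h1
  have h2 : (fun ξ => 𝓕 F ξ) =ᵐ[volume] fun ξ => symB r ξ * 𝓕 f ξ := by
    filter_upwards [coeFn_mulOp (symB r) ((𝓕 f).toLp 2), (𝓕 f).coeFn_toLp 2,
      (𝓕 F).coeFn_toLp 2] with ξ h₁ h₂ h₃
    rw [← h₂, ← h₁, h1, h₃]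
  have h3 := (Continuous.ae_eq_iff_eq volume (𝓕 F).continuous
    ((symB r).continuous.mul (𝓕 f).continuous)).mp h2
  exact congrFun h3 ξ

/-- A Schwartz function as an element of `L²`. -/
def toL (f : 𝓢(Space N, ℂ)) : L2C N := f.toLp 2

/-- On the Fourier side the product is a convolution, whose weights are separated by `kernel_le`.
Young's inequality bounds the two pieces by `‖J P‖_{L¹} ‖Q‖_{L²}` and `‖J Q‖_{L¹} ‖P‖_{L²}`, and
Cauchy-Schwarz bounds these `L¹` norms, the square of `‖J‖_{L²}` being `japInt`. In the constant, `4
^ c` is the square of `2 ^ c`, and the last factor `4` comes from `(u + v)² ≤ 2u² + 2v²` with two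
equal bounds. -/
theorem schwartz_product {a b c : ℕ} (hca : c ≤ a) (hcb : c ≤ b) (f g : 𝓢(Space N, ℂ)) :
    ∃ x : L2C N, ENNReal.ofReal ‖x‖ ^ 2 ≤ 4 ^ (c + 1) * japInt N (a + b - c) *
        (ENNReal.ofReal ‖toL f‖ ^ 2 * ENNReal.ofReal ‖toL g‖ ^ 2) ∧
      (fun p => bes a (toL f) p * bes b (toL g) p) =ᵐ[volume] bes c x := by
  set s := a + b - c with hs
  obtain ⟨F, hF⟩ := exists_schwartz_bes a f
  obtain ⟨G, hG⟩ := exists_schwartz_bes b g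
  set H : 𝓢(Space N, ℂ) := pairing (ContinuousLinearMap.mul ℂ ℂ) F G with hH
  obtain ⟨K, hK⟩ := exists_schwartz_eq_bes c H
  refine ⟨toL K, ?_, ?_⟩
  swap
  · rw [toL, toL, toL, ← hK, hF, hG]
    filter_upwards [F.coeFn_toLp 2, G.coeFn_toLp 2, H.coeFn_toLp 2] with p h₁ h₂ h₃
    rw [h₁, h₂, h₃]; rfl
  have e : ∀ φ : 𝓢(Space N, ℂ), ENNReal.ofReal ‖toL φ‖ ^ 2 = ∫⁻ ξ, ‖𝓕 φ ξ‖ₑ ^ 2 := by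
    intro φ
    rw [toL, ← Lp.norm_fourier_eq, SchwartzMap.toLp_fourier_eq, ofReal_norm_sq_eq_lintegral]
    apply lintegral_congr_ae
    filter_upwards [(𝓕 φ).coeFn_toLp 2] with ξ h
    rw [h]
  set J : Space N → ℝ≥0∞ := fun ξ => ENNReal.ofReal ((jap ξ ^ s)⁻¹) with hJ
  set P : Space N → ℝ≥0∞ := fun t => ‖𝓕 f (-t)‖ₑ with hP
  set Q : Space N → ℝ≥0∞ := fun t => ‖𝓕 g t‖ₑ with hQ
  have mJ : Measurable J := by
    have h1 : Continuous fun ξ : Space N => (jap ξ ^ s)⁻¹ :=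
      (continuous_jap.pow s).inv₀ fun ξ => (pow_pos (jap_pos ξ) s).ne'
    exact h1.measurable.ennreal_ofReal
  have mP : Measurable P := ((𝓕 f).continuous.comp continuous_neg).measurable.enorm
  have mQ : Measurable Q := (𝓕 g).continuous.measurable.enorm
  have hPi : ∫⁻ t, P t ^ 2 = ENNReal.ofReal ‖toL f‖ ^ 2 := by
    rw [e f]
    exact lintegral_neg_eq_self (μ := (volume : Measure (Space N))) (fun t => ‖𝓕 f t‖ₑ ^ 2)
  have hQi : ∫⁻ t, Q t ^ 2 = ENNReal.ofReal ‖toL g‖ ^ 2 := (e g).symm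
  have hpt : ∀ ξ, ‖𝓕 K ξ‖ₑ ≤ 2 ^ c * ((∫⁻ t, (J t * P t) * Q (ξ + t)) +
      ∫⁻ t, (J t * Q t) * P (t - ξ)) := by
    intro ξ
    have h1 : 𝓕 K ξ = (jap ξ : ℂ) ^ c * 𝓕 H ξ := by
      rw [norm_fourier_bes hK.symm ξ, mul_inv_cancel_left₀ (pow_ne_zero _ (jap_ne ξ))]
    have hjn : ∀ η : Space N, ‖((jap η : ℂ))‖ₑ = ENNReal.ofReal (jap η) := fun η => by
      rw [← ofReal_norm, Complex.norm_real, Real.norm_of_nonneg (jap_pos η).le]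
    rw [h1, hH, fourier_mul_apply, enorm_mul]
    calc _ ≤ ENNReal.ofReal (jap ξ) ^ c * ∫⁻ t, ‖𝓕 F (-t) * 𝓕 G (ξ + t)‖ₑ := by
          rw [enorm_pow, hjn]
          gcongr
          exact enorm_integral_le_lintegral_enorm _
      _ = ∫⁻ t, ENNReal.ofReal (jap ξ) ^ c * ‖𝓕 F (-t) * 𝓕 G (ξ + t)‖ₑ := by
          rw [lintegral_const_mul' _ _ (by finiteness)]
      _ ≤ ∫⁻ t, 2 ^ c * ((J t * P t) * Q (ξ + t) + (J (ξ + t) * Q (ξ + t)) * P t) := by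
          refine lintegral_mono fun t => ?_
          have h2 : ENNReal.ofReal (jap ξ) ^ c * ‖𝓕 F (-t) * 𝓕 G (ξ + t)‖ₑ =
              ENNReal.ofReal (jap ξ ^ c * ((jap t ^ a)⁻¹ * (jap (ξ + t) ^ b)⁻¹)) *
                (P t * Q (ξ + t)) := by
            have j1 := jap_pos ξ
            have j2 := jap_pos t
            have j3 := jap_pos (ξ + t)
            rw [norm_fourier_bes hF, norm_fourier_bes hG, jap_neg, enorm_mul, enorm_mul, enorm_mul,
              ENNReal.ofReal_mul (by positivity), ENNReal.ofReal_mul (by positivity),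
              ENNReal.ofReal_pow j1.le]
            have h4 : ∀ (η : Space N) (r : ℕ), ‖((jap η : ℂ) ^ r)⁻¹‖ₑ =
                ENNReal.ofReal ((jap η ^ r)⁻¹) := fun η r => by
              rw [← ofReal_norm, norm_inv, norm_pow, Complex.norm_real,
                Real.norm_of_nonneg (jap_pos η).le]
            rw [h4, h4]
            ring
          rw [h2]
          have h3 : jap ξ ≤ jap t + jap (ξ + t) := by
            have := jap_add_le (ξ + t) (-t)
            rw [add_neg_cancel_right, jap_neg] at this
            linarith
          have h5 := kernel_le hca hcb (one_le_jap t) (one_le_jap (ξ + t)) (jap_pos ξ).le h3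
          calc _ ≤ ENNReal.ofReal (2 ^ c * ((jap t ^ s)⁻¹ + (jap (ξ + t) ^ s)⁻¹)) *
                (P t * Q (ξ + t)) := by gcongr
            _ = _ := by
                have j2 := jap_pos t
                have j3 := jap_pos (ξ + t)
                rw [ENNReal.ofReal_mul (by positivity), ENNReal.ofReal_add (by positivity)
                  (by positivity), ENNReal.ofReal_pow (by norm_num)]
                simp only [hJ, ENNReal.ofReal_ofNat]
                ring
      _ = _ := by
          have m1 : Measurable fun t => (J t * P t) * Q (ξ + t) :=
            (mJ.mul mP).mul (mQ.comp (measurable_const_add ξ))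
          rw [lintegral_const_mul' _ _ (by finiteness), lintegral_add_left m1]
          congr 2
          -- Translation by `ξ` places the weight of the second piece on the integration variable.
          rw [← lintegral_add_left_eq_self (fun t => J t * Q t * P (t - ξ)) ξ]
          simp only [add_sub_cancel_left]
  have y1 : ∫⁻ ξ, (∫⁻ t, (J t * P t) * Q (ξ + t)) ^ 2 ≤ (∫⁻ t, J t * P t) ^ 2 * ∫⁻ t, Q t ^ 2 := by
    refine lintegral_sq_lintegral_le (mJ.mul mP) ?_ fun t => ?_
    · exact mQ.comp (measurable_fst.add measurable_snd)
    · rw [lintegral_add_right_eq_self (fun ξ => Q ξ ^ 2) t]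
  have y2 : ∫⁻ ξ, (∫⁻ t, (J t * Q t) * P (t - ξ)) ^ 2 ≤ (∫⁻ t, J t * Q t) ^ 2 * ∫⁻ t, P t ^ 2 := by
    refine lintegral_sq_lintegral_le (mJ.mul mQ) ?_ fun t => ?_
    · exact mP.comp (measurable_snd.sub measurable_fst)
    · rw [lintegral_sub_left_eq_self (fun ξ => P ξ ^ 2) t]
  have z1 : (∫⁻ t, J t * P t) ^ 2 ≤ japInt N s * ∫⁻ t, P t ^ 2 :=
    sq_lintegral_mul_le mJ.aemeasurable mP.aemeasurable
  have z2 : (∫⁻ t, J t * Q t) ^ 2 ≤ japInt N s * ∫⁻ t, Q t ^ 2 :=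
    sq_lintegral_mul_le mJ.aemeasurable mQ.aemeasurable
  rw [e K, ← hPi, ← hQi]
  have hsq : ∀ u v : ℝ≥0∞, (u + v) ^ 2 ≤ 2 * u ^ 2 + 2 * v ^ 2 := fun u v => by
    have h1 := ENNReal.rpow_add_le_mul_rpow_add_rpow u v (p := 2) (by norm_num)
    norm_num at h1
    rwa [mul_add] at h1
  have mm : Measurable fun ξ => (∫⁻ t, (J t * P t) * Q (ξ + t)) ^ 2 := by
    refine Measurable.pow_const (Measurable.lintegral_prod_right' (f := fun p : Space N × Space N =>
      (J p.2 * P p.2) * Q (p.1 + p.2)) ?_) 2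
    exact ((mJ.mul mP).comp measurable_snd).mul (mQ.comp (measurable_fst.add measurable_snd))
  calc _ ≤ ∫⁻ ξ, 4 ^ c * (2 * (∫⁻ t, (J t * P t) * Q (ξ + t)) ^ 2 +
        2 * (∫⁻ t, (J t * Q t) * P (t - ξ)) ^ 2) := by
        refine lintegral_mono fun ξ => ?_
        calc _ ≤ (2 ^ c * ((∫⁻ t, (J t * P t) * Q (ξ + t)) + ∫⁻ t, (J t * Q t) * P (t - ξ))) ^ 2 := by
              gcongr; exact hpt ξ
          _ ≤ _ := by
              rw [mul_pow, ← pow_mul, mul_comm c 2, pow_mul]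
              norm_num
              gcongr
              exact hsq _ _
    _ = 4 ^ c * (2 * (∫⁻ ξ, (∫⁻ t, (J t * P t) * Q (ξ + t)) ^ 2) +
        2 * ∫⁻ ξ, (∫⁻ t, (J t * Q t) * P (t - ξ)) ^ 2) := by
        rw [lintegral_const_mul' _ _ (by finiteness), lintegral_add_left (mm.const_mul 2),
          lintegral_const_mul' _ _ (by finiteness), lintegral_const_mul' _ _ (by finiteness)]
    _ ≤ 4 ^ c * (2 * ((japInt N s * ∫⁻ t, P t ^ 2) * ∫⁻ t, Q t ^ 2) +
        2 * ((japInt N s * ∫⁻ t, Q t ^ 2) * ∫⁻ t, P t ^ 2)) := by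
        gcongr
        · exact y1.trans (by gcongr)
        · exact y2.trans (by gcongr)
    _ = _ := by ring

end

end SineGordon

namespace SineGordon

noncomputable section

open FourierTransform SchwartzMap LineDeriv
open scoped ComplexConjugate

variable {N : ℕ}

/-! ### Extension of the product from Schwartz functions to `L²` -/

theorem exists_subseq_ae {f : ℕ → L2C N} {g : L2C N} (h : Tendsto f atTop (𝓝 g)) :
    ∃ ns : ℕ → ℕ, StrictMono ns ∧ ∀ᵐ x, Tendsto (fun n => f (ns n) x) atTop (𝓝 (g x)) :=
  (tendstoInMeasure_of_tendsto_Lp h).exists_seq_tendsto_ae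

/-- The multiplication `H^a × H^b → H^c`. -/
theorem exists_product {a b c : ℕ} (hca : c ≤ a) (hcb : c ≤ b) (hN : N < 2 * (a + b - c)) :
    ∃ C : ℝ, 0 ≤ C ∧ ∀ y z : L2C N, ∃ x : L2C N, ‖x‖ ≤ C * ‖y‖ * ‖z‖ ∧
      (fun p => bes a y p * bes b z p) =ᵐ[volume] bes c x := by
  set K : ℝ≥0∞ := 4 ^ (c + 1) * japInt N (a + b - c) with hK
  have hKt : K ≠ ⊤ := ENNReal.mul_ne_top (by finiteness) (japInt_lt_top hN).ne
  set C : ℝ := √K.toReal with hC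
  have key : ∀ f g : 𝓢(Space N, ℂ), ∃ x : L2C N, ‖x‖ ≤ C * ‖toL f‖ * ‖toL g‖ ∧
      (fun p => bes a (toL f) p * bes b (toL g) p) =ᵐ[volume] bes c x := by
    intro f g
    obtain ⟨x, h1, h2⟩ := schwartz_product hca hcb f g
    refine ⟨x, ?_, h2⟩
    refine abs_le_of_sq_le_sq' ?_ (by positivity) |>.2
    have h3 := ENNReal.toReal_mono (ENNReal.mul_ne_top hKt (by finiteness)) h1
    simp only [ENNReal.toReal_mul, ENNReal.toReal_pow,
      ENNReal.toReal_ofReal (norm_nonneg _)] at h3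
    rw [mul_pow, mul_pow, hC, Real.sq_sqrt ENNReal.toReal_nonneg, mul_assoc]
    exact h3
  refine ⟨C, by positivity, fun y z => ?_⟩
  obtain ⟨fs, hfs⟩ := (mem_closure_iff_seq_limit (s := range fun f : 𝓢(Space N, ℂ) => toL f)).mp
    (dense_schwartz y)
  obtain ⟨gs, hgs⟩ := (mem_closure_iff_seq_limit (s := range fun f : 𝓢(Space N, ℂ) => toL f)).mp
    (dense_schwartz z)
  choose f hf using hfs.1
  choose g hg using hgs.1
  have hfl : Tendsto (fun n => toL (f n)) atTop (𝓝 y) := by simpa only [hf] using hfs.2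
  have hgl : Tendsto (fun n => toL (g n)) atTop (𝓝 z) := by simpa only [hg] using hgs.2
  choose x hx using fun n => key (f n) (g n)
  -- Bilinearity, `fg - f'g' = (f - f')g + f'(g - g')`: both terms are estimated by `key`, and
  -- representatives are identified by injectivity of `bes c`.
  have hdiff : ∀ n m, ‖x n - x m‖ ≤ C * ‖toL (f n) - toL (f m)‖ * ‖toL (g n)‖ +
      C * ‖toL (f m)‖ * ‖toL (g n) - toL (g m)‖ := by
    intro n m
    have hs : ∀ u v : 𝓢(Space N, ℂ), toL (u - v) = toL u - toL v := fun u v =>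
      map_sub (SchwartzMap.toLpCLM ℂ (E := Space N) ℂ 2 volume) u v
    obtain ⟨x₁, h1, e1⟩ := key (f n - f m) (g n)
    obtain ⟨x₂, h2, e2⟩ := key (f m) (g n - g m)
    rw [hs] at h1 e1 h2 e2
    have : x n - x m = x₁ + x₂ := by
      apply bes_injective c
      rw [map_sub, map_add]
      apply Lp.ext
      rw [map_sub] at e1 e2
      filter_upwards [Lp.coeFn_sub (bes c (x n)) (bes c (x m)),
        Lp.coeFn_add (bes c x₁) (bes c x₂), (hx n).2, (hx m).2, e1, e2,
        Lp.coeFn_sub (bes a (toL (f n))) (bes a (toL (f m))),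
        Lp.coeFn_sub (bes b (toL (g n))) (bes b (toL (g m)))] with p q1 q2 q3 q4 q5 q6 q7 q8
      rw [q1, q2, Pi.sub_apply, Pi.add_apply, ← q3, ← q4, ← q5, ← q6, q7, q8]
      simp only [Pi.sub_apply]
      ring
    rw [this]
    exact (norm_add_le _ _).trans (add_le_add h1 h2)
  have hcau : CauchySeq x := by
    rw [cauchySeq_iff_tendsto_dist_atTop_0]
    have t1 : Tendsto (fun p : ℕ × ℕ => ‖toL (f p.1) - toL (f p.2)‖) atTop (𝓝 0) := by
      simpa only [dist_eq_norm] using cauchySeq_iff_tendsto_dist_atTop_0.mp hfl.cauchySeq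
    have t2 : Tendsto (fun p : ℕ × ℕ => ‖toL (g p.1) - toL (g p.2)‖) atTop (𝓝 0) := by
      simpa only [dist_eq_norm] using cauchySeq_iff_tendsto_dist_atTop_0.mp hgl.cauchySeq
    have p1 : Tendsto (fun p : ℕ × ℕ => p.1) atTop atTop := by
      rw [← prod_atTop_atTop_eq]; exact tendsto_fst
    have p2 : Tendsto (fun p : ℕ × ℕ => p.2) atTop atTop := by
      rw [← prod_atTop_atTop_eq]; exact tendsto_snd
    have t3 := hgl.norm.comp p1
    have t4 := hfl.norm.comp p2
    have t5 := ((t1.const_mul C).mul t3).add ((t4.const_mul C).mul t2)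
    simp only [mul_zero, zero_mul, add_zero] at t5
    refine squeeze_zero (fun _ => dist_nonneg) (fun p => ?_) t5
    rw [dist_eq_norm]
    exact hdiff p.1 p.2
  obtain ⟨x₀, hx₀⟩ := cauchySeq_tendsto_of_complete hcau
  refine ⟨x₀, le_of_tendsto_of_tendsto' hx₀.norm ((hfl.norm.const_mul C).mul hgl.norm)
    fun n => (hx n).1, ?_⟩
  have l1 := ((bes (N := N) a).continuous.tendsto y).comp hfl
  have l2 := ((bes (N := N) b).continuous.tendsto z).comp hgl
  have l3 := ((bes (N := N) c).continuous.tendsto x₀).comp hx₀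
  -- Three nested subsequences turn the `L²` limits into almost everywhere limits, so that the
  -- pointwise products pass to the limit.
  obtain ⟨n1, m1, s1⟩ := exists_subseq_ae l1
  obtain ⟨n2, m2, s2⟩ := exists_subseq_ae (l2.comp m1.tendsto_atTop)
  obtain ⟨n3, m3, s3⟩ := exists_subseq_ae (l3.comp (m1.comp m2).tendsto_atTop)
  have hall : ∀ᵐ p, ∀ n, bes a (toL (f n)) p * bes b (toL (g n)) p = bes c (x n) p :=
    ae_all_iff.mpr fun n => (hx n).2
  filter_upwards [s1, s2, s3, hall] with p q1 q2 q3 q4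
  refine tendsto_nhds_unique ?_ q3
  have := (q1.comp ((m2.comp m3).tendsto_atTop)).mul (q2.comp m3.tendsto_atTop)
  refine this.congr fun n => ?_
  exact q4 _

end

end SineGordon

namespace SineGordon

noncomputable section

open ContinuousLinearMap

variable {N : ℕ}

/-! ### The chain rule and the product rule for weak derivatives -/

/-- Vitali's theorem on `K`: on a set of finite measure an `L²` bound gives uniform integrability,
with `δ = (ε/(b+1))²` from Cauchy-Schwarz. For mollified gradients such a bound is at hand, but no
pointwise majorant. -/
theorem tendsto_integral_of_eLpNorm_two_le {α : Type*} [MeasurableSpace α] {μ : Measure α} {K : Set α}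
    (hK : μ K ≠ ⊤) {f : ℕ → α → ℝ} {g : α → ℝ} {B : ℝ≥0∞} (hB : B ≠ ⊤)
    (hf : ∀ n, AEStronglyMeasurable (f n) μ) (hfB : ∀ n, eLpNorm (f n) 2 μ ≤ B)
    (hg : MemLp g 2 μ) (hfK : ∀ n, ∀ x ∉ K, f n x = 0) (hgK : ∀ x ∉ K, g x = 0)
    (hfg : ∀ᵐ x ∂μ, Tendsto (fun n => f n x) atTop (𝓝 (g x))) :
    Tendsto (fun n => ∫ x, f n x ∂μ) atTop (𝓝 (∫ x, g x ∂μ)) := by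
  have e : ∀ h : α → ℝ, (∀ x ∉ K, h x = 0) → ∫ x, h x ∂μ = ∫ x in K, h x ∂μ := fun h hh =>
    (setIntegral_eq_integral_of_forall_compl_eq_zero hh).symm
  rw [e g hgK]
  simp_rw [e (f _) (hfK _)]
  have : IsFiniteMeasure (μ.restrict K) := isFiniteMeasure_restrict.mpr hK
  have hInt : ∀ h : α → ℝ, MemLp h 2 μ → MemLp h 1 (μ.restrict K) := fun h hh =>
    (hh.restrict K).mono_exponent (by norm_num)
  have hfm : ∀ n, MemLp (f n) 2 μ := fun n => ⟨hf n, (hfB n).trans_lt hB.lt_top⟩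
  refine tendsto_integral_of_L1' _ hg.1.restrict
    (Eventually.of_forall fun n => memLp_one_iff_integrable.mp (hInt _ (hfm n))) ?_
  refine tendsto_Lp_finite_of_tendsto_ae le_rfl (by simp) (fun n => (hf n).restrict) (hInt _ hg) ?_
    (ae_restrict_of_ae hfg)
  intro ε hε
  set b := B.toReal with hb
  have hb0 : 0 ≤ b := ENNReal.toReal_nonneg
  refine ⟨(ε / (b + 1)) ^ 2, by positivity, fun n s hs hμ => ?_⟩
  rw [eLpNorm_indicator_eq_eLpNorm_restrict hs, Measure.restrict_restrict hs]
  rw [Measure.restrict_apply hs] at hμ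
  refine (eLpNorm_le_eLpNorm_mul_rpow_measure_univ (p := 1) (q := 2) (by norm_num)
    (hf n).restrict).trans ?_
  calc _ ≤ B * (ENNReal.ofReal ((ε / (b + 1)) ^ 2)) ^ (1 / 2 : ℝ) := by
        gcongr
        · exact (eLpNorm_mono_measure _ Measure.restrict_le_self).trans (hfB n)
        · norm_num
          gcongr
    _ = ENNReal.ofReal (b * (ε / (b + 1))) := by
        rw [ENNReal.ofReal_rpow_of_nonneg (by positivity) (by norm_num), ← Real.sqrt_eq_rpow,
          Real.sqrt_sq (by positivity), ENNReal.ofReal_mul hb0, hb, ENNReal.ofReal_toReal hB]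
    _ ≤ _ := by
        apply ENNReal.ofReal_le_ofReal
        rw [mul_div_assoc', div_le_iff₀ (by positivity)]
        nlinarith

/-- Young's inequality with a kernel of mass one. -/
theorem eLpNorm_convolution_le {ρ g : Space N → ℝ} (hρ : Continuous ρ) (hρ0 : ∀ x, 0 ≤ ρ x)
    (hρi : Integrable ρ volume) (hρ1 : ∫ x, ρ x = 1) (hg : Measurable g) :
    eLpNorm (MeasureTheory.convolution ρ g (lsmul ℝ ℝ) volume) 2 volume ≤ eLpNorm g 2 volume := by
  have e : ∀ h : Space N → ℝ, eLpNorm h 2 volume = (∫⁻ x, ‖h x‖ₑ ^ 2) ^ (1 / 2 : ℝ) := fun h => by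
    rw [eLpNorm_eq_lintegral_rpow_enorm_toReal (by norm_num) (by norm_num)]
    norm_num
  rw [e, e]
  refine ENNReal.rpow_le_rpow ?_ (by norm_num)
  have hρl : ∫⁻ t, ‖ρ t‖ₑ = 1 := by
    rw [← ofReal_integral_norm_eq_lintegral_enorm hρi]
    simp_rw [Real.norm_of_nonneg (hρ0 _)]
    rw [hρ1]; simp
  calc _ ≤ ∫⁻ x, (∫⁻ t, ‖ρ t‖ₑ * ‖g (x - t)‖ₑ) ^ 2 := by
        refine lintegral_mono fun x => ?_
        gcongr
        rw [convolution_def]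
        refine (enorm_integral_le_lintegral_enorm _).trans (le_of_eq ?_)
        simp [enorm_mul]
    _ ≤ (∫⁻ t, ‖ρ t‖ₑ) ^ 2 * ∫⁻ x, ‖g x‖ₑ ^ 2 := by
        refine lintegral_sq_lintegral_le (h := fun x t => ‖g (x - t)‖ₑ) hρ.measurable.enorm
          ?_ fun t => ?_
        · exact (hg.comp (measurable_fst.sub measurable_snd)).enorm
        · rw [lintegral_sub_right_eq_self (fun x => ‖g x‖ₑ ^ 2) t]
    _ = _ := by rw [hρl]; simp

/-- The classical derivative falls on the kernel, and `s ↦ ρ (x - s)` is a test function to which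
the weak derivative applies. -/
theorem WeakD.fderiv_convolution {i : Fin N} {v g ρ : Space N → ℝ} (h : WeakD i v g) (hρ : IsTest ρ)
    (x : Space N) : fderiv ℝ (MeasureTheory.convolution ρ v (lsmul ℝ ℝ) volume) x (unitVec i) =
      MeasureTheory.convolution ρ g (lsmul ℝ ℝ) volume x := by
  have h1 := hρ.2.hasFDerivAt_convolution_left (μ := volume) (lsmul ℝ ℝ)
    (hρ.1.of_le (by simp)) h.1 x
  rw [h1.fderiv, convolution_eq_swap, convolution_eq_swap]
  have hρx : IsTest fun s => ρ (x - s) :=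
    ⟨hρ.1.comp (contDiff_const.sub contDiff_id), hρ.2.comp_homeomorph (Homeomorph.subLeft x)⟩
  have h2 := h.2.2 _ hρx
  have h3 : ∀ s, partialD (fun _ : Fin 1 => i) (fun s => ρ (x - s)) s =
      - fderiv ℝ ρ (x - s) (unitVec i) := fun s => by
    have h4 : HasFDerivAt (fun s => ρ (x - s))
        ((fderiv ℝ ρ (x - s)).comp (-ContinuousLinearMap.id ℝ (Space N))) s :=
      ((hρ.1.differentiable (by simp)) (x - s)).hasFDerivAt.comp s
        ((hasFDerivAt_id s).const_sub x)
    rw [partialD_one, h4.fderiv]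
    simp
  simp only [h3] at h2
  simp only [mul_neg, integral_neg, pow_one, neg_mul, one_mul, neg_inj] at h2
  rw [ContinuousLinearMap.integral_apply]
  · simp only [ContinuousLinearMap.precompL_apply, lsmul_apply, smul_eq_mul]
    simpa only [mul_comm] using h2
  · have h5 : ConvolutionExistsAt (fderiv ℝ ρ) v x ((lsmul ℝ ℝ).precompL (Space N)) volume :=
      (hρ.2.fderiv (𝕜 := ℝ)).convolutionExists_left _
        (hρ.1.continuous_fderiv (by simp)) h.1 x
    exact h5.integrable_swap

/-- The chain rule for weak derivatives. -/
theorem WeakD.comp {i : Fin N} {v g : Space N → ℝ} (h : WeakD i v g) (hg : MemLp g 2 volume)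
    {F F' : ℝ → ℝ} (hF : ∀ x, HasDerivAt F (F' x) x) (hF' : Continuous F') {M : ℝ}
    (hFM : ∀ x, |F x| ≤ M) (hFM' : ∀ x, |F' x| ≤ M) :
    WeakD i (fun x => F (v x)) (fun x => F' (v x) * g x) := by
  have hFc : Continuous F := continuous_iff_continuousAt.mpr fun x => (hF x).continuousAt
  have hM0 : 0 ≤ M := (abs_nonneg _).trans (hFM 0)
  -- `eLpNorm_convolution_le` is for measurable functions, and `g` may be changed on a null set.
  wlog hgm : Measurable g generalizing g
  · have h1 := this (g := hg.1.mk g) (h.congr (EventuallyEq.refl _ _) hg.1.ae_eq_mk)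
      ((memLp_congr_ae hg.1.ae_eq_mk).mp hg) hg.1.stronglyMeasurable_mk.measurable
    refine h1.congr (EventuallyEq.refl _ _) ?_
    filter_upwards [hg.1.ae_eq_mk] with x hx
    rw [hx]
  have hvm : AEStronglyMeasurable v volume := h.1.aestronglyMeasurable
  have hFv : AEStronglyMeasurable (fun x => F (v x)) volume := hFc.comp_aestronglyMeasurable hvm
  have hFv' : AEStronglyMeasurable (fun x => F' (v x)) volume := hF'.comp_aestronglyMeasurable hvm
  have hprod : MemLp (fun x => F' (v x) * g x) 2 volume := by
    refine (hg.const_mul M).mono (hFv'.mul hg.1) (Eventually.of_forall fun x => ?_)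
    rw [norm_mul, norm_mul, Real.norm_of_nonneg hM0]
    gcongr
    exact hFM' _
  have lFv : LocallyIntegrable (fun x => F (v x)) volume :=
    (memLp_top_of_bound hFv M (Eventually.of_forall fun x => hFM _)).locallyIntegrable
      (by simp)
  refine ⟨lFv, hprod.locallyIntegrable (by norm_num), fun χ hχ => ?_⟩
  -- Mollification: the `vn` are `C¹`, so the classical chain rule and integration by parts apply to
  -- them. The ratio `2` of the radii is kept fixed for the almost everywhere convergence of the
  -- convolutions.
  let b : ℕ → ContDiffBump (0 : Space N) := fun n =>
    ⟨1 / ((n : ℝ) + 1), 2 * (1 / ((n : ℝ) + 1)), by positivity, by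
      have : 0 < 1 / ((n : ℝ) + 1) := by positivity
      linarith⟩
  let ρ : ℕ → Space N → ℝ := fun n => (b n).normed volume
  have hρ : ∀ n, IsTest (ρ n) := fun n => ⟨(b n).contDiff_normed, (b n).hasCompactSupport_normed⟩
  have hbt : Tendsto (fun n => (b n).rOut) atTop (𝓝 0) := by
    have := tendsto_one_div_add_atTop_nhds_zero_nat (𝕜 := ℝ)
    have h2 := this.const_mul 2
    rwa [mul_zero] at h2
  let vn : ℕ → Space N → ℝ := fun n => MeasureTheory.convolution (ρ n) v (lsmul ℝ ℝ) volume
  let gn : ℕ → Space N → ℝ := fun n => MeasureTheory.convolution (ρ n) g (lsmul ℝ ℝ) volume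
  have tv : ∀ᵐ x, Tendsto (fun n => vn n x) atTop (𝓝 (v x)) :=
    ContDiffBump.ae_convolution_tendsto_right_of_locallyIntegrable (K := 2) hbt
      (Eventually.of_forall fun n => le_rfl) h.1
  have tg : ∀ᵐ x, Tendsto (fun n => gn n x) atTop (𝓝 (g x)) :=
    ContDiffBump.ae_convolution_tendsto_right_of_locallyIntegrable (K := 2) hbt
      (Eventually.of_forall fun n => le_rfl) h.2.1
  have cv : ∀ n, ContDiff ℝ 1 (vn n) := fun n =>
    (hρ n).2.contDiff_convolution_left (n := 1) _ ((hρ n).1.of_le (by simp)) h.1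
  have cg : ∀ n, Continuous (gn n) := fun n =>
    ((hρ n).2.contDiff_convolution_left (n := 0) _ ((hρ n).1.of_le (by simp)) h.2.1).continuous
  have gB : ∀ n, eLpNorm (gn n) 2 volume ≤ eLpNorm g 2 volume := fun n =>
    eLpNorm_convolution_le (hρ n).continuous (b n).nonneg_normed (b n).integrable_normed
      (b n).integral_normed hgm
  have cχ : Continuous χ := hχ.continuous
  have hD : ∀ n x, HasFDerivAt (fun x => F (vn n x)) (F' (vn n x) • fderiv ℝ (vn n) x) x :=
    fun n x => (hF _).comp_hasFDerivAt x (((cv n).differentiable (by simp)) x).hasFDerivAt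
  have hDi : ∀ n x, fderiv ℝ (fun x => F (vn n x)) x (unitVec i) = F' (vn n x) * gn n x :=
    fun n x => by
      rw [(hD n x).fderiv]
      simp only [_root_.smul_apply, smul_eq_mul]
      rw [h.fderiv_convolution (hρ n) x]
  have ibp : ∀ n, ∫ x, F (vn n x) * partialD (fun _ : Fin 1 => i) χ x =
      -∫ x, F' (vn n x) * gn n x * χ x := fun n => by
    have hχ' := hχ.partialD (fun _ : Fin 1 => i)
    have cF : Continuous fun x => F (vn n x) := hFc.comp (cv n).continuous
    have := integral_mul_fderiv_eq_neg_fderiv_mul_of_integrable (μ := (volume : Measure (Space N)))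
      (f := fun x => F (vn n x)) (g := χ) (v := unitVec i) ?_ ?_ ?_ ?_ ?_
    · simp only [hDi, ← partialD_one] at this
      exact this
    · simp only [hDi]
      exact ((((hF'.comp (cv n).continuous).mul (cg n)).mul cχ).integrable_of_hasCompactSupport
        hχ.2.mul_left)
    · simp only [← partialD_one]
      exact (cF.mul hχ'.continuous).integrable_of_hasCompactSupport hχ'.2.mul_left
    · exact (cF.mul cχ).integrable_of_hasCompactSupport hχ.2.mul_left
    · exact fun x _ => (hD n x).differentiableAt
    · exact fun x _ => (hχ.1.differentiable (by simp)) x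
  have l1 : Tendsto (fun n => ∫ x, F (vn n x) * partialD (fun _ : Fin 1 => i) χ x) atTop
      (𝓝 (∫ x, F (v x) * partialD (fun _ : Fin 1 => i) χ x)) := by
    have hχ' := hχ.partialD (fun _ : Fin 1 => i)
    refine tendsto_integral_of_dominated_convergence
      (fun x => M * |partialD (fun _ : Fin 1 => i) χ x|) (fun n => ?_) ?_ (fun n => ?_) ?_
    · exact ((hFc.comp (cv n).continuous).mul hχ'.continuous).aestronglyMeasurable
    · exact ((hχ'.continuous.integrable_of_hasCompactSupport hχ'.2).abs).const_mul M
    · refine Eventually.of_forall fun x => ?_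
      rw [norm_mul, Real.norm_eq_abs, Real.norm_eq_abs]
      gcongr
      exact hFM _
    · filter_upwards [tv] with x hx
      exact ((hFc.tendsto _).comp hx).mul_const _
  have l2 : Tendsto (fun n => ∫ x, F' (vn n x) * gn n x * χ x) atTop
      (𝓝 (∫ x, F' (v x) * g x * χ x)) := by
    obtain ⟨m, hm⟩ := hχ.2.exists_bound_of_continuous cχ
    have hm0 : 0 ≤ m := (norm_nonneg _).trans (hm 0)
    have hbd : ∀ a c x : ℝ, |a| ≤ M → |x| ≤ m → ‖a * c * x‖ ≤ ‖(M * m) * c‖ := fun a c x ha hx => by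
      rw [norm_mul, norm_mul, norm_mul, Real.norm_of_nonneg (by positivity : 0 ≤ M * m),
        Real.norm_eq_abs, Real.norm_eq_abs x]
      calc _ ≤ M * ‖c‖ * m := by gcongr
        _ = _ := by ring
    refine tendsto_integral_of_eLpNorm_two_le (K := tsupport χ)
      hχ.2.isCompact.measure_lt_top.ne
      (B := ENNReal.ofReal (M * m) * eLpNorm g 2 volume)
      (ENNReal.mul_ne_top (by finiteness) hg.2.ne) (fun n => ?_) (fun n => ?_) ?_
      (fun n x hx => by rw [image_eq_zero_of_notMem_tsupport hx, mul_zero])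
      (fun x hx => by rw [image_eq_zero_of_notMem_tsupport hx, mul_zero]) ?_
    · exact (((hF'.comp (cv n).continuous).mul (cg n)).mul cχ).aestronglyMeasurable
    · calc _ ≤ eLpNorm (fun x => (M * m) * gn n x) 2 volume :=
            eLpNorm_mono fun x => hbd _ _ _ (hFM' _) (hm x)
        _ = ENNReal.ofReal (M * m) * eLpNorm (gn n) 2 volume := by
            have := eLpNorm_const_smul (M * m) (gn n) 2 volume
            rw [Real.enorm_of_nonneg (by positivity : 0 ≤ M * m)] at this
            exact this
        _ ≤ _ := by gcongr; exact gB n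
    · refine (hg.const_mul (M * m)).mono (hprod.1.mul cχ.aestronglyMeasurable)
        (Eventually.of_forall fun x => hbd _ _ _ (hFM' _) (hm x))
    · filter_upwards [tv, tg] with x hx hx'
      exact (((hF'.tendsto _).comp hx).mul hx').mul_const _
  rw [pow_one, neg_one_mul]
  refine tendsto_nhds_unique l1 ?_
  simp_rw [ibp]
  exact l2.neg

theorem WeakD.mul_test {j : Fin N} {v g χ : Space N → ℝ} (h : WeakD j v g) (hχ : IsTest χ) :
    WeakD j (fun x => v x * χ x) (fun x => g x * χ x + v x * partialD (fun _ : Fin 1 => j) χ x) := by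
  have hχ' := hχ.partialD (fun _ : Fin 1 => j)
  refine ⟨(hχ.integrable_mul h.1).locallyIntegrable, ((hχ.integrable_mul h.2.1).add
    (hχ'.integrable_mul h.1)).locallyIntegrable, fun κ hκ => ?_⟩
  have hκ' := hκ.partialD (fun _ : Fin 1 => j)
  have t1 : ∀ {θ θ' : Space N → ℝ}, IsTest θ → IsTest θ' → IsTest fun x => θ x * θ' x :=
    fun a b => ⟨a.1.mul b.1, a.2.mul_right⟩
  have h1 := h.2.2 _ (t1 hχ hκ)
  have hd : ∀ x, partialD (fun _ : Fin 1 => j) (fun x => χ x * κ x) x =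
      χ x * partialD (fun _ : Fin 1 => j) κ x + κ x * partialD (fun _ : Fin 1 => j) χ x := fun x => by
    have e1 : HasFDerivAt (fun x => χ x * κ x) (χ x • fderiv ℝ κ x + κ x • fderiv ℝ χ x) x :=
      ((hχ.1.differentiable (by simp)) x).hasFDerivAt.mul
        ((hκ.1.differentiable (by simp)) x).hasFDerivAt
    rw [partialD_one, partialD_one, partialD_one, e1.fderiv]
    simp
  have i1 := (t1 hχ hκ').integrable_mul h.1
  have i2 := (t1 hκ hχ').integrable_mul h.1
  have i3 := (t1 hχ hκ).integrable_mul h.2.1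
  simp only [hd, mul_add] at h1
  rw [integral_add i1 i2] at h1
  have e2 : ∫ x, (g x * χ x + v x * partialD (fun _ : Fin 1 => j) χ x) * κ x =
      (∫ x, g x * (χ x * κ x)) + ∫ x, v x * (κ x * partialD (fun _ : Fin 1 => j) χ x) := by
    rw [← integral_add i3 i2]
    congr 1; funext x; ring
  have e3 : ∫ x, v x * χ x * partialD (fun _ : Fin 1 => j) κ x =
      ∫ x, v x * (χ x * partialD (fun _ : Fin 1 => j) κ x) := by
    congr 1; funext x; ring
  rw [e2, e3]
  linarith

theorem inner_eq_integral {u w : Space N → ℝ} {f g : L2C N}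
    (hu : (fun x => (u x : ℂ)) =ᵐ[volume] f) (hw : (fun x => (w x : ℂ)) =ᵐ[volume] g) :
    inner ℂ f g = ((∫ x, u x * w x : ℝ) : ℂ) := by
  rw [L2.inner_def, ← integral_complex_ofReal]
  apply integral_congr_ae
  filter_upwards [hu, hw] with x h₁ h₂
  rw [← h₁, ← h₂]
  simp [mul_comm]

theorem Rep.eq_rie {j : Fin N} {w h : Space N → ℝ} {z : L2C N} (hw : Rep 1 w z) (hh : WeakD j w h) :
    (fun x => (h x : ℂ)) =ᵐ[volume] rie j z := by
  have h1 := Rep.weakD (s := 0) hw j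
  have h2 := h1.2.congr (h1.1.unique hh)
  rwa [Rep, bes_zero] at h2

/-- The product rule for weak derivatives of functions in `H¹`. -/
theorem WeakD.mul {j : Fin N} {u w : Space N → ℝ} {y z : L2C N} (hu : Rep 1 u y) (hw : Rep 1 w z)
    {g h : Space N → ℝ} (hg : WeakD j u g) (hh : WeakD j w h) (hgm : MemLp g 2 volume)
    (hhm : MemLp h 2 volume) :
    WeakD j (fun x => u x * w x) (fun x => g x * w x + u x * h x) := by
  have i1 : Integrable (fun x => u x * w x) volume := hu.memLp.integrable_mul hw.memLp
  have i2 : Integrable (fun x => g x * w x) volume := hgm.integrable_mul hw.memLp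
  have i3 : Integrable (fun x => u x * h x) volume := hu.memLp.integrable_mul hhm
  refine ⟨i1.locallyIntegrable, (i2.add i3).locallyIntegrable, fun χ hχ => ?_⟩
  have hχ' := fun i => hχ.partialD (fun _ : Fin 1 => i)
  have bd : ∀ {f θ : Space N → ℝ}, MemLp f 2 volume → IsTest θ → MemLp (fun x => f x * θ x) 2 volume :=
    fun hf hθ => by
      have := (hθ.memLp ⊤).mul (r := 2) hf
      exact this
  have hd := fun i => Rep.weakD (s := 0) hu i
  obtain ⟨f, hf⟩ := exists_rep_zero (bd hu.memLp hχ)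
  choose k hk using fun i => exists_rep_zero ((bd (hd i).2.memLp hχ).add (bd hu.memLp (hχ' i)))
  simp only [Rep, bes_zero] at hf hk
  -- The localised function `u χ` is in `H¹`. Pairing it with `w`, the skew-adjointness of `rie j`
  -- gives `-∫ u χ ∂ⱼw = ∫ ∂ⱼ(u χ) w`, which is the product rule tested against `χ`.
  have hU := exists_rep_one hf hk fun i => by
    have h1 := (hd i).1.mul_test hχ
    rw [bes_zero] at h1
    exact h1
  have e1 := hU.eq_rie (hg.mul_test hχ)
  have e2 := hw.eq_rie hh
  have e3 := inner_eq_integral e1 hw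
  have e4 := inner_eq_integral hU e2
  rw [inner_rie, ← bes_rie, ← inner_bes, e4] at e3
  have e5 : -(∫ x, u x * χ x * h x) =
      ∫ x, (g x * χ x + u x * partialD (fun _ : Fin 1 => j) χ x) * w x := by exact_mod_cast e3
  have j1 := hχ.integrable_mul i2.locallyIntegrable
  have j2 := hχ.integrable_mul i3.locallyIntegrable
  have j3 := (hχ' j).integrable_mul i1.locallyIntegrable
  have e6 : ∫ x, (g x * χ x + u x * partialD (fun _ : Fin 1 => j) χ x) * w x =
      (∫ x, g x * w x * χ x) + ∫ x, u x * w x * partialD (fun _ : Fin 1 => j) χ x := by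
    rw [← integral_add j1 j3]
    congr 1; funext x; ring
  have e7 : ∫ x, (g x * w x + u x * h x) * χ x =
      (∫ x, g x * w x * χ x) + ∫ x, u x * χ x * h x := by
    have : ∫ x, u x * χ x * h x = ∫ x, u x * h x * χ x := by congr 1; funext x; ring
    rw [this, ← integral_add j1 j2]
    congr 1; funext x; ring
  rw [e7]
  rw [e6] at e5
  linarith

end

end SineGordon

namespace SineGordon

noncomputable section

variable {N : ℕ}

/-! ### Estimates of the nonlinearity -/

/-- `v` is in `H^s`, with norm at most `c`. -/
def HBound (s : ℕ) (v : Space N → ℝ) (c : ℝ) : Prop := ∃ y, Rep s v y ∧ ‖y‖ ≤ c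

theorem HBound.le {s : ℕ} {v : Space N → ℝ} {c d : ℝ} (h : HBound s v c) (hcd : c ≤ d) :
    HBound s v d := h.imp fun _ hy => ⟨hy.1, hy.2.trans hcd⟩

theorem HBound.nonneg {s : ℕ} {v : Space N → ℝ} {c : ℝ} (h : HBound s v c) : 0 ≤ c := by
  obtain ⟨y, -, h⟩ := h
  exact (norm_nonneg y).trans h

theorem HBound.congr {s : ℕ} {v w : Space N → ℝ} {c : ℝ} (h : HBound s v c) (hvw : v =ᵐ[volume] w) :
    HBound s w c := h.imp fun _ hy => ⟨hy.1.congr hvw, hy.2⟩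

theorem HBound.add {s : ℕ} {v w : Space N → ℝ} {c d : ℝ} (h : HBound s v c) (h' : HBound s w d) :
    HBound s (v + w) (c + d) := by
  obtain ⟨y, hy, hyc⟩ := h
  obtain ⟨z, hz, hzd⟩ := h'
  exact ⟨y + z, hy.add hz, (norm_add_le _ _).trans (add_le_add hyc hzd)⟩

theorem HBound.smul {s : ℕ} {v : Space N → ℝ} {c : ℝ} (r : ℝ) (h : HBound s v c) :
    HBound s (r • v) (|r| * c) := by
  obtain ⟨y, hy, hyc⟩ := h
  refine ⟨r • y, hy.smul r, ?_⟩
  rw [norm_smul, Real.norm_eq_abs]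
  gcongr

theorem HBound.mono {s r : ℕ} (hrs : r ≤ s) {v : Space N → ℝ} {c : ℝ} (h : HBound s v c) :
    HBound r v c := by
  obtain ⟨q, rfl⟩ := Nat.exists_eq_add_of_le hrs
  obtain ⟨y, hy, hyc⟩ := h
  exact ⟨bes q y, hy.mono, (norm_bes_le _ _).trans hyc⟩

theorem HBound.succ {s : ℕ} {v : Space N → ℝ} {g : Fin N → Space N → ℝ} {c d : ℝ}
    (h : HBound s v c) (hg : ∀ i, HBound s (g i) d) (hv : ∀ i, WeakD i v (g i)) :
    HBound (s + 1) v (c + N * d) := by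
  obtain ⟨y, hy, hyc⟩ := h
  choose β hβ hβd using hg
  refine ⟨_, rep_succ hy hβ hv, (norm_sub_le _ _).trans (add_le_add ((norm_bes_le _ _).trans hyc) ?_)⟩
  refine (norm_sum_le _ _).trans ?_
  calc _ ≤ ∑ _i : Fin N, d := Finset.sum_le_sum fun i _ => (norm_rie_le _ _).trans (hβd i)
    _ = _ := by simp

theorem exists_hBound_mul {a b c : ℕ} (hca : c ≤ a) (hcb : c ≤ b) (hN : N < 2 * (a + b - c)) :
    ∃ C : ℝ, 0 ≤ C ∧ ∀ (v w : Space N → ℝ) (p q : ℝ), HBound a v p → HBound b w q →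
      HBound c (fun x => v x * w x) (C * p * q) := by
  obtain ⟨C, hC, h⟩ := exists_product hca hcb hN
  refine ⟨C, hC, fun v w p q ⟨y, hy, hyp⟩ ⟨z, hz, hzq⟩ => ?_⟩
  obtain ⟨x, hx, hx'⟩ := h y z
  have := (norm_nonneg y).trans hyp
  refine ⟨x, ?_, hx.trans (by gcongr)⟩
  rw [Rep]
  filter_upwards [hx', hy, hz] with p h1 h2 h3
  rw [← h1, ← h2, ← h3, Complex.ofReal_mul]

theorem HBound.eLpNorm_le {s : ℕ} {v : Space N → ℝ} {c : ℝ} (h : HBound s v c) :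
    eLpNorm v 2 volume ≤ ENNReal.ofReal c := by
  obtain ⟨y, hy, hyc⟩ := h
  rw [hy.eLpNorm_eq]
  exact ENNReal.ofReal_le_ofReal ((norm_bes_le _ _).trans hyc)

theorem hBound_zero {v : Space N → ℝ} {c : ℝ} (hv : AEStronglyMeasurable v volume) (hc : 0 ≤ c)
    (h : eLpNorm v 2 volume ≤ ENNReal.ofReal c) : HBound 0 v c := by
  obtain ⟨y, hy⟩ := exists_rep_zero ⟨hv, h.trans_lt ENNReal.ofReal_lt_top⟩
  refine ⟨y, hy, ?_⟩
  rw [hy.eLpNorm_eq, bes_zero, ENNReal.ofReal_le_ofReal_iff hc] at h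
  exact h

theorem hBound_zero_of_le {v w : Space N → ℝ} {K c : ℝ} (hv : AEStronglyMeasurable v volume)
    (hK : 0 ≤ K) (hc : 0 ≤ c) (hvw : ∀ x, |v x| ≤ K * |w x|)
    (h : eLpNorm w 2 volume ≤ ENNReal.ofReal c) : HBound 0 v (K * c) := by
  refine hBound_zero hv (by positivity) ?_
  have h1 := eLpNorm_le_mul_eLpNorm_of_ae_le_mul (p := 2) (μ := volume) (f := v) (g := w) (c := K)
    (Eventually.of_forall fun x => by simpa [Real.norm_eq_abs] using hvw x)
  rw [ENNReal.ofReal_mul hK]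
  exact h1.trans (by gcongr)

/-- `v` and `w` have gradients in `H^s`, and their distance in `H_sin^{s+1}` is at most `d`. -/
structure Close (s : ℕ) (v w : Space N → ℝ) (α β : Fin N → L2C N) (d : ℝ) : Prop where
  left : GradRep s v α
  right : GradRep s w β
  left_meas : AEStronglyMeasurable v volume
  right_meas : AEStronglyMeasurable w volume
  nonneg : 0 ≤ d
  sin_le : eLpNorm (fun x => Real.sin (v x - w x)) 2 volume ≤ ENNReal.ofReal d
  grad_le : ∀ i, ‖α i - β i‖ ≤ d

theorem weakD_zero (i : Fin N) : WeakD i (0 : Space N → ℝ) 0 := by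
  refine ⟨?_, ?_, fun χ _ => by simp⟩ <;> exact (integrable_zero _ _ _).locallyIntegrable

theorem gradRep_zero (s : ℕ) : GradRep s (0 : Space N → ℝ) 0 :=
  gradRep_of (fun i => weakD_zero i) fun _ => Rep.zero s

theorem abs_sin_two_sub_le (x y : ℝ) :
    |Real.sin (2 * x) - Real.sin (2 * y)| ≤ 2 * |Real.sin (x - y)| := by
  rw [Real.sin_sub_sin, abs_mul, abs_mul, show (2 * x - 2 * y) / 2 = x - y by ring]
  have := Real.abs_cos_le_one ((2 * x + 2 * y) / 2)
  rw [abs_two]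
  nlinarith [abs_nonneg (Real.sin (x - y))]

theorem abs_cos_two_sub_le (x y : ℝ) :
    |Real.cos (2 * x) - Real.cos (2 * y)| ≤ 2 * |Real.sin (x - y)| := by
  rw [Real.cos_sub_cos, abs_mul, abs_mul, show (2 * x - 2 * y) / 2 = x - y by ring]
  have := Real.abs_sin_le_one ((2 * x + 2 * y) / 2)
  rw [abs_neg, abs_two]
  nlinarith [abs_nonneg (Real.sin (x - y))]

theorem hasDerivAt_sin_two (x : ℝ) :
    HasDerivAt (fun x => Real.sin (2 * x)) (2 * Real.cos (2 * x)) x := by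
  have h : HasDerivAt (fun y : ℝ => 2 * y) 2 x := by simpa using (hasDerivAt_id x).const_mul 2
  exact h.sin.congr_deriv (by ring)

theorem hasDerivAt_cos_two (x : ℝ) :
    HasDerivAt (fun x => Real.cos (2 * x)) (-2 * Real.sin (2 * x)) x := by
  have h : HasDerivAt (fun y : ℝ => 2 * y) 2 x := by simpa using (hasDerivAt_id x).const_mul 2
  exact h.cos.congr_deriv (by ring)

theorem weakD_sin_two {i : Fin N} {v g : Space N → ℝ} (h : WeakD i v g) (hg : MemLp g 2 volume) :
    WeakD i (fun x => Real.sin (2 * v x)) (fun x => 2 * Real.cos (2 * v x) * g x) :=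
  h.comp hg (M := 2) hasDerivAt_sin_two (by fun_prop)
    (fun x => (Real.abs_sin_le_one _).trans (by norm_num)) fun x => by
      rw [abs_mul, abs_two]; linarith [Real.abs_cos_le_one (2 * x)]

theorem weakD_cos_two {i : Fin N} {v g : Space N → ℝ} (h : WeakD i v g) (hg : MemLp g 2 volume) :
    WeakD i (fun x => Real.cos (2 * v x)) (fun x => -2 * Real.sin (2 * v x) * g x) :=
  h.comp hg (M := 2) hasDerivAt_cos_two (by fun_prop)
    (fun x => (Real.abs_cos_le_one _).trans (by norm_num)) fun x => by
      rw [abs_mul, abs_neg, abs_two]; linarith [Real.abs_sin_le_one (2 * x)]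

section

variable {s : ℕ} {v w : Space N → ℝ} {α β : Fin N → L2C N} {d : ℝ}

theorem GradRep.hBound (h : GradRep s v α) (i : Fin N) :
    HBound s (reF (bes s (α i))) ‖α i‖ := ⟨α i, h.rep i, le_rfl⟩

theorem Close.hBound_grad (h : Close s v w α β d) (i : Fin N) :
    HBound s (reF (bes s (α i)) - reF (bes s (β i))) d :=
  ⟨α i - β i, (h.left.rep i).sub (h.right.rep i), h.grad_le i⟩

theorem Close.hBound_sin (h : Close s v w α β d) :
    HBound 0 (fun x => Real.sin (2 * v x) - Real.sin (2 * w x)) (2 * d) := by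
  have m1 := h.left_meas
  have m2 := h.right_meas
  refine hBound_zero_of_le ?_ (by norm_num) h.nonneg (fun x => abs_sin_two_sub_le _ _) h.sin_le
  exact ((Real.continuous_sin.comp (continuous_const_mul 2)).comp_aestronglyMeasurable m1).sub
    ((Real.continuous_sin.comp (continuous_const_mul 2)).comp_aestronglyMeasurable m2)

theorem Close.hBound_cos (h : Close s v w α β d) :
    HBound 0 (fun x => Real.cos (2 * v x) - Real.cos (2 * w x)) (2 * d) := by
  have m1 := h.left_meas
  have m2 := h.right_meas
  refine hBound_zero_of_le ?_ (by norm_num) h.nonneg (fun x => abs_cos_two_sub_le _ _) h.sin_le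
  exact ((Real.continuous_cos.comp (continuous_const_mul 2)).comp_aestronglyMeasurable m1).sub
    ((Real.continuous_cos.comp (continuous_const_mul 2)).comp_aestronglyMeasurable m2)

theorem Close.weakD_sin (h : Close s v w α β d) (i : Fin N) :
    WeakD i (fun x => Real.sin (2 * v x) - Real.sin (2 * w x))
      (fun x => 2 * Real.cos (2 * v x) * reF (bes s (α i)) x -
        2 * Real.cos (2 * w x) * reF (bes s (β i)) x) :=
  (weakD_sin_two (h.left i).1 (h.left.rep i).memLp).sub
    (weakD_sin_two (h.right i).1 (h.right.rep i).memLp)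

theorem Close.weakD_cos (h : Close s v w α β d) (i : Fin N) :
    WeakD i (fun x => Real.cos (2 * v x) - Real.cos (2 * w x))
      (fun x => -2 * Real.sin (2 * v x) * reF (bes s (α i)) x -
        (-2) * Real.sin (2 * w x) * reF (bes s (β i)) x) :=
  (weakD_cos_two (h.left i).1 (h.left.rep i).memLp).sub
    (weakD_cos_two (h.right i).1 (h.right.rep i).memLp)

end

/-- The maps `v ↦ sin (2v)` and `v ↦ cos (2v)` are Lipschitz on bounded sets of `H_sin^{s+1}`, with
values in `H^{s+1}`, if `s > N / 2`. -/
theorem exists_hBound_sin_cos {s : ℕ} (hs : N < 2 * s) {j : ℕ} (hj : j ≤ s + 1) (B : ℝ) :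
    ∃ L : ℝ, 0 ≤ L ∧ ∀ (v w : Space N → ℝ) (α β : Fin N → L2C N) (d : ℝ),
      Close s v w α β d → Close s v 0 α 0 B → Close s w 0 β 0 B →
      HBound j (fun x => Real.sin (2 * v x) - Real.sin (2 * w x)) (L * d) ∧
      HBound j (fun x => Real.cos (2 * v x) - Real.cos (2 * w x)) (L * d) := by
  induction j with
  | zero => exact ⟨2, by norm_num, fun v w α β d h _ _ => ⟨h.hBound_sin, h.hBound_cos⟩⟩
  | succ j ih =>
    obtain ⟨L, hL, ih⟩ := ih (by omega)
    -- For `H^j × H^s → H^j` one has `a + b - c = s`; this is where `N < 2 * s` enters.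
    obtain ⟨C, hC, hmul⟩ := exists_hBound_mul (N := N) (a := j) (b := s) (c := j) le_rfl (by omega)
      (by omega)
    set B' := max B 0 with hB'
    have hB0 : 0 ≤ B' := le_max_right _ _
    -- The derivative of `sin 2v - sin 2w` is `2(∂v - ∂w) + 2(cos 2v - 1)(∂v - ∂w) + 2(cos 2v - cos
    -- 2w)∂w`, matching the three terms of the constant. Sine and cosine go together because
    -- differentiation exchanges them, and `cos 2v - 1`, not `cos 2v`, is square integrable.
    refine ⟨L + N * (2 + 2 * (C * (L * B')) + 2 * (C * L * B')), by positivity,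
      fun v w α β d h hv hw => ?_⟩
    have hd := h.nonneg
    have hBB : B = B' := (max_eq_left hv.nonneg).symm
    obtain ⟨h1, h2⟩ := ih v w α β d h hv hw
    have c0 : Close s (0 : Space N → ℝ) 0 0 0 B := ⟨gradRep_zero s, gradRep_zero s,
      aestronglyMeasurable_const, aestronglyMeasurable_const, hv.nonneg, by simp, by
        simpa using fun _ => hv.nonneg⟩
    -- Applied to the pair `(v, 0)`, the induction hypothesis bounds `sin 2v` and `cos 2v - 1`
    -- themselves.
    obtain ⟨h3, h4⟩ := ih v 0 α 0 B hv hv c0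
    simp only [Pi.zero_apply, mul_zero, Real.sin_zero, sub_zero, Real.cos_zero] at h3 h4
    rw [hBB] at h3 h4
    have hβ : ∀ i, HBound s (reF (bes s (β i))) B' := fun i =>
      (hw.left.hBound i).le (by
        have := hw.grad_le i
        rw [← hBB]
        simpa using this)
    have g := h.hBound_grad
    constructor
    · refine ((h1.mono le_rfl).succ (d := (2 + 2 * (C * (L * B')) + 2 * (C * L * B')) * d)
        (fun i => ?_) h.weakD_sin).le (le_of_eq (by ring))
      have e1 := (g i).mono (by omega : j ≤ s)
      have e2 := hmul _ _ _ _ h4 (g i)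
      have e3 := hmul _ _ _ _ h2 (hβ i)
      refine (((e1.smul 2).add (e2.smul 2)).add (e3.smul 2)).congr (ae_of_all _ fun x => ?_) |>.le ?_
      · simp only [Pi.add_apply, Pi.smul_apply, Pi.sub_apply, smul_eq_mul]; ring
      · rw [abs_two]
        exact le_of_eq (by ring)
    · refine ((h2.mono le_rfl).succ (d := (2 + 2 * (C * (L * B')) + 2 * (C * L * B')) * d)
        (fun i => ?_) h.weakD_cos).le (le_of_eq (by ring))
      have e2 := hmul _ _ _ _ h3 (g i)
      have e3 := hmul _ _ _ _ h1 (hβ i)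
      refine ((e2.smul (-2)).add (e3.smul (-2))).congr (ae_of_all _ fun x => ?_) |>.le ?_
      · simp only [Pi.add_apply, Pi.smul_apply, Pi.sub_apply, smul_eq_mul]; ring
      · rw [abs_neg, abs_two]
        nlinarith

/-- The map `v ↦ sin (2v)` is Lipschitz on bounded sets of `H_sin^{s+1}`, with values in `H^s`. -/
def LipschitzSin (N s : ℕ) : Prop :=
  ∀ B : ℝ, ∃ L : ℝ, 0 ≤ L ∧ ∀ (v w : Space N → ℝ) (α β : Fin N → L2C N) (d : ℝ),
    Close s v w α β d → Close s v 0 α 0 B → Close s w 0 β 0 B →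
      HBound s (fun x => Real.sin (2 * v x) - Real.sin (2 * w x)) (L * d)

theorem lipschitzSin_of_lt {s : ℕ} (hs : N < 2 * s) : LipschitzSin N s := fun B => by
  obtain ⟨L, hL, h⟩ := exists_hBound_sin_cos hs (j := s) (by omega) B
  exact ⟨L, hL, fun v w α β d h1 h2 h3 => (h v w α β d h1 h2 h3).1⟩

/-- Without `N < 2`, the product `H¹ × H¹ → L²` has to suffice. The delicate term `(cos 2v - cos 2w)
∂w` is dominated pointwise by `2 |sin (v - w)| |∂w|`, and `sin (v - w)` is in `H¹` with norm at most
`(1 + N) d`. -/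
theorem lipschitzSin_one (hN : N ≤ 3) : LipschitzSin N 1 := fun B => by
  obtain ⟨C, hC, hmul⟩ := exists_hBound_mul (N := N) (a := 1) (b := 1) (c := 0) (by omega) (by omega)
    (by omega)
  set B' := max B 0 with hB'
  have hB0 : 0 ≤ B' := le_max_right _ _
  refine ⟨2 + N * (2 + 4 * (C * (1 + N) * B')), by positivity, fun v w α β d h hv hw => ?_⟩
  have hd := h.nonneg
  have hBB : B = B' := (max_eq_left hv.nonneg).symm
  have hβ : ∀ i, HBound 1 (reF (bes 1 (β i))) B' := fun i => (hw.left.hBound i).le (by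
        have := hw.grad_le i
        rw [← hBB]
        simpa using this)
  have m1 := h.left_meas
  have m2 := h.right_meas
  have mc : ∀ {u : Space N → ℝ}, AEStronglyMeasurable u volume →
      AEStronglyMeasurable (fun x => Real.cos (2 * u x)) volume := fun hu =>
    (Real.continuous_cos.comp (continuous_const_mul 2)).comp_aestronglyMeasurable hu
  have hsub := h.left.sub h.right
  have hsin : HBound 1 (fun x => Real.sin (v x - w x)) ((1 + N) * d) := by
    have := HBound.succ (s := 0) (v := fun x => Real.sin (v x - w x))
      (g := fun i x => Real.cos (v x - w x) * reF (bes 1 ((α - β) i)) x) (c := d) (d := 1 * d)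
      (hBound_zero (Real.continuous_sin.comp_aestronglyMeasurable (m1.sub m2)) hd h.sin_le)
      (fun i => hBound_zero_of_le (w := reF (bes 1 ((α - β) i))) ?_ (by norm_num) hd
        (fun x => ?_) ?_) fun i => ?_
    · exact this.le (le_of_eq (by ring))
    · exact (Real.continuous_cos.comp_aestronglyMeasurable (m1.sub m2)).mul (hsub.rep i).memLp.1
    · rw [abs_mul]
      gcongr
      exact Real.abs_cos_le_one _
    · exact ((hsub.hBound i).le (h.grad_le i)).eLpNorm_le
    · exact WeakD.comp (hsub i).1 (hsub.rep i).memLp (M := 1) Real.hasDerivAt_sin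
        Real.continuous_cos Real.abs_sin_le_one Real.abs_cos_le_one
  refine (h.hBound_sin.succ (d := (2 + 4 * (C * (1 + N) * B')) * d) (fun i => ?_) h.weakD_sin).le
    (le_of_eq (by ring))
  have e1 : HBound 0 (fun x => 2 * Real.cos (2 * v x) *
      (reF (bes 1 (α i)) - reF (bes 1 (β i))) x) (2 * d) := by
    refine hBound_zero_of_le (w := reF (bes 1 (α i)) - reF (bes 1 (β i))) ?_ (by norm_num) hd
      (fun x => ?_) (h.hBound_grad i).eLpNorm_le
    · exact ((mc m1).const_mul 2).mul ((h.left.rep i).memLp.1.sub (h.right.rep i).memLp.1)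
    · rw [abs_mul, abs_mul, abs_two]
      gcongr
      linarith [Real.abs_cos_le_one (2 * v x)]
  have e2 : HBound 0 (fun x => (Real.cos (2 * v x) - Real.cos (2 * w x)) * reF (bes 1 (β i)) x)
      (2 * (C * ((1 + N) * d) * B')) := by
    have e3 := hmul _ _ _ _ hsin (hβ i)
    refine hBound_zero_of_le (w := fun x => Real.sin (v x - w x) * reF (bes 1 (β i)) x) ?_
      (by norm_num) e3.nonneg (fun x => ?_) e3.eLpNorm_le
    · exact ((mc m1).sub (mc m2)).mul (h.right.rep i).memLp.1
    · rw [abs_mul, abs_mul, ← mul_assoc]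
      gcongr
      exact abs_cos_two_sub_le _ _
  refine (e1.add (e2.smul 2)).congr (ae_of_all _ fun x => ?_) |>.le ?_
  · simp only [Pi.add_apply, Pi.smul_apply, Pi.sub_apply, smul_eq_mul]; ring
  · rw [abs_two]
    exact le_of_eq (by ring)

section

variable {s : ℕ} {v : Space N → ℝ} {α : Fin N → L2C N} {B : ℝ}

theorem Close.hBound_left (h : Close s v 0 α 0 B) (i : Fin N) : HBound s (reF (bes s (α i))) B :=
  (h.left.hBound i).le (by simpa using h.grad_le i)

theorem Close.hBound_mul_left (h : Close s v 0 α 0 B) {c : Space N → ℝ}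
    (hc : AEStronglyMeasurable c volume) (h2 : ∀ x, |c x| ≤ 2) (i : Fin N) :
    HBound 0 (fun x => c x * reF (bes s (α i)) x) (2 * B) := by
  refine hBound_zero_of_le (w := reF (bes s (α i))) (hc.mul (h.left.rep i).memLp.1) (by norm_num)
    h.nonneg (fun x => ?_) (h.hBound_left i).eLpNorm_le
  rw [abs_mul]
  gcongr
  exact h2 x

theorem Close.hBound_sin_one (h : Close s v 0 α 0 B) :
    HBound 1 (fun x => Real.sin (2 * v x)) (2 * B + N * (2 * B)) := by
  have h1 := h.hBound_sin
  simp only [Pi.zero_apply, mul_zero, Real.sin_zero, sub_zero] at h1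
  refine h1.succ (fun i => h.hBound_mul_left ?_ (fun x => ?_) i)
    fun i => weakD_sin_two (h.left i).1 (h.left.rep i).memLp
  · exact ((Real.continuous_cos.comp (continuous_const_mul 2)).comp_aestronglyMeasurable
      h.left_meas).const_mul 2
  · rw [abs_mul, abs_two]
    linarith [Real.abs_cos_le_one (2 * v x)]

theorem Close.weakD_cos_sub_one (h : Close s v 0 α 0 B) (i : Fin N) :
    WeakD i (fun x => Real.cos (2 * v x) - 1)
      (fun x => -2 * Real.sin (2 * v x) * reF (bes s (α i)) x) := by
  have h2 := h.weakD_cos i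
  simp only [Pi.zero_apply, mul_zero, Real.sin_zero, Real.cos_zero, zero_mul, sub_zero] at h2
  exact h2

theorem Close.hBound_sin_two_mul (h : Close s v 0 α 0 B) (i : Fin N) :
    HBound 0 (fun x => -2 * Real.sin (2 * v x) * reF (bes s (α i)) x) (2 * B) := by
  refine h.hBound_mul_left ?_ (fun x => ?_) i
  · exact ((Real.continuous_sin.comp (continuous_const_mul 2)).comp_aestronglyMeasurable
      h.left_meas).const_mul (-2)
  · rw [abs_mul, abs_neg, abs_two]
    linarith [Real.abs_sin_le_one (2 * v x)]

end

/-- The map `v ↦ sin (2v)` is bounded on bounded sets of `H_sin^{s+1}`, with values in `H^{s+1}`. -/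
theorem exists_hBound_sin (hN : N ≤ 3) (s : ℕ) (B : ℝ) : ∃ L : ℝ, ∀ (v : Space N → ℝ)
    (α : Fin N → L2C N), Close s v 0 α 0 B → HBound (s + 1) (fun x => Real.sin (2 * v x)) L := by
  -- For `s = 0` boundedness of the trigonometric functions is enough, for `s = 1` the products `∂ᵢv
  -- ∂ⱼv` are in `L²` by `H¹ × H¹ → L²`, and for `2 ≤ s` one has `N ≤ 3 < 2 * s`.
  obtain rfl | rfl | hs : s = 0 ∨ s = 1 ∨ 2 ≤ s := by omega
  · exact ⟨_, fun v α h => h.hBound_sin_one⟩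
  · obtain ⟨C, hC, hmul⟩ := exists_hBound_mul (N := N) (a := 1) (b := 1) (c := 0) (by omega)
      (by omega) (by omega)
    refine ⟨2 * B + N * (2 * B) + N * (2 * B + 2 * (2 * B + N * (2 * (C * B * B) + 2 * B))),
      fun v α h => ?_⟩
    have hB := h.nonneg
    have mc : AEStronglyMeasurable (fun x => Real.cos (2 * v x) - 1) volume :=
      ((Real.continuous_cos.comp (continuous_const_mul 2)).comp_aestronglyMeasurable
        h.left_meas).sub aestronglyMeasurable_const
    have hc2 : ∀ x, |Real.cos (2 * v x) - 1| ≤ 2 := fun x => by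
      rw [abs_le]
      constructor <;> linarith [Real.cos_le_one (2 * v x), Real.neg_one_le_cos (2 * v x)]
    have h1 := h.hBound_cos
    simp only [Pi.zero_apply, mul_zero, Real.cos_zero] at h1
    -- Membership of `cos 2v - 1` in `H¹` is needed for the product rule `WeakD.mul`.
    obtain ⟨z, hz, -⟩ := h1.succ h.hBound_sin_two_mul h.weakD_cos_sub_one
    have key : ∀ i, HBound 1 (fun x => (Real.cos (2 * v x) - 1) * reF (bes 1 (α i)) x)
        (2 * B + N * (2 * (C * B * B) + 2 * B)) := fun i => by
      have hd := fun j => Rep.weakD (s := 0) (h.left.rep i) j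
      refine (h.hBound_mul_left mc hc2 i).succ (fun j => ?_)
        fun j => WeakD.mul hz (h.left.rep i) (h.weakD_cos_sub_one j) (hd j).1 ?_ (hd j).2.memLp
      · have e1 := hmul _ _ _ _ (h.hBound_left j) (h.hBound_left i)
        refine HBound.add (hBound_zero_of_le
          (w := fun x => reF (bes 1 (α j)) x * reF (bes 1 (α i)) x) ?_ (by norm_num) e1.nonneg
          (fun x => ?_) e1.eLpNorm_le) (hBound_zero_of_le (w := reF (bes 0 (rie j (α i)))) ?_
          (by norm_num) hB (fun x => ?_) ?_)
        · obtain ⟨_, h3, -⟩ := h.hBound_sin_two_mul j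
          exact h3.memLp.1.mul (h.left.rep i).memLp.1
        · rw [mul_assoc, abs_mul, abs_mul, abs_neg, abs_two]
          gcongr
          linarith [Real.abs_sin_le_one (2 * v x)]
        · exact mc.mul (hd j).2.memLp.1
        · rw [abs_mul]
          gcongr
          exact hc2 x
        · rw [(hd j).2.eLpNorm_eq]
          refine ENNReal.ofReal_le_ofReal ((norm_bes_le _ _).trans ((norm_rie_le _ _).trans ?_))
          simpa using h.grad_le i
      · obtain ⟨_, h3, -⟩ := h.hBound_sin_two_mul j
        exact h3.memLp
    refine h.hBound_sin_one.succ (fun i => ?_)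
      fun i => weakD_sin_two (h.left i).1 (h.left.rep i).memLp
    refine ((h.hBound_left i).smul 2 |>.add ((key i).smul 2)).congr (ae_of_all _ fun x => ?_) |>.le ?_
    · simp only [Pi.add_apply, Pi.smul_apply, smul_eq_mul]; ring
    · rw [abs_two]
  · obtain ⟨L, hL, h⟩ := exists_hBound_sin_cos (N := N) (s := s) (by omega) (j := s + 1) le_rfl B
    refine ⟨L * B, fun v α hv => ?_⟩
    have h0 := (h v 0 α 0 B hv hv ⟨gradRep_zero s, gradRep_zero s,
      aestronglyMeasurable_const, aestronglyMeasurable_const, hv.nonneg, by simp, by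
        simpa using fun _ => hv.nonneg⟩).1
    simpa only [Pi.zero_apply, mul_zero, Real.sin_zero, sub_zero] using h0

end

end SineGordon

namespace SineGordon

noncomputable section

open FourierTransform SchwartzMap LineDeriv
open scoped ComplexConjugate

variable {N : ℕ}

/-! ### Weak and strong time derivatives -/

/-- The mean value inequality for `q ↦ ⟨w, ζ q - q G t⟩` bounds the pairing of `w` with the
remainder by `‖w‖ ε |r - t|`, where `ε` comes from the continuity of `G` and the range of `r` does
not depend on `w`. Density extends this from the span of `W` to every `w`, and taking `w` to be the
remainder concludes. -/
theorem hasDerivWithinAt_of_inner {W : Set (L2C N)}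
    (hW : ∀ f : L2C N, (∀ w ∈ W, inner ℂ w f = 0) → f = 0) {I : Set ℝ} (hI : Convex ℝ I)
    {ζ G : ℝ → L2C N} (hG : ContinuousOn G I)
    (h : ∀ w ∈ W, ∀ t ∈ I, HasDerivWithinAt (fun t => inner ℂ w (ζ t)) (inner ℂ w (G t)) I t)
    {t : ℝ} (ht : t ∈ I) : HasDerivWithinAt ζ (G t) I t := by
  have hS : ∀ w ∈ Submodule.span ℂ W, ∀ t ∈ I,
      HasDerivWithinAt (fun t => inner ℂ w (ζ t)) (inner ℂ w (G t)) I t := by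
    intro w hw
    induction hw using Submodule.span_induction with
    | mem w hw => exact h w hw
    | zero => intro t _; simpa using hasDerivWithinAt_const t I (0 : ℂ)
    | add x y _ _ hx hy =>
      intro t ht
      simp only [inner_add_left]
      exact (hx t ht).add (hy t ht)
    | smul c x _ hx =>
      intro t ht
      simp only [inner_smul_left]
      exact (hx t ht).const_mul _
  have hd : (Submodule.span ℂ W).topologicalClosure = ⊤ := by
    rw [Submodule.topologicalClosure_eq_top_iff, Submodule.eq_bot_iff]
    intro f hf
    exact hW f fun w hw => hf w (Submodule.subset_span hw)
  rw [hasDerivWithinAt_iff_isLittleO, Asymptotics.isLittleO_iff]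
  intro ε hε
  have h1 := Metric.continuousWithinAt_iff.mp (hG t ht) ε hε
  obtain ⟨δ, hδ, h1⟩ := h1
  have hconv : Convex ℝ (I ∩ Metric.ball t δ) := hI.inter (convex_ball t δ)
  filter_upwards [self_mem_nhdsWithin, mem_nhdsWithin_of_mem_nhds (Metric.ball_mem_nhds t hδ)]
    with r hr hrδ
  set x := ζ r - ζ t - (r - t) • G t with hx
  have key : ∀ w : L2C N, ‖inner ℂ w x‖ ≤ ‖w‖ * (ε * ‖r - t‖) := by
    intro w
    have hw : w ∈ (Submodule.span ℂ W).topologicalClosure := hd ▸ Submodule.mem_top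
    refine closure_minimal (s := (Submodule.span ℂ W : Set (L2C N)))
      (t := {w | ‖inner ℂ w x‖ ≤ ‖w‖ * (ε * ‖r - t‖)}) (fun w hw => ?_) ?_ hw
    · have e := Convex.norm_image_sub_le_of_norm_hasDerivWithin_le (s := I ∩ Metric.ball t δ)
        (f := fun q => inner ℂ w (ζ q) - ((q : ℝ) : ℂ) * inner ℂ w (G t))
        (f' := fun q => inner ℂ w (G q) - inner ℂ w (G t)) (C := ‖w‖ * ε)
        (fun q hq => ?_) (fun q hq => ?_) hconv ⟨ht, Metric.mem_ball_self hδ⟩ ⟨hr, hrδ⟩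
      · have e2 : inner ℂ w x = inner ℂ w (ζ r) - ((r : ℝ) : ℂ) * inner ℂ w (G t) -
            (inner ℂ w (ζ t) - ((t : ℝ) : ℂ) * inner ℂ w (G t)) := by
          have e3 : (r - t) • G t = (((r - t : ℝ)) : ℂ) • G t := (Complex.coe_smul _ _).symm
          rw [hx, inner_sub_right, inner_sub_right, e3, inner_smul_right]
          push_cast
          ring
        rw [mem_ofPred_eq, e2, ← mul_assoc]
        exact e
      · have e4 : HasDerivWithinAt (fun q : ℝ => ((q : ℝ) : ℂ) * inner ℂ w (G t))
            (1 * inner ℂ w (G t)) (I ∩ Metric.ball t δ) q :=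
          (Complex.ofRealCLM.hasDerivAt (x := q)).hasDerivWithinAt.mul_const _
        rw [one_mul] at e4
        exact ((hS w hw q hq.1).mono inter_subset_left).sub e4
      · rw [← inner_sub_right]
        refine (norm_inner_le_norm _ _).trans ?_
        gcongr
        have := h1 hq.1 hq.2
        rw [dist_eq_norm] at this
        exact this.le
    · exact isClosed_le (by fun_prop) (by fun_prop)
  have h3 := key x
  rw [inner_self_eq_norm_sq_to_K, norm_pow, RCLike.norm_ofReal, abs_norm] at h3
  by_cases hx0 : ‖x‖ = 0
  · rw [hx0]; positivity
  · have : 0 < ‖x‖ := lt_of_le_of_ne (norm_nonneg _) (Ne.symm hx0)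
    rw [sq] at h3
    exact le_of_mul_le_mul_left h3 this

/-- A test function as an element of `L²`. -/
def IsTest.toL {χ : Space N → ℝ} (hχ : IsTest χ) : L2C N := SineGordon.toL hχ.toSchwartz

theorem IsTest.inner_toL {χ : Space N → ℝ} (hχ : IsTest χ) {v : Space N → ℝ} {f : L2C N}
    (h : (fun x => (v x : ℂ)) =ᵐ[volume] f) :
    inner ℂ hχ.toL f = ((∫ x, v x * χ x : ℝ) : ℂ) := inner_toSchwartz hχ h

theorem eq_zero_of_inner_test {f : L2C N}
    (h : ∀ (χ : Space N → ℝ) (hχ : IsTest χ), inner ℂ hχ.toL f = 0) : f = 0 := by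
  apply Lp.ext
  have h1 := ae_eq_zero_of_integral_contDiff_smul_eq_zero (μ := (volume : Measure (Space N)))
    (f := (f : Space N → ℂ)) ((Lp.memLp f).locallyIntegrable (by norm_num)) fun χ h1 h2 => by
      have hχ : IsTest χ := ⟨h1, h2⟩
      rw [← h χ hχ, L2.inner_def]
      apply integral_congr_ae
      filter_upwards [hχ.toSchwartz.coeFn_toLp 2] with x hx
      rw [IsTest.toL, SineGordon.toL, hx]
      simp [IsTest.toSchwartz_apply, mul_comm]
  filter_upwards [h1, Lp.coeFn_zero ℂ 2 (volume : Measure (Space N))] with x e1 e2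
  rw [e1, e2]; rfl

/-- A derivative in a weaker norm is a derivative in `L²` if the candidate is continuous in `L²`.
The range of `bes r` is total since `bes r` is self-adjoint and injective. -/
theorem hasDerivWithinAt_of_bes {I : Set ℝ} (hI : Convex ℝ I) (r : ℕ) {ζ G : ℝ → L2C N}
    (hG : ContinuousOn G I)
    (h : ∀ t ∈ I, HasDerivWithinAt (fun t => bes r (ζ t)) (bes r (G t)) I t)
    {t : ℝ} (ht : t ∈ I) : HasDerivWithinAt ζ (G t) I t := by
  refine hasDerivWithinAt_of_inner (W := range (bes r)) (fun f hf => ?_) hI hG ?_ ht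
  · apply bes_injective r
    rw [map_zero]
    have := hf (bes r (bes r f)) ⟨_, rfl⟩
    rw [inner_bes] at this
    exact inner_self_eq_zero.mp this
  · rintro _ ⟨w, rfl⟩ t ht
    simp only [inner_bes]
    exact ((innerSL ℂ w).restrictScalars ℝ).hasFDerivAt.comp_hasDerivWithinAt t (h t ht)

/-! ### The linear part of the equation in the sense of distributions -/

theorem IsTest.laplacian_eq {χ : Space N → ℝ} (hχ : IsTest χ) (x : Space N) :
    Laplacian.laplacian χ x =
      ∑ i, SineGordon.partialD (fun _ : Fin 1 => i) (SineGordon.partialD (fun _ : Fin 1 => i) χ) x := by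
  have h := congrFun (InnerProductSpace.laplacian_eq_iteratedFDeriv_orthonormalBasis χ
    (EuclideanSpace.basisFun (Fin N) ℝ)) x
  rw [h]
  refine Finset.sum_congr rfl fun i _ => ?_
  rw [← partialD_cons i _ hχ.1]
  unfold SineGordon.partialD
  congr 1
  funext j
  refine Fin.cases ?_ (fun j => ?_) j <;> simp

/-- `∑ i, rie i (A i)` represents `Δv` at order `r`. As `v` itself may have no representative, the
Laplacian is tested through the gradient. -/
theorem GradRep.inner_test {r : ℕ} {v : Space N → ℝ} {A : Fin N → L2C N} (h : GradRep (r + 1) v A)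
    (hv : LocallyIntegrable v volume)
    {χ : Space N → ℝ} (hχ : IsTest χ) : inner ℂ (bes r hχ.toL) (∑ i, rie i (A i)) =
      ((∫ x, v x * Laplacian.laplacian χ x : ℝ) : ℂ) := by
  have h1 : ∀ i, inner ℂ (bes r hχ.toL) (rie i (A i)) = ((∫ x, v x *
      partialD (fun _ : Fin 1 => i) (partialD (fun _ : Fin 1 => i) χ) x : ℝ) : ℂ) := fun i => by
    have e1 := (h i).1.2.2 _ (hχ.partialD fun _ : Fin 1 => i)
    have e2 := inner_lineDeriv_toSchwartz hχ i (h.rep i)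
    rw [e1, pow_one, neg_one_mul, Complex.ofReal_neg, ← e2, ← inner_bes, ← bes_bes r 1, ← rie_toLp,
      bes_rie, inner_rie, neg_neg]
    rfl
  rw [inner_sum]
  simp only [h1]
  rw [← Complex.ofReal_sum, ← integral_finsetSum _ fun i _ =>
    ((hχ.partialD _).partialD _).integrable_mul hv]
  congr 2
  funext x
  rw [hχ.laplacian_eq, Finset.mul_sum]

end

end SineGordon

namespace SineGordon

noncomputable section

variable {N : ℕ}

/-! ### Solutions without initial conditions -/

/-- A solution on `I`, in `φ₀ + H^k`, without initial conditions. -/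
structure SolOn (σ : ℝ) (k : ℕ) (I : Set ℝ) (φ₀ : Space N → ℝ) (φ ψ : ℝ → Space N → ℝ) : Prop where
  contInH : ContInH k I φ₀ φ
  contInH_deriv : ContInH (k - 1) I 0 ψ
  hasTimeDeriv : HasTimeDeriv (k - 1) I φ ψ
  equation : ∀ χ : Space N → ℝ, IsTest χ → ∀ t ∈ I,
    HasDerivWithinAt (fun s => ∫ x, ψ s x * χ x)
      ((∫ x, φ t x * Laplacian.laplacian χ x) - σ / 2 * ∫ x, Real.sin (2 * φ t x) * χ x) I t

section

variable {σ : ℝ} {k : ℕ} {I J : Set ℝ} {φ₀ φ₁ : Space N → ℝ} {φ ψ φ' ψ' : ℝ → Space N → ℝ}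

theorem isSolution_iff : IsSolution σ k I φ₀ φ₁ φ ψ ↔
    SolOn σ k I φ₀ φ ψ ∧ φ 0 =ᵐ[volume] φ₀ ∧ ψ 0 =ᵐ[volume] φ₁ :=
  ⟨fun h => ⟨⟨h.1, h.2, h.3, h.4⟩, h.5, h.6⟩, fun h => ⟨h.1.1, h.1.2, h.1.3, h.1.4, h.2.1, h.2.2⟩⟩

theorem IsSolution.solOn (h : IsSolution σ k I φ₀ φ₁ φ ψ) : SolOn σ k I φ₀ φ ψ :=
  (isSolution_iff.mp h).1

theorem nhdsWithin_diff_le {t : ℝ} (hJ : J ∈ 𝓝[I] t) : 𝓝[I \ {t}] t ≤ 𝓝[J \ {t}] t := by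
  rw [sdiff_eq, sdiff_eq, nhdsWithin_inter', nhdsWithin_inter']
  exact inf_le_inf_right _ (nhdsWithin_le_iff.mpr hJ)

/-- Being a solution is a local property. -/
theorem solOn_of_local (h : ∀ t ∈ I, ∃ J, t ∈ J ∧ J ∈ 𝓝[I] t ∧ SolOn σ k J φ₀ φ ψ) :
    SolOn σ k I φ₀ φ ψ := by
  refine ⟨⟨fun t ht => ?_, fun t ht => ?_⟩, ⟨fun t ht => ?_, fun t ht => ?_⟩, fun t ht => ?_,
    fun χ hχ t ht => ?_⟩ <;> obtain ⟨J, htJ, hJ, hs⟩ := h t ht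
  · exact hs.contInH.1 t htJ
  · exact (hs.contInH.2 t htJ).mono_left (nhdsWithin_le_iff.mpr hJ)
  · exact hs.contInH_deriv.1 t htJ
  · exact (hs.contInH_deriv.2 t htJ).mono_left (nhdsWithin_le_iff.mpr hJ)
  · exact (hs.hasTimeDeriv t htJ).mono_left (nhdsWithin_diff_le hJ)
  · exact (hs.equation χ hχ t htJ).mono_of_mem_nhdsWithin hJ

theorem SolOn.mono (h : SolOn σ k I φ₀ φ ψ) (hJ : J ⊆ I) : SolOn σ k J φ₀ φ ψ :=
  solOn_of_local fun _ ht => ⟨I, hJ ht, mem_of_superset self_mem_nhdsWithin hJ, h⟩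

theorem SolOn.congr (h : SolOn σ k I φ₀ φ ψ) (hφ : ∀ t ∈ I, φ t =ᵐ[volume] φ' t)
    (hψ : ∀ t ∈ I, ψ t =ᵐ[volume] ψ' t) : SolOn σ k I φ₀ φ' ψ' := by
  refine ⟨⟨fun t ht => ?_, fun t ht => ?_⟩, ⟨fun t ht => ?_, fun t ht => ?_⟩, fun t ht => ?_,
    fun χ hχ t ht => ?_⟩
  · exact (h.contInH.1 t ht).congr ((hφ t ht).sub (ae_eq_refl _))
  · refine (h.contInH.2 t ht).congr' ?_
    filter_upwards [self_mem_nhdsWithin] with r hr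
    exact hNorm_congr ((hφ r hr).sub (hφ t ht)) _
  · exact (h.contInH_deriv.1 t ht).congr ((hψ t ht).sub (ae_eq_refl _))
  · refine (h.contInH_deriv.2 t ht).congr' ?_
    filter_upwards [self_mem_nhdsWithin] with r hr
    exact hNorm_congr ((hψ r hr).sub (hψ t ht)) _
  · refine (h.hasTimeDeriv t ht).congr' ?_
    filter_upwards [self_mem_nhdsWithin] with r hr
    exact hNorm_congr ((((hφ r hr.1).sub (hφ t ht)).const_smul _).sub (hψ t ht)) _
  · have e1 : ∀ r ∈ I, ∫ x, ψ' r x * χ x = ∫ x, ψ r x * χ x := fun r hr => integral_congr_ae <| by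
      filter_upwards [hψ r hr] with x hx
      rw [hx]
    have e2 : ∫ x, φ' t x * Laplacian.laplacian χ x = ∫ x, φ t x * Laplacian.laplacian χ x :=
      integral_congr_ae <| by
        filter_upwards [hφ t ht] with x hx
        rw [hx]
    have e3 : ∫ x, Real.sin (2 * φ' t x) * χ x = ∫ x, Real.sin (2 * φ t x) * χ x :=
      integral_congr_ae <| by
        filter_upwards [hφ t ht] with x hx
        rw [hx]
    rw [e2, e3]
    exact (h.equation χ hχ t ht).congr e1 (e1 t ht)

/-- Only the affine space `φ₀ + H^k` matters, so a solution can be restarted from its value at a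
later time. -/
theorem SolOn.change_ref {φ₀' : Space N → ℝ} (h : SolOn σ k I φ₀ φ ψ) (h0 : MemH k (φ₀ - φ₀')) :
    SolOn σ k I φ₀' φ ψ := by
  refine ⟨⟨fun t ht => ?_, h.contInH.2⟩, h.contInH_deriv, h.hasTimeDeriv, h.equation⟩
  exact ((h.contInH.1 t ht).add h0).congr (ae_of_all _ fun x => by simp)

/-- For `K` closed and `t ∉ K` the filter `𝓝[K] t` is trivial, so limits can be taken on the two
sets separately. -/
theorem SolOn.union (hI : IsClosed I) (hJ : IsClosed J) (h : SolOn σ k I φ₀ φ ψ)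
    (h' : SolOn σ k J φ₀ φ ψ) : SolOn σ k (I ∪ J) φ₀ φ ψ := by
  have bot : ∀ {K : Set ℝ}, IsClosed K → ∀ {t}, t ∉ K → 𝓝[K] t = ⊥ := fun hK _ ht => by
    rwa [← notMem_closure_iff_nhdsWithin_eq_bot, hK.closure_eq]
  have bot' : ∀ {K : Set ℝ}, IsClosed K → ∀ {t}, t ∉ K → 𝓝[K \ {t}] t = ⊥ := fun hK t ht =>
    le_bot_iff.mp ((nhdsWithin_mono t sdiff_subset).trans (bot hK ht).le)
  refine ⟨⟨fun t ht => ?_, fun t ht => ?_⟩, ⟨fun t ht => ?_, fun t ht => ?_⟩, fun t ht => ?_,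
    fun χ hχ t ht => ?_⟩
  · exact ht.elim (h.contInH.1 t) (h'.contInH.1 t)
  · rw [nhdsWithin_union, tendsto_sup]
    constructor
    · by_cases hi : t ∈ I
      · exact h.contInH.2 t hi
      · rw [bot hI hi]; exact tendsto_bot
    · by_cases hi : t ∈ J
      · exact h'.contInH.2 t hi
      · rw [bot hJ hi]; exact tendsto_bot
  · exact ht.elim (h.contInH_deriv.1 t) (h'.contInH_deriv.1 t)
  · rw [nhdsWithin_union, tendsto_sup]
    constructor
    · by_cases hi : t ∈ I
      · exact h.contInH_deriv.2 t hi
      · rw [bot hI hi]; exact tendsto_bot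
    · by_cases hi : t ∈ J
      · exact h'.contInH_deriv.2 t hi
      · rw [bot hJ hi]; exact tendsto_bot
  · rw [union_sdiff_distrib, nhdsWithin_union, tendsto_sup]
    constructor
    · by_cases hi : t ∈ I
      · exact h.hasTimeDeriv t hi
      · rw [bot' hI hi]; exact tendsto_bot
    · by_cases hi : t ∈ J
      · exact h'.hasTimeDeriv t hi
      · rw [bot' hJ hi]; exact tendsto_bot
  · rw [hasDerivWithinAt_iff_tendsto_slope, union_sdiff_distrib, nhdsWithin_union, tendsto_sup]
    constructor
    · by_cases hi : t ∈ I
      · exact hasDerivWithinAt_iff_tendsto_slope.mp (h.equation χ hχ t hi)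
      · rw [bot' hI hi]; exact tendsto_bot
    · by_cases hi : t ∈ J
      · exact hasDerivWithinAt_iff_tendsto_slope.mp (h'.equation χ hχ t hi)
      · rw [bot' hJ hi]; exact tendsto_bot

/-- Two solutions on closed intervals with a common end point can be glued. -/
theorem SolOn.glue {b : ℝ} (hI : IsClosed I) (hJ : IsClosed J) (hIb : ∀ t ∈ I, t ≤ b)
    (hJb : ∀ t ∈ J, b ≤ t) (h : SolOn σ k I φ₀ φ ψ) (h' : SolOn σ k J φ₀ φ' ψ')
    (hφ : φ b =ᵐ[volume] φ' b) (hψ : ψ b =ᵐ[volume] ψ' b) :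
    SolOn σ k (I ∪ J) φ₀ (fun t => if t ≤ b then φ t else φ' t)
      (fun t => if t ≤ b then ψ t else ψ' t) := by
  refine SolOn.union hI hJ (h.congr (fun t ht => ?_) fun t ht => ?_)
    (h'.congr (fun t ht => ?_) fun t ht => ?_)
  · rw [if_pos (hIb t ht)]
  · rw [if_pos (hIb t ht)]
  · rcases (hJb t ht).eq_or_lt with rfl | hlt
    · rw [if_pos le_rfl]; exact hφ.symm
    · rw [if_neg (not_le.mpr hlt)]
  · rcases (hJb t ht).eq_or_lt with rfl | hlt
    · rw [if_pos le_rfl]; exact hψ.symm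
    · rw [if_neg (not_le.mpr hlt)]

end

/-! ### Perturbations in `H_sin` -/

theorem abs_sin_add_le (x y : ℝ) : |Real.sin (x + y)| ≤ |Real.sin x| + |y| := by
  rw [Real.sin_add]
  refine (abs_add_le _ _).trans ?_
  rw [abs_mul, abs_mul]
  have h1 := Real.abs_cos_le_one y
  have h2 := Real.abs_cos_le_one x
  have h3 : |Real.sin y| ≤ |y| := Real.abs_sin_le_abs
  have h4 := abs_nonneg (Real.sin x)
  have h5 := abs_nonneg (Real.sin y)
  nlinarith

/-- By `|sin (x + y)| ≤ |sin x| + |y|`, perturbations in `H^{s+1}` increase the sine distance by at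
most the `L²` norm of their difference. -/
theorem Close.add {s : ℕ} {v w v' w' : Space N → ℝ} {α β : Fin N → L2C N} {d : ℝ} {u u' : L2C N}
    (h : Close s v w α β d) (hv : Rep (s + 1) v' u) (hw : Rep (s + 1) w' u') :
    Close s (v + v') (w + w') (α + fun i => rie i u) (β + fun i => rie i u') (d + ‖u - u'‖) where
  left := h.left.add hv.gradRep
  right := h.right.add hw.gradRep
  left_meas := h.left_meas.add hv.memLp.1
  right_meas := h.right_meas.add hw.memLp.1
  nonneg := add_nonneg h.nonneg (norm_nonneg _)
  sin_le := by
    have hsub := hv.sub hw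
    have m1 : AEStronglyMeasurable (fun x => |Real.sin (v x - w x)|) volume :=
      (Real.continuous_sin.comp_aestronglyMeasurable (h.left_meas.sub h.right_meas)).norm
    have m2 : AEStronglyMeasurable (fun x => |(v' - w') x|) volume := hsub.memLp.1.norm
    calc _ ≤ eLpNorm ((fun x => |Real.sin (v x - w x)|) + fun x => |(v' - w') x|) 2 volume := by
          refine eLpNorm_mono fun x => ?_
          refine le_trans (le_trans (le_of_eq ?_) (abs_sin_add_le (v x - w x) ((v' - w') x)))
            (le_abs_self _)
          rw [Real.norm_eq_abs]
          congr 2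
          simp only [Pi.add_apply, Pi.sub_apply]
          ring
      _ ≤ eLpNorm (fun x => |Real.sin (v x - w x)|) 2 volume +
          eLpNorm (fun x => |(v' - w') x|) 2 volume := eLpNorm_add_le m1 m2 (by norm_num)
      _ ≤ ENNReal.ofReal d + ENNReal.ofReal ‖u - u'‖ := by
          gcongr
          · exact (eLpNorm_norm (fun x => Real.sin (v x - w x))).trans_le h.sin_le
          · refine (eLpNorm_norm (v' - w')).trans_le ?_
            rw [hsub.eLpNorm_eq]
            exact ENNReal.ofReal_le_ofReal (norm_bes_le _ _)
      _ = _ := (ENNReal.ofReal_add h.nonneg (norm_nonneg _)).symm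
  grad_le := fun i => by
    have : (α + fun i => rie i u) i - (β + fun i => rie i u') i = (α i - β i) + rie i (u - u') := by
      simp only [Pi.add_apply, map_sub]; abel
    rw [this]
    exact (norm_add_le _ _).trans (add_le_add (h.grad_le i) (norm_rie_le _ _))

theorem Close.congr {s : ℕ} {v w v' w' : Space N → ℝ} {α β : Fin N → L2C N} {d : ℝ}
    (h : Close s v w α β d) (hv : v =ᵐ[volume] v') (hw : w =ᵐ[volume] w') :
    Close s v' w' α β d where
  left := fun i => ⟨(h.left i).1.congr hv (ae_eq_refl _), (h.left i).2⟩
  right := fun i => ⟨(h.right i).1.congr hw (ae_eq_refl _), (h.right i).2⟩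
  left_meas := h.left_meas.congr hv
  right_meas := h.right_meas.congr hw
  nonneg := h.nonneg
  sin_le := by
    refine le_trans (le_of_eq (eLpNorm_congr_ae ?_)) h.sin_le
    filter_upwards [hv, hw] with x h1 h2
    rw [h1, h2]
  grad_le := h.grad_le

theorem Close.le {s : ℕ} {v w : Space N → ℝ} {α β : Fin N → L2C N} {d d' : ℝ}
    (h : Close s v w α β d) (hd : d ≤ d') : Close s v w α β d' :=
  ⟨h.left, h.right, h.left_meas, h.right_meas, h.nonneg.trans hd,
    h.sin_le.trans (ENNReal.ofReal_le_ofReal hd), fun i => (h.grad_le i).trans hd⟩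

theorem Close.symm {s : ℕ} {v w : Space N → ℝ} {α β : Fin N → L2C N} {d : ℝ}
    (h : Close s v w α β d) : Close s w v β α d := by
  refine ⟨h.right, h.left, h.right_meas, h.left_meas, h.nonneg, le_trans (le_of_eq ?_) h.sin_le,
    fun i => by rw [norm_sub_rev]; exact h.grad_le i⟩
  rw [← eLpNorm_neg]
  congr 1
  funext x
  rw [Pi.neg_apply, ← Real.sin_neg, neg_sub]

theorem Close.add_left {s : ℕ} {v v' : Space N → ℝ} {α : Fin N → L2C N} {D : ℝ} {u : L2C N}
    (h : Close s v 0 α 0 D) (hv : Rep (s + 1) v' u) :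
    Close s (v + v') 0 (α + fun i => rie i u) 0 (D + ‖u‖) := by
  have := h.add hv (Rep.zero (s + 1))
  have e : ((0 : Fin N → L2C N) + fun i => rie i (0 : L2C N)) = 0 := by funext i; simp
  rwa [add_zero, sub_zero, e] at this

theorem LipschitzSin.exists_rep {s : ℕ} (hL : LipschitzSin N s) {v : Space N → ℝ}
    {α : Fin N → L2C N} {D : ℝ} (h : Close s v 0 α 0 D) :
    ∃ q, Rep s (fun x => Real.sin (2 * v x)) q := by
  obtain ⟨L, -, hL⟩ := hL D
  obtain ⟨q, hq, -⟩ := hL v 0 α 0 D h h ⟨gradRep_zero s, gradRep_zero s,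
    aestronglyMeasurable_const, aestronglyMeasurable_const, h.nonneg, by simp, by
      simpa using fun _ => h.nonneg⟩
  exact ⟨q, by simpa using hq⟩

end

end SineGordon

namespace SineGordon

noncomputable section

variable {N : ℕ}

/-! ### The equation as a system in `L²` -/

theorem LipschitzSin.exists_norm_sub_le {s : ℕ} (hL : LipschitzSin N s) (B : ℝ) :
    ∃ L : ℝ, 0 ≤ L ∧ ∀ (v w : Space N → ℝ) (α β : Fin N → L2C N) (d : ℝ) (q q' : L2C N),
      Close s v w α β d → Close s v 0 α 0 B → Close s w 0 β 0 B →
      Rep s (fun x => Real.sin (2 * v x)) q → Rep s (fun x => Real.sin (2 * w x)) q' →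
      ‖q - q'‖ ≤ L * d := by
  obtain ⟨L, hL0, hL⟩ := hL B
  refine ⟨L, hL0, fun v w α β d q q' h1 h2 h3 hq hq' => ?_⟩
  obtain ⟨z, hz, hzd⟩ := hL v w α β d h1 h2 h3
  rwa [(hq.sub hq').unique hz]

/-- The solution `φ = φ₀ + (1 - Δ)^{-(s+1)/2} u`, `ψ = (1 - Δ)^{-s/2} p`, with
`sin (2φ) = (1 - Δ)^{-s/2} q`, where `∂_i φ₀ = (1 - Δ)^{-s/2} α i`. -/
structure Evol (σ : ℝ) (s : ℕ) (I : Set ℝ) (φ₀ : Space N → ℝ) (α : Fin N → L2C N)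
    (φ ψ : ℝ → Space N → ℝ) (u p q : ℝ → L2C N) : Prop where
  rep_u : ∀ t ∈ I, Rep (s + 1) (φ t - φ₀) (u t)
  rep_p : ∀ t ∈ I, Rep s (ψ t) (p t)
  rep_q : ∀ t ∈ I, Rep s (fun x => Real.sin (2 * φ t x)) (q t)
  cont_u : ContinuousOn u I
  cont_p : ContinuousOn p I
  cont_q : ContinuousOn q I
  deriv_u : ∀ t ∈ I, HasDerivWithinAt (fun t => bes 1 (u t)) (p t) I t
  deriv_p : ∀ t ∈ I, HasDerivWithinAt (fun t => bes 1 (p t))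
    ((∑ i, rie i (α i + rie i (u t))) - (σ / 2) • bes 1 (q t)) I t

section

variable {σ : ℝ} {s : ℕ} {I : Set ℝ} {φ₀ : Space N → ℝ} {α : Fin N → L2C N} {D : ℝ}
  {φ ψ : ℝ → Space N → ℝ} {u p q : ℝ → L2C N}

theorem close_of_rep (h0 : Close s φ₀ 0 α 0 D) {v : Space N → ℝ} {y : L2C N}
    (h : Rep (s + 1) (v - φ₀) y) : Close s v 0 (α + fun i => rie i y) 0 (D + ‖y‖) :=
  (h0.add_left h).congr (ae_of_all _ fun x => by simp) (ae_eq_refl _)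

theorem close_of_rep₂ {φ₀' : Space N → ℝ} {β : Fin N → L2C N} {d : ℝ}
    (h0 : Close s φ₀ φ₀' α β d) {v w : Space N → ℝ} {y z : L2C N}
    (h : Rep (s + 1) (v - φ₀) y) (h' : Rep (s + 1) (w - φ₀') z) :
    Close s v w (α + fun i => rie i y) (β + fun i => rie i z) (d + ‖y - z‖) :=
  (h0.add h h').congr (ae_of_all _ fun x => by simp) (ae_of_all _ fun x => by simp)

theorem Close.refl_of (h0 : Close s φ₀ 0 α 0 D) : Close s φ₀ φ₀ α α 0 :=
  ⟨h0.left, h0.left, h0.left_meas, h0.left_meas, le_rfl, by simp, by simp⟩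

/-- Near `t` the norms of `u` stay below `‖u t‖ + 1`, so a single Lipschitz constant applies. -/
theorem continuousOn_of_rep_sin (hL : LipschitzSin N s) (h0 : Close s φ₀ 0 α 0 D)
    (hu : ∀ t ∈ I, Rep (s + 1) (φ t - φ₀) (u t)) (huc : ContinuousOn u I)
    (hq : ∀ t ∈ I, Rep s (fun x => Real.sin (2 * φ t x)) (q t)) : ContinuousOn q I := by
  intro t ht
  obtain ⟨L, hL0, hL⟩ := hL.exists_norm_sub_le (D + (‖u t‖ + 1))
  have h1 : ∀ᶠ r in 𝓝[I] t, ‖u r‖ < ‖u t‖ + 1 :=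
    (huc t ht).norm.eventually (gt_mem_nhds (lt_add_one _))
  have h2 : Tendsto (fun r => L * ‖u r - u t‖) (𝓝[I] t) (𝓝 0) := by
    have := ((huc t ht).tendsto.sub_const (u t)).norm.const_mul L
    simpa using this
  rw [ContinuousWithinAt, tendsto_iff_norm_sub_tendsto_zero]
  refine squeeze_zero' (Eventually.of_forall fun _ => norm_nonneg _) ?_ h2
  filter_upwards [h1, self_mem_nhdsWithin] with r hr hrI
  have c1 := close_of_rep₂ h0.refl_of (hu r hrI) (hu t ht)
  rw [zero_add] at c1
  exact hL _ _ _ _ _ _ _ c1 ((close_of_rep h0 (hu r hrI)).le (by linarith))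
    ((close_of_rep h0 (hu t ht)).le (by linarith)) (hq r hrI) (hq t ht)

theorem locallyIntegrable_of_rep (h0 : LocallyIntegrable φ₀ volume) {v : Space N → ℝ} {y : L2C N}
    (h : Rep (s + 1) (v - φ₀) y) : LocallyIntegrable v volume := by
  have := h0.add h.locallyIntegrable
  simpa using this

theorem Evol.inner_deriv {r : ℕ} {v w : Space N → ℝ} {A : Fin N → L2C N} {Q P : L2C N}
    (hA : GradRep (r + 1) v A) (hv : LocallyIntegrable v volume)
    (hq : Rep (r + 1) (fun x => Real.sin (2 * v x)) Q) (hw : Rep (r + 1) w P)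
    {χ : Space N → ℝ} (hχ : IsTest χ) :
    inner ℂ (bes r hχ.toL) (bes 1 P) = ((∫ x, w x * χ x : ℝ) : ℂ) ∧
    inner ℂ (bes r hχ.toL) ((∑ i, rie i (A i)) - (σ / 2) • bes 1 Q) =
      (((∫ x, v x * Laplacian.laplacian χ x) - σ / 2 * ∫ x, Real.sin (2 * v x) * χ x : ℝ) : ℂ) := by
  constructor
  · rw [inner_bes, bes_bes, hχ.inner_toL hw]
  · have e : (σ / 2) • bes 1 Q = (((σ / 2 : ℝ)) : ℂ) • bes 1 Q := (Complex.coe_smul _ _).symm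
    rw [inner_sub_right, hA.inner_test hv, e, inner_smul_right, inner_bes, bes_bes, hχ.inner_toL hq]
    push_cast
    ring

/-- The passage from distributions to `L²`. With `s = r + 1`, the equation gives the derivative of
`bes 1 p` paired with each `bes r χ`; these vectors are total since `bes r` is self-adjoint and
injective, so `hasDerivWithinAt_of_inner` applies. -/
theorem SolOn.exists_evol (hs : 1 ≤ s) (hL : LipschitzSin N s) (h0 : Close s φ₀ 0 α 0 D)
    (hφ₀ : LocallyIntegrable φ₀ volume) (hI : Convex ℝ I) (h : SolOn σ (s + 1) I φ₀ φ ψ) :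
    ∃ u p q, Evol σ s I φ₀ α φ ψ u p q := by
  choose! u hu using fun t ht => memH_iff.mp (h.contInH.1 t ht)
  choose! p hp using fun t ht => memH_iff.mp (h.contInH_deriv.1 t ht)
  simp only [sub_zero, Nat.add_sub_cancel] at hp
  choose! q hq using fun t ht => hL.exists_rep (close_of_rep h0 (hu t ht))
  have hdu : ∀ r ∈ I, ∀ t ∈ I, Rep (s + 1) (φ r - φ t) (u r - u t) := fun r hr t ht =>
    ((hu r hr).sub (hu t ht)).congr (ae_of_all _ fun x => by simp)
  have cu : ContinuousOn u I := fun t ht => by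
    have := (tendsto_hNorm_iff (l := 𝓝[I] t) (y := fun r => u r - u t)
      (by filter_upwards [self_mem_nhdsWithin] with r hr using hdu r hr t ht)).mp (h.contInH.2 t ht)
    rwa [tendsto_sub_nhds_zero_iff] at this
  have cp : ContinuousOn p I := fun t ht => by
    have := (tendsto_hNorm_iff (l := 𝓝[I] t) (y := fun r => p r - p t)
      (by filter_upwards [self_mem_nhdsWithin] with r hr using (hp r hr).sub (hp t ht))).mp
      (h.contInH_deriv.2 t ht)
    rwa [tendsto_sub_nhds_zero_iff] at this
  have cq := continuousOn_of_rep_sin hL h0 hu cu hq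
  refine ⟨u, p, q, hu, hp, hq, cu, cp, cq, fun t ht => ?_, fun t ht => ?_⟩
  · rw [hasDerivWithinAt_iff_tendsto_slope]
    have := (tendsto_hNorm_iff (l := 𝓝[I \ {t}] t)
      (y := fun r => (r - t)⁻¹ • (bes 1 (u r) - bes 1 (u t)) - p t) (by
        filter_upwards [self_mem_nhdsWithin] with r hr
        have h1 := (((hdu r hr.1 t ht).mono).smul (r - t)⁻¹).sub (hp t ht)
        rwa [map_sub] at h1)).mp (h.hasTimeDeriv t ht)
    rw [tendsto_sub_nhds_zero_iff] at this
    exact this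
  · obtain ⟨r, rfl⟩ : ∃ r, s = r + 1 := ⟨s - 1, by omega⟩
    refine hasDerivWithinAt_of_inner
      (G := fun t => (∑ i, rie i (α i + rie i (u t))) - (σ / 2) • bes 1 (q t))
      (W := {w | ∃ (χ : Space N → ℝ) (hχ : IsTest χ), w = bes r hχ.toL})
      (fun f hf => ?_) hI ?_ ?_ ht
    · apply bes_injective r
      rw [map_zero]
      refine eq_zero_of_inner_test fun χ hχ => ?_
      rw [← inner_bes]
      exact hf _ ⟨χ, hχ, rfl⟩
    · refine ContinuousOn.sub (continuousOn_finsetSum _ fun i _ => ?_) ?_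
      · exact (rie i).continuous.comp_continuousOn
          (continuousOn_const.add ((rie i).continuous.comp_continuousOn cu))
      · exact ((bes 1).continuous.comp_continuousOn cq).const_smul (σ / 2)
    · rintro _ ⟨χ, hχ, rfl⟩ t ht
      have e : ∀ t ∈ I, _ := fun t ht => Evol.inner_deriv (σ := σ) (close_of_rep h0 (hu t ht)).left
        (locallyIntegrable_of_rep hφ₀ (hu t ht)) (hq t ht) (hp t ht) hχ
      have e1 := (Complex.ofRealCLM.hasFDerivAt.comp_hasDerivWithinAt t (h.equation χ hχ t ht))
      have e2 := (e t ht).2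
      simp only [Pi.add_apply] at e2
      rw [e2]
      exact e1.congr (fun r hr => (e r hr).1) (e t ht).1

theorem Evol.solOn (hs : 1 ≤ s) (h0 : Close s φ₀ 0 α 0 D) (hφ₀ : LocallyIntegrable φ₀ volume)
    (h : Evol σ s I φ₀ α φ ψ u p q) : SolOn σ (s + 1) I φ₀ φ ψ := by
  have hu := h.rep_u
  have hp := h.rep_p
  have hdu : ∀ r ∈ I, ∀ t ∈ I, Rep (s + 1) (φ r - φ t) (u r - u t) := fun r hr t ht =>
    ((hu r hr).sub (hu t ht)).congr (ae_of_all _ fun x => by simp)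
  refine ⟨⟨fun t ht => (hu t ht).memH, fun t ht => ?_⟩, ⟨fun t ht => ?_, fun t ht => ?_⟩,
    fun t ht => ?_, fun χ hχ t ht => ?_⟩
  · refine (tendsto_hNorm_iff (l := 𝓝[I] t) (y := fun r => u r - u t)
      (by filter_upwards [self_mem_nhdsWithin] with r hr using hdu r hr t ht)).mpr ?_
    rw [tendsto_sub_nhds_zero_iff]
    exact h.cont_u t ht
  · rw [sub_zero]
    exact (hp t ht).memH
  · refine (tendsto_hNorm_iff (l := 𝓝[I] t) (y := fun r => p r - p t)
      (by filter_upwards [self_mem_nhdsWithin] with r hr using (hp r hr).sub (hp t ht))).mpr ?_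
    rw [tendsto_sub_nhds_zero_iff]
    exact h.cont_p t ht
  · refine (tendsto_hNorm_iff (l := 𝓝[I \ {t}] t)
      (y := fun r => (r - t)⁻¹ • (bes 1 (u r) - bes 1 (u t)) - p t) (by
        filter_upwards [self_mem_nhdsWithin] with r hr
        have h1 := (((hdu r hr.1 t ht).mono).smul (r - t)⁻¹).sub (hp t ht)
        rwa [map_sub] at h1)).mpr ?_
    rw [tendsto_sub_nhds_zero_iff]
    exact hasDerivWithinAt_iff_tendsto_slope.mp (h.deriv_u t ht)
  · obtain ⟨r, rfl⟩ : ∃ r, s = r + 1 := ⟨s - 1, by omega⟩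
    have e : ∀ t ∈ I, _ := fun t ht => Evol.inner_deriv (σ := σ) (close_of_rep h0 (hu t ht)).left
        (locallyIntegrable_of_rep hφ₀ (hu t ht)) (h.rep_q t ht) (hp t ht) hχ
    have e1 := (((innerSL ℂ (bes r hχ.toL)).restrictScalars ℝ).hasFDerivAt).comp_hasDerivWithinAt t
      (h.deriv_p t ht)
    have e2 := Complex.reCLM.hasFDerivAt.comp_hasDerivWithinAt t e1
    have e3 := (e t ht).2
    simp only [Pi.add_apply] at e3
    have e4 : Complex.reCLM (((innerSL ℂ (bes r hχ.toL)).restrictScalars ℝ)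
        ((∑ i, rie i (α i + rie i (u t))) - (σ / 2) • bes 1 (q t))) =
        (∫ x, φ t x * Laplacian.laplacian χ x) - σ / 2 * ∫ x, Real.sin (2 * φ t x) * χ x := by
      change (inner ℂ (bes r hχ.toL) _).re = _
      rw [e3, Complex.ofReal_re]
    rw [e4] at e2
    have e5 : ∀ r' ∈ I, ∫ x, ψ r' x * χ x = Complex.reCLM (((innerSL ℂ (bes r hχ.toL)).restrictScalars ℝ)
        (bes 1 (p r'))) := fun r' hr' => by
      change _ = (inner ℂ (bes r hχ.toL) _).re
      rw [(e r' hr').1, Complex.ofReal_re]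
    exact e2.congr e5 (e5 t ht)

end

end

end SineGordon

namespace SineGordon

noncomputable section

open scoped ComplexConjugate

variable {N : ℕ}

/-! ### Conjugation with the Klein-Gordon group -/

/-- The real part. -/
def reL : L2C N →L[ℝ] L2C N := (1 / 2 : ℝ) • (ContinuousLinearMap.id ℝ (L2C N) + conjL)

/-- The imaginary part. -/
def imL (f : L2C N) : L2C N := reL (-(Complex.I • f))

theorem reL_apply (f : L2C N) : reL f = (1 / 2 : ℝ) • (f + conjL f) := rfl

theorem norm_conjL (f : L2C N) : ‖conjL f‖ = ‖f‖ := by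
  rw [Lp.norm_def, Lp.norm_def, eLpNorm_congr_ae (coeFn_conjL f)]
  congr 1
  exact eLpNorm_congr_norm_ae (ae_of_all _ fun x => by simp)

theorem norm_reL_le (f : L2C N) : ‖reL f‖ ≤ ‖f‖ := by
  rw [reL_apply, norm_smul]
  have := norm_add_le f (conjL f)
  rw [norm_conjL] at this
  norm_num
  linarith

theorem norm_imL_le (f : L2C N) : ‖imL f‖ ≤ ‖f‖ := by
  refine (norm_reL_le _).trans (le_of_eq ?_)
  rw [norm_neg, norm_smul, Complex.norm_I, one_mul]

theorem conjL_reL (f : L2C N) : conjL (reL f) = reL f := by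
  rw [reL_apply, map_smul, map_add, conjL_conjL, add_comm]

theorem conjL_imL (f : L2C N) : conjL (imL f) = imL f := conjL_reL _

theorem reL_of_real {f : L2C N} (h : conjL f = f) : reL f = f := by
  rw [reL_apply, h, ← two_smul ℝ f, smul_smul]; norm_num

theorem reL_I_smul_of_real {f : L2C N} (h : conjL f = f) : reL (Complex.I • f) = 0 := by
  rw [reL_apply, conjL_smul, h, Complex.conj_I, neg_smul, add_neg_cancel, smul_zero]

/-- Real and imaginary parts recover the two real unknowns from the complex one, and they are
contractions. -/
theorem reL_add_I_smul {a b : L2C N} (ha : conjL a = a) (hb : conjL b = b) :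
    reL (a + Complex.I • b) = a := by
  rw [map_add, reL_of_real ha, reL_I_smul_of_real hb, add_zero]

theorem imL_add_I_smul {a b : L2C N} (ha : conjL a = a) (hb : conjL b = b) :
    imL (a + Complex.I • b) = b := by
  rw [imL, smul_add, smul_smul, Complex.I_mul_I, neg_one_smul, neg_add, neg_neg, map_add, map_neg,
    reL_I_smul_of_real ha, reL_of_real hb, neg_zero, zero_add]

theorem reL_bes (r : ℕ) (f : L2C N) : reL (bes r f) = bes r (reL f) := by
  rw [reL_apply, reL_apply, conjL_bes, ← map_add]
  exact ((bes r).map_smul_of_tower (1 / 2 : ℝ) _).symm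

/-- The force in the half-wave equation. -/
def force (σ : ℝ) (u q : L2C N) : L2C N := bes 1 u - (σ / 2) • q

/-- The unknown of the half-wave equation. -/
def wave (α : Fin N → L2C N) (u p : L2C N) : L2C N := (u - ∑ i, rie i (α i)) + Complex.I • p

theorem conjL_sum_rie {α : Fin N → L2C N} (h : ∀ i, conjL (α i) = α i) :
    conjL (∑ i, rie i (α i)) = ∑ i, rie i (α i) := by
  rw [map_sum]
  simp only [conjL_rie, h]

theorem conjL_force {σ : ℝ} {u q : L2C N} (hu : conjL u = u) (hq : conjL q = q) :
    conjL (force σ u q) = force σ u q := by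
  rw [force, map_sub, conjL_bes, hu, map_smul, hq]

theorem bes_smul_real (r : ℕ) (c : ℝ) (f : L2C N) : bes r (c • f) = c • bes r f :=
  (bes r).map_smul_of_tower c f

theorem sum_rie_eq (α : Fin N → L2C N) (u : L2C N) :
    ∑ i, rie i (α i + rie i u) = (∑ i, rie i (α i)) + (bes 2 u - u) := by
  simp only [map_add, Finset.sum_add_distrib]
  congr 1
  have := bes_two_sub_sum_rie u
  rw [eq_comm, sub_eq_iff_eq_add, ← sub_eq_iff_eq_add']
  exact this.symm ▸ rfl

/-- The Laplacian is written as `-(1 - Δ)` plus the identity: the first goes to the linear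
Klein-Gordon flow, the second becomes the term `bes 1 u` of `force`. The gradient of `φ₀` enters
only through the constant `∑ i, rie i (α i)`. -/
theorem deriv_p_eq (σ : ℝ) (α : Fin N → L2C N) (u q : L2C N) :
    (∑ i, rie i (α i + rie i u)) - (σ / 2) • bes 1 q =
      bes 1 (force σ u q) - (u - ∑ i, rie i (α i)) := by
  rw [sum_rie_eq, force, map_sub, bes_bes, bes_smul_real]
  abel

section

variable {σ : ℝ} {s : ℕ} {I : Set ℝ} {φ₀ : Space N → ℝ} {α : Fin N → L2C N} {D : ℝ}
  {φ ψ : ℝ → Space N → ℝ} {u p q : ℝ → L2C N}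

theorem continuousOn_kg {f : ℝ → L2C N} (hf : ContinuousOn f I) :
    ContinuousOn (fun t => kg t (f t)) I := fun t ht =>
  tendsto_kg_apply (tendsto_id.mono_left nhdsWithin_le_nhds) (hf t ht)

/-- After conjugation with the group no derivative is lost. The product rule is available once `bes
1` is applied, where the two terms `± i · wave` cancel; the result is lifted back by
`hasDerivWithinAt_of_bes`. -/
theorem Evol.hasDerivWithinAt_kg (h : Evol σ s I φ₀ α φ ψ u p q) (hI : Convex ℝ I) {t : ℝ}
    (ht : t ∈ I) : HasDerivWithinAt (fun t => kg t (wave α (u t) (p t)))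
      (kg t (Complex.I • force σ (u t) (q t))) I t := by
  refine hasDerivWithinAt_of_bes hI 1 (G := fun t => kg t (Complex.I • force σ (u t) (q t)))
    (continuousOn_kg ?_) (fun t ht => ?_) ht
  · exact (((bes 1).continuous.comp_continuousOn h.cont_u).sub
      (h.cont_q.const_smul (σ / 2))).const_smul Complex.I
  · have h1 : HasDerivWithinAt (fun t => bes 1 (wave α (u t) (p t)))
        (p t + Complex.I • (bes 1 (force σ (u t) (q t)) - (u t - ∑ i, rie i (α i)))) I t := by
      have h2 := (h.deriv_u t ht).sub_const (bes 1 (∑ i, rie i (α i)))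
      have h3 := (h.deriv_p t ht).const_smul Complex.I
      rw [deriv_p_eq] at h3
      have h4 := h2.add h3
      refine h4.congr (fun r _ => ?_) ?_ <;>
      · rw [wave, map_add, map_sub, map_smul]; rfl
    have h5 := SineGordon.hasDerivWithinAt_kg 1 h1 rfl
    simp only [one_mul, Complex.ofReal_one] at h5
    refine (h5.congr (fun r _ => bes_kg _ _ _) (bes_kg _ _ _)).congr_deriv ?_
    rw [bes_kg, map_smul]
    congr 1
    rw [wave, smul_add, smul_smul, Complex.I_mul_I, neg_one_smul, smul_sub, smul_sub]
    abel

/-- The converse reduction, from the differential equation in `L²` to the system: undoing the group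
and taking real and imaginary parts gives `u`, shifted by `∑ i, rie i (α i)`, and `p`. -/
theorem evol_of_hasDerivWithinAt (hL : LipschitzSin N s) (h0 : Close s φ₀ 0 α 0 D)
    {ζ : ℝ → L2C N} (hq : ∀ t ∈ I, Rep s (fun x => Real.sin (2 * φ t x)) (q t))
    (hu : ∀ t, u t = reL (kg (-t) (ζ t)) + ∑ i, rie i (α i)) (hp : ∀ t, p t = imL (kg (-t) (ζ t)))
    (hφ : ∀ t, φ t = φ₀ + reF (bes (s + 1) (u t))) (hψ : ∀ t, ψ t = reF (bes s (p t)))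
    (h : ∀ t ∈ I, HasDerivWithinAt ζ (kg t (Complex.I • force σ (u t) (q t))) I t) :
    Evol σ s I φ₀ α φ ψ u p q := by
  have hα : ∀ i, conjL (α i) = α i := fun i => (h0.left i).2
  have hur : ∀ t, conjL (u t) = u t := fun t => by
    rw [hu, map_add, conjL_reL, conjL_sum_rie hα]
  have hpr : ∀ t, conjL (p t) = p t := fun t => by rw [hp, conjL_imL]
  have rep_u : ∀ t ∈ I, Rep (s + 1) (φ t - φ₀) (u t) := fun t _ => by
    rw [hφ, add_sub_cancel_left]
    exact rep_reF (hur t)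
  have hζc : ContinuousOn (fun t => kg (-t) (ζ t)) I := fun t ht =>
    tendsto_kg_apply ((continuous_neg.tendsto t).mono_left nhdsWithin_le_nhds)
      (h t ht).continuousWithinAt
  have cu : ContinuousOn u I := by
    rw [show u = fun t => reL (kg (-t) (ζ t)) + ∑ i, rie i (α i) from funext hu]
    exact (reL.continuous.comp_continuousOn hζc).add continuousOn_const
  have cp : ContinuousOn p I := by
    rw [show p = fun t => imL (kg (-t) (ζ t)) from funext hp]
    exact reL.continuous.comp_continuousOn ((hζc.const_smul Complex.I).neg)
  have hd : ∀ t ∈ I, HasDerivWithinAt (fun t => bes 1 (kg (-t) (ζ t)))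
      (Complex.I • bes 1 (force σ (u t) (q t)) - Complex.I • kg (-t) (ζ t)) I t := fun t ht => by
    have h1 : HasDerivWithinAt (fun t => bes 1 (ζ t))
        (bes 1 (kg t (Complex.I • force σ (u t) (q t)))) I t :=
      ((bes 1).restrictScalars ℝ).hasFDerivAt.comp_hasDerivWithinAt t (h t ht)
    have h2 := SineGordon.hasDerivWithinAt_kg (-1) h1 rfl
    simp only [neg_one_mul] at h2
    refine (h2.congr (fun r _ => bes_kg _ _ _) (bes_kg _ _ _)).congr_deriv ?_
    rw [bes_kg, map_add, kg_neg_kg, map_smul, map_smul]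
    simp [sub_eq_add_neg]
  have hF : ∀ t ∈ I, conjL (force σ (u t) (q t)) = force σ (u t) (q t) := fun t ht =>
    conjL_force (hur t) (hq t ht).conj
  refine ⟨rep_u, fun t _ => ?_, hq, cu, cp, continuousOn_of_rep_sin hL h0 rep_u cu hq,
    fun t ht => ?_, fun t ht => ?_⟩
  · rw [hψ]; exact rep_reF (hpr t)
  · have h1 := ((reL (N := N)).hasFDerivAt.comp_hasDerivWithinAt t (hd t ht)).add_const
      (bes 1 (∑ i, rie i (α i)))
    refine (h1.congr (fun r _ => ?_) ?_).congr_deriv ?_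
    · rw [hu, map_add, Function.comp_apply, reL_bes]
    · rw [hu, map_add, Function.comp_apply, reL_bes]
    · rw [map_sub, reL_I_smul_of_real (by rw [conjL_bes, hF t ht]), hp, imL, map_neg, zero_sub]
  · have h1 := (reL (N := N)).hasFDerivAt.comp_hasDerivWithinAt t
      ((hd t ht).const_smul Complex.I).neg
    refine (h1.congr (fun r _ => ?_) ?_).congr_deriv ?_
    · rw [hp, imL, ← reL_bes, map_neg, map_smul]; rfl
    · rw [hp, imL, ← reL_bes, map_neg, map_smul]; rfl
    · have hb : reL (bes 1 (force σ (u t) (q t))) = bes 1 (force σ (u t) (q t)) :=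
        reL_of_real (by rw [conjL_bes, hF t ht])
      have hr : u t - ∑ i, rie i (α i) = reL (kg (-t) (ζ t)) := by rw [hu t, add_sub_cancel_right]
      rw [deriv_p_eq, smul_sub, smul_smul, smul_smul, Complex.I_mul_I, neg_one_smul, neg_one_smul,
        neg_sub, sub_neg_eq_add, map_add, map_neg, hb, hr]
      abel

end

end

end SineGordon

open scoped NNReal

namespace SineGordon

noncomputable section

variable {N : ℕ}

/-! ### Local existence -/

theorem norm_sum_rie_le {α : Fin N → L2C N} {d : ℝ} (h : ∀ i, ‖α i‖ ≤ d) :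
    ‖∑ i, rie i (α i)‖ ≤ N * d := by
  refine (norm_sum_le _ _).trans ?_
  calc _ ≤ ∑ _i : Fin N, d := Finset.sum_le_sum fun i _ => (norm_rie_le _ _).trans (h i)
    _ = _ := by simp

theorem norm_force_le (σ : ℝ) (u q : L2C N) : ‖force σ u q‖ ≤ ‖u‖ + |σ| * ‖q‖ := by
  refine (norm_sub_le _ _).trans (add_le_add (norm_bes_le _ _) ?_)
  rw [norm_smul, Real.norm_eq_abs, abs_div, abs_two]
  have := abs_nonneg σ
  have := norm_nonneg q
  gcongr
  linarith

theorem force_sub (σ : ℝ) (u q u' q' : L2C N) :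
    force σ u q - force σ u' q' = force σ (u - u') (q - q') := by
  simp only [force, map_sub, smul_sub]; abel

theorem norm_I_smul (f : L2C N) : ‖Complex.I • f‖ = ‖f‖ := by
  rw [norm_smul, Complex.norm_I, one_mul]

theorem close_zero_zero {s : ℕ} {B : ℝ} (hB : 0 ≤ B) : Close s (0 : Space N → ℝ) 0 0 0 B :=
  ⟨gradRep_zero s, gradRep_zero s, aestronglyMeasurable_const, aestronglyMeasurable_const, hB,
    by simp, by simpa using fun _ => hB⟩

theorem Close.norm_le {s : ℕ} {φ₀ : Space N → ℝ} {α : Fin N → L2C N} {D : ℝ}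
    (h : Close s φ₀ 0 α 0 D) (i : Fin N) : ‖α i‖ ≤ D := by simpa using h.grad_le i

/-- If `g` exceeded `b`, there would be a first time with `g = b`. Up to that time `g ≤ b`, so the
hypothesis gives `g ≤ a < b` there. -/
theorem forall_le_of_bootstrap {g : ℝ → ℝ} {t₀ T a b : ℝ} (hab : a < b)
    (hg : ContinuousOn g (Icc t₀ T)) (h0 : g t₀ ≤ a)
    (h : ∀ t ∈ Icc t₀ T, (∀ r ∈ Icc t₀ t, g r ≤ b) → g t ≤ a) : ∀ t ∈ Icc t₀ T, g t ≤ a := by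
  suffices hb : ∀ t ∈ Icc t₀ T, g t ≤ b from fun t ht =>
    h t ht fun r hr => hb r ⟨hr.1, hr.2.trans ht.2⟩
  by_contra! hcon
  obtain ⟨t₁, ht₁, hgt⟩ := hcon
  have ivt : ∀ t ∈ Icc t₀ t₁, b < g t → ∃ r ∈ Icc t₀ t, g r = b := fun t ht hbt => by
    have hc : ContinuousOn g (Icc t₀ t) := hg.mono (Icc_subset_Icc_right (ht.2.trans ht₁.2))
    exact intermediate_value_Icc ht.1 hc ⟨h0.trans hab.le, hbt.le⟩
  have hc : IsCompact (Icc t₀ t₁ ∩ g ⁻¹' {b}) :=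
    isCompact_Icc.of_isClosed_subset ((hg.mono (Icc_subset_Icc_right ht₁.2)).preimage_isClosed_of_isClosed
      isClosed_Icc isClosed_singleton) inter_subset_left
  obtain ⟨r₁, hr₁, hgr₁⟩ := ivt t₁ ⟨ht₁.1, le_rfl⟩ hgt
  obtain ⟨r, hr, hmin⟩ := hc.exists_isLeast ⟨r₁, hr₁, hgr₁⟩
  have hgr : g r = b := hr.2
  have h1 := h r ⟨hr.1.1, hr.1.2.trans ht₁.2⟩ fun t ht => by
    by_contra! hlt
    obtain ⟨t', ht', hgt'⟩ := ivt t ⟨ht.1, ht.2.trans hr.1.2⟩ hlt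
    have h2 := hmin ⟨⟨ht'.1, ht'.2.trans (ht.2.trans hr.1.2)⟩, hgt'⟩
    have h3 : t = r := le_antisymm ht.2 (h2.trans ht'.2)
    rw [h3, hgr] at hlt
    exact lt_irrefl _ hlt
  linarith

/-- Picard-Lindelöf for `ζ` on the unit ball of `L²` around its initial value. The group being
isometric, all bounds are uniform in time and depend on the data only through `D` and `M`, and so
does `τ`. -/
theorem exists_local_solOn (σ : ℝ) {s : ℕ} (hs : 1 ≤ s) (hL : LipschitzSin N s) (D M : ℝ) :
    ∃ τ B : ℝ, 0 < τ ∧ ∀ (φ₀ φ₁ : Space N → ℝ) (α : Fin N → L2C N) (p₀ : L2C N) (t₀ : ℝ),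
      Close s φ₀ 0 α 0 D → LocallyIntegrable φ₀ volume → Rep s φ₁ p₀ → ‖p₀‖ ≤ M →
      ∃ φ ψ, SolOn σ (s + 1) (Icc t₀ (t₀ + τ)) φ₀ φ ψ ∧ φ t₀ =ᵐ[volume] φ₀ ∧
        ψ t₀ =ᵐ[volume] φ₁ ∧ ∀ t ∈ Icc t₀ (t₀ + τ),
          HBound (s + 1) (φ t - φ₀) B ∧ HBound s (ψ t) B := by
  by_cases hDM : 0 ≤ D ∧ 0 ≤ M
  swap
  · refine ⟨1, 0, one_pos, fun φ₀ φ₁ α p₀ t₀ h0 _ _ hp => (hDM ⟨h0.nonneg, ?_⟩).elim⟩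
    exact (norm_nonneg _).trans hp
  obtain ⟨hD, hM⟩ := hDM
  -- The initial wave has norm at most `N D + M`, the ball has radius `1`, and the shift `e` has
  -- norm at most `N D`.
  set ρ : ℝ := N * D + M + 1 + N * D with hρ
  have hρ0 : 0 ≤ ρ := by positivity
  obtain ⟨L, hL0, hLip⟩ := hL.exists_norm_sub_le (D + ρ)
  set K : ℝ := 1 + |σ| * L with hK
  set C : ℝ := ρ + |σ| * (L * (D + ρ)) with hC
  have hK0 : 0 ≤ K := by positivity
  have hC0 : 0 ≤ C := by positivity
  -- This choice gives `C τ ≤ 1/2`, half the radius of the ball, which leaves room for the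
  -- bootstrap.
  refine ⟨1 / (2 * (C + 1)), ρ, by positivity, fun φ₀ φ₁ α p₀ t₀ h0 hφ₀ hp₀ hpM => ?_⟩
  set τ : ℝ := 1 / (2 * (C + 1)) with hτ
  have hτ0 : 0 < τ := by positivity
  set e : L2C N := ∑ i, rie i (α i) with he
  have heN : ‖e‖ ≤ N * D := norm_sum_rie_le h0.norm_le
  have hα : ∀ i, conjL (α i) = α i := fun i => (h0.left i).2
  have her : conjL e = e := conjL_sum_rie hα
  have hrepu : ∀ U : L2C N, conjL U = U →
      Rep (s + 1) ((φ₀ + reF (bes (s + 1) U)) - φ₀) U := fun U hU => by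
    rw [add_sub_cancel_left]; exact rep_reF hU
  choose! Q hQ using fun (U : L2C N) (hU : conjL U = U) => hL.exists_rep (close_of_rep h0 (hrepu U hU))
  have hQL : ∀ U U' : L2C N, conjL U = U → conjL U' = U' → ‖U‖ ≤ ρ → ‖U'‖ ≤ ρ →
      ‖Q U - Q U'‖ ≤ L * ‖U - U'‖ := fun U U' hU hU' h1 h2 => by
    have c1 := close_of_rep₂ h0.refl_of (hrepu U hU) (hrepu U' hU')
    rw [zero_add] at c1
    exact hLip _ _ _ _ _ _ _ c1 ((close_of_rep h0 (hrepu U hU)).le (by linarith))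
      ((close_of_rep h0 (hrepu U' hU')).le (by linarith)) (hQ U hU) (hQ U' hU')
  have hQB : ∀ U : L2C N, conjL U = U → ‖U‖ ≤ ρ → ‖Q U‖ ≤ L * (D + ρ) := fun U hU h1 => by
    have c1 := (close_of_rep h0 (hrepu U hU)).le (d' := D + ρ) (by linarith)
    have := hLip _ _ _ _ _ _ 0 c1 c1 (close_zero_zero (by positivity)) (hQ U hU)
      ((Rep.zero s).congr (ae_of_all _ fun x => by simp))
    simpa using this
  let U : ℝ → L2C N → L2C N := fun t x => reL (kg (-t) x) + e
  have hUr : ∀ t x, conjL (U t x) = U t x := fun t x => by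
    simp only [U]
    rw [map_add, conjL_reL, her]
  let x₀ : L2C N := kg t₀ (wave α 0 p₀)
  have hx₀ : ‖x₀‖ ≤ N * D + M := by
    simp only [x₀]
    rw [norm_kg, wave, zero_sub]
    refine (norm_add_le _ _).trans ?_
    rw [norm_neg, norm_I_smul]
    exact add_le_add heN hpM
  have hUb : ∀ t, ∀ x ∈ Metric.closedBall x₀ 1, ‖U t x‖ ≤ ρ := fun t x hx => by
    have h1 : ‖x‖ ≤ ‖x₀‖ + 1 := by
      have := norm_le_norm_add_norm_sub' x x₀
      rw [mem_closedBall_iff_norm] at hx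
      linarith
    have h2 : ‖reL (kg (-t) x)‖ ≤ ‖x‖ := (norm_reL_le _).trans (norm_kg _ _).le
    have h3 := norm_add_le (reL (kg (-t) x)) e
    simp only [U]
    linarith
  let f : ℝ → L2C N → L2C N := fun t x => kg t (Complex.I • force σ (U t x) (Q (U t x)))
  have hUsub : ∀ t x y, ‖U t x - U t y‖ ≤ ‖x - y‖ := fun t x y => by
    have : U t x - U t y = reL (kg (-t) (x - y)) := by simp only [U, map_sub]; abel
    rw [this]
    exact (norm_reL_le _).trans (norm_kg _ _).le
  have hfb : ∀ t, ∀ x ∈ Metric.closedBall x₀ 1, ‖f t x‖ ≤ C := fun t x hx => by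
    simp only [f]
    rw [norm_kg, norm_I_smul]
    refine (norm_force_le _ _ _).trans ?_
    have h2 := hQB _ (hUr t x) (hUb t x hx)
    have h3 := hUb t x hx
    rw [hC]
    gcongr
  have hPL : IsPicardLindelof f (tmin := t₀) (tmax := t₀ + τ) ⟨t₀, by constructor <;> linarith⟩ x₀ 1 0
      (⟨C, hC0⟩ : ℝ≥0) (⟨K, hK0⟩ : ℝ≥0) := by
    refine ⟨fun t _ => LipschitzOnWith.of_dist_le_mul fun x hx y hy => ?_, fun x hx => ?_,
      fun t _ x hx => ?_, ?_⟩
    · rw [dist_eq_norm, dist_eq_norm]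
      simp only [f]
      rw [← map_sub, norm_kg, ← smul_sub, norm_I_smul, force_sub]
      refine (norm_force_le _ _ _).trans ?_
      have h1 := hUsub t x y
      have h2 := hQL _ _ (hUr t x) (hUr t y) (hUb t x hx) (hUb t y hy)
      have h3 : L * ‖U t x - U t y‖ ≤ L * ‖x - y‖ := by gcongr
      have h4 : |σ| * ‖Q (U t x) - Q (U t y)‖ ≤ |σ| * (L * ‖x - y‖) := by
        gcongr; exact h2.trans h3
      change _ ≤ K * ‖x - y‖
      rw [hK]
      linarith
    · have cU : Continuous fun t => U t x :=
        (reL.continuous.comp ((continuous_kg x).comp continuous_neg)).add continuous_const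
      have cQ : Continuous fun t => Q (U t x) := by
        rw [continuous_iff_continuousAt]
        intro t
        have h2 : Tendsto (fun r => L * ‖U r x - U t x‖) (𝓝 t) (𝓝 0) := by
          have := ((cU.tendsto t).sub_const (U t x)).norm.const_mul L
          simpa using this
        rw [ContinuousAt, tendsto_iff_norm_sub_tendsto_zero]
        exact squeeze_zero (fun _ => norm_nonneg _)
          (fun r => hQL _ _ (hUr r x) (hUr t x) (hUb r x hx) (hUb t x hx)) h2
      refine continuousOn_kg (Continuous.continuousOn ?_)
      exact (((bes 1).continuous.comp cU).sub (cQ.const_smul (σ / 2))).const_smul Complex.I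
    · exact hfb t x hx
    · change C * max (t₀ + τ - t₀) (t₀ - t₀) ≤ (1 : ℝ) - 0
      rw [add_sub_cancel_left, sub_self, max_eq_left hτ0.le, hτ, mul_one_div, sub_zero,
        div_le_one (by positivity)]
      linarith
  obtain ⟨ζ, hζ0, hζ⟩ := hPL.exists_eq_forall_mem_Icc_hasDerivWithinAt₀
  simp only at hζ0
  -- The existence statement gives the derivative of `ζ` but does not locate it; as long as `ζ` is
  -- in the unit ball, `C τ ≤ 1/2` confines it to the half ball.
  have hball : ∀ t ∈ Icc t₀ (t₀ + τ), ‖ζ t - x₀‖ ≤ 1 / 2 := by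
    refine forall_le_of_bootstrap (g := fun t => ‖ζ t - x₀‖) (b := 1) (by norm_num) ?_ ?_
      fun t ht hr => ?_
    · have hζc : ContinuousOn ζ (Icc t₀ (t₀ + τ)) := fun t ht => (hζ t ht).continuousWithinAt
      exact (hζc.sub continuousOn_const).norm
    · simp [hζ0]
    · have hsub : Icc t₀ t ⊆ Icc t₀ (t₀ + τ) := Icc_subset_Icc_right ht.2
      have h1 := Convex.norm_image_sub_le_of_norm_hasDerivWithin_le (s := Icc t₀ t) (C := C)
        (fun r hr => (hζ r (hsub hr)).mono hsub)
        (fun r hr' => hfb r (ζ r) (by rw [mem_closedBall_iff_norm]; exact hr r hr'))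
        (convex_Icc t₀ t) (left_mem_Icc.mpr ht.1) (right_mem_Icc.mpr ht.1)
      rw [hζ0] at h1
      refine h1.trans ?_
      rw [Real.norm_of_nonneg (by linarith [ht.1])]
      have h2 : t - t₀ ≤ τ := by linarith [ht.2]
      calc C * (t - t₀) ≤ C * τ := by gcongr
        _ ≤ 1 / 2 := by
          rw [hτ, mul_one_div, div_le_div_iff₀ (by positivity) (by norm_num)]
          linarith
  have hmem : ∀ t ∈ Icc t₀ (t₀ + τ), ζ t ∈ Metric.closedBall x₀ 1 := fun t ht => by
    rw [mem_closedBall_iff_norm]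
    linarith [hball t ht]
  let u : ℝ → L2C N := fun t => U t (ζ t)
  let p : ℝ → L2C N := fun t => imL (kg (-t) (ζ t))
  have hev := evol_of_hasDerivWithinAt (σ := σ) (I := Icc t₀ (t₀ + τ)) hL h0 (ζ := ζ) (u := u) (p := p)
    (q := fun t => Q (u t)) (φ := fun t => φ₀ + reF (bes (s + 1) (u t)))
    (ψ := fun t => reF (bes s (p t))) (fun t _ => hQ (u t) (hUr t (ζ t))) (fun _ => rfl)
    (fun _ => rfl) (fun _ => rfl) (fun _ => rfl) hζ
  have hy0 : kg (-t₀) (ζ t₀) = -e + Complex.I • p₀ := by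
    rw [hζ0, kg_neg_kg, wave, zero_sub]
  have hner : conjL (-e) = -e := by rw [map_neg, her]
  have hu0 : u t₀ = 0 := by
    simp only [u, U]
    rw [hy0, reL_add_I_smul hner hp₀.conj, neg_add_cancel]
  have hp0 : p t₀ = p₀ := by
    simp only [p]
    rw [hy0, imL_add_I_smul hner hp₀.conj]
  refine ⟨_, _, hev.solOn hs h0 hφ₀, ?_, ?_, fun t ht => ⟨⟨u t, hev.rep_u t ht, hUb t _ (hmem t ht)⟩,
    ⟨p t, hev.rep_p t ht, ?_⟩⟩⟩
  · have h1 : Rep (s + 1) (reF (bes (s + 1) (u t₀))) 0 := by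
      have := rep_reF (s := s + 1) (hUr t₀ (ζ t₀))
      change Rep (s + 1) (reF (bes (s + 1) (u t₀))) (u t₀) at this
      rwa [hu0] at this ⊢
    filter_upwards [h1.ae_eq (Rep.zero (s + 1))] with x hx
    simp [hx]
  · simp only [hp0]
    exact (rep_reF hp₀.conj).ae_eq hp₀
  · have h1 : ‖p t‖ ≤ ‖ζ t‖ := (norm_imL_le _).trans (norm_kg _ _).le
    have h2 := norm_le_norm_add_norm_sub' (ζ t) x₀
    have h3 := hball t ht
    have h4 : 0 ≤ N * D := by positivity
    rw [hρ]
    linarith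

/-! ### Stability -/

/-- The hypothesis `1 ≤ K` serves to replace `ε / K` by `ε`. -/
theorem norm_le_of_gronwall {f f' : ℝ → L2C N} {δ K ε T : ℝ} (hK : 1 ≤ K) (hε : 0 ≤ ε)
    (hf : ∀ t ∈ Icc 0 T, HasDerivWithinAt f (f' t) (Icc 0 T) t) (h0 : ‖f 0‖ ≤ δ)
    (bound : ∀ t ∈ Icc 0 T, ‖f' t‖ ≤ K * ‖f t‖ + ε) {t : ℝ} (ht : t ∈ Icc 0 T) :
    ‖f t‖ ≤ (δ + ε) * Real.exp (K * T) := by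
  have h1 := norm_le_gronwallBound_of_norm_deriv_right_le (f := f) (f' := f') (δ := δ) (K := K)
    (ε := ε) (a := 0) (b := T) (fun t ht => (hf t ht).continuousWithinAt)
    (fun t ht => (hf t (Ico_subset_Icc_self ht)).mono_of_mem_nhdsWithin
      (Icc_mem_nhdsGE_of_mem ht)) h0
    (fun t ht => bound t (Ico_subset_Icc_self ht)) t ht
  refine h1.trans ?_
  rw [gronwallBound_of_K_ne_0 (by positivity), sub_zero]
  have hδ : 0 ≤ δ := (norm_nonneg _).trans h0
  have hexp : Real.exp (K * t) ≤ Real.exp (K * T) := by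
    apply Real.exp_le_exp.mpr
    have := ht.2
    gcongr
  have hpos := Real.exp_pos (K * t)
  have h2 : ε / K * (Real.exp (K * t) - 1) ≤ ε * Real.exp (K * t) := by
    have h3 : ε / K ≤ ε := div_le_self hε hK
    have h4 : 0 ≤ ε / K := by positivity
    nlinarith
  calc _ ≤ δ * Real.exp (K * t) + ε * Real.exp (K * t) := by linarith
    _ = (δ + ε) * Real.exp (K * t) := by ring
    _ ≤ _ := by gcongr

/-- Gronwall's inequality for the difference `Y` of the two waves. Its imaginary part is `p - p'`,
and its real part is `u - u'` up to the vector `e`, of norm at most `N d`. -/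
theorem LipschitzSin.exists_stability {s : ℕ} (hL : LipschitzSin N s) (σ T B : ℝ) :
    ∃ A : ℝ, 1 ≤ A ∧ ∀ (T' : ℝ) (φ₀ φ₀' : Space N → ℝ) (α α' : Fin N → L2C N)
      (φ ψ φ' ψ' : ℝ → Space N → ℝ) (u p q u' p' q' : ℝ → L2C N) (d m : ℝ), T' ≤ T →
      Evol σ s (Icc 0 T') φ₀ α φ ψ u p q → Evol σ s (Icc 0 T') φ₀' α' φ' ψ' u' p' q' →
      u 0 = 0 → u' 0 = 0 → Close s φ₀ φ₀' α α' d → ‖p 0 - p' 0‖ ≤ m →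
      (∀ t ∈ Icc 0 T', Close s (φ t) 0 (α + fun i => rie i (u t)) 0 B) →
      (∀ t ∈ Icc 0 T', Close s (φ' t) 0 (α' + fun i => rie i (u' t)) 0 B) →
      ∀ t ∈ Icc 0 T', ‖u t - u' t‖ ≤ A * (d + m) ∧ ‖p t - p' t‖ ≤ A * (d + m) := by
  obtain ⟨L, hL0, hLip⟩ := hL.exists_norm_sub_le B
  set K : ℝ := 1 + |σ| * L with hK
  have hK1 : 1 ≤ K := by rw [hK]; linarith [mul_nonneg (abs_nonneg σ) hL0]
  have hK0 : 0 ≤ K := by linarith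
  set E : ℝ := Real.exp (K * T) with hE
  have hE0 : 0 < E := Real.exp_pos _
  -- `Y 0` is bounded by `N d + m` and the inhomogeneous term by `K (N + 1) d`; `E` is the Gronwall
  -- factor, the additional `N` accounts for `e`, and the final `1` ensures `1 ≤ A`.
  refine ⟨(1 + N + K * (N + 1)) * E + N + 1, ?_, fun T' φ₀ φ₀' α α' φ ψ φ' ψ' u p q u' p' q' d m hT h h'
    hu0 hu0' hd hm hB hB' t ht => ?_⟩
  · have : 0 ≤ (1 + N + K * (N + 1)) * E := by positivity
    have : (0 : ℝ) ≤ N := N.cast_nonneg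
    linarith
  have hd0 := hd.nonneg
  have hm0 : 0 ≤ m := (norm_nonneg _).trans hm
  set e : L2C N := (∑ i, rie i (α i)) - ∑ i, rie i (α' i) with he
  have heN : ‖e‖ ≤ N * d := by
    rw [he, ← Finset.sum_sub_distrib]
    simp only [← map_sub]
    exact norm_sum_rie_le (α := fun i => α i - α' i) hd.grad_le
  have hαr : ∀ i, conjL (α i) = α i := fun i => (hd.left i).2
  have hαr' : ∀ i, conjL (α' i) = α' i := fun i => (hd.right i).2
  have her : conjL e = e := by rw [he, map_sub, conjL_sum_rie hαr, conjL_sum_rie hαr']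
  set Y : ℝ → L2C N := fun t => wave α (u t) (p t) - wave α' (u' t) (p' t) with hY
  have hYeq : ∀ t, Y t = (u t - u' t - e) + Complex.I • (p t - p' t) := fun t => by
    simp only [hY, wave, he, smul_sub]; abel
  have hur : ∀ t ∈ Icc 0 T', conjL (u t - u' t - e) = u t - u' t - e := fun t ht => by
    rw [map_sub, map_sub, (h.rep_u t ht).conj, (h'.rep_u t ht).conj, her]
  have hpr : ∀ t ∈ Icc 0 T', conjL (p t - p' t) = p t - p' t := fun t ht => by
    rw [map_sub, (h.rep_p t ht).conj, (h'.rep_p t ht).conj]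
  have hYu : ∀ t ∈ Icc 0 T', ‖u t - u' t‖ ≤ ‖Y t‖ + N * d := fun t ht => by
    have h1 : ‖u t - u' t - e‖ ≤ ‖Y t‖ := by
      have := norm_reL_le (Y t)
      rwa [hYeq, reL_add_I_smul (hur t ht) (hpr t ht), ← hYeq] at this
    have h2 := norm_le_norm_sub_add (u t - u' t) e
    linarith
  have hYp : ∀ t ∈ Icc 0 T', ‖p t - p' t‖ ≤ ‖Y t‖ := fun t ht => by
    have := norm_imL_le (Y t)
    rwa [hYeq, imL_add_I_smul (hur t ht) (hpr t ht), ← hYeq] at this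
  have hconv : Convex ℝ (Icc 0 T') := convex_Icc 0 T'
  have h00 : (0 : ℝ) ∈ Icc 0 T' := ⟨le_rfl, ht.1.trans ht.2⟩
  have hG := norm_le_of_gronwall (N := N) (T := T') (K := K) (δ := N * d + m) (ε := K * (N + 1) * d)
    (f := fun t => kg t (wave α (u t) (p t)) - kg t (wave α' (u' t) (p' t)))
    (f' := fun t => kg t (Complex.I • force σ (u t) (q t)) -
      kg t (Complex.I • force σ (u' t) (q' t))) hK1 (by positivity)
    (fun t ht => (h.hasDerivWithinAt_kg hconv ht).sub (h'.hasDerivWithinAt_kg hconv ht)) ?_ ?_ ht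
  · have hYt : ‖Y t‖ ≤ (N * d + m + K * (N + 1) * d) * E := by
      have h1 : ‖Y t‖ = ‖kg t (wave α (u t) (p t)) - kg t (wave α' (u' t) (p' t))‖ := by
        rw [← map_sub, norm_kg]
      rw [h1]
      refine hG.trans ?_
      have : Real.exp (K * T') ≤ E := Real.exp_le_exp.mpr (by gcongr)
      gcongr
    have h2 : (N * d + m + K * (N + 1) * d) * E ≤ ((1 + N + K * (N + 1)) * E) * (d + m) := by
      have h3 : N * d + m + K * (N + 1) * d ≤ (1 + N + K * (N + 1)) * (d + m) := by
        have : 0 ≤ N * m := by positivity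
        have : 0 ≤ K * (N + 1) * m := by positivity
        nlinarith
      calc _ ≤ (1 + N + K * (N + 1)) * (d + m) * E := by gcongr
        _ = _ := by ring
    have h4 : 0 ≤ N * m := by positivity
    have h5 := hYu t ht
    have h6 := hYp t ht
    have h7 : (0 : ℝ) ≤ N * d := by positivity
    constructor <;> nlinarith
  · rw [← map_sub, norm_kg]
    change ‖Y 0‖ ≤ _
    rw [hYeq, hu0, hu0', sub_zero, zero_sub]
    refine (norm_add_le _ _).trans ?_
    rw [norm_neg, norm_I_smul]
    exact add_le_add heN hm
  · intro t ht
    rw [← map_sub, ← map_sub, norm_kg, norm_kg, ← smul_sub, norm_I_smul, force_sub]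
    refine (norm_force_le _ _ _).trans ?_
    have c1 := close_of_rep₂ hd (h.rep_u t ht) (h'.rep_u t ht)
    have h2 := hLip _ _ _ _ _ _ _ c1 (hB t ht) (hB' t ht) (h.rep_q t ht) (h'.rep_q t ht)
    have h3 := hYu t ht
    change _ ≤ K * ‖Y t‖ + K * (N + 1) * d
    have h4 : |σ| * ‖q t - q' t‖ ≤ |σ| * (L * (d + (‖Y t‖ + N * d))) := by
      gcongr
      exact h2.trans (by gcongr)
    have h5 : 0 ≤ |σ| * L * (N * d) := by positivity
    rw [hK]
    nlinarith

end

end SineGordon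

open scoped NNReal

namespace SineGordon

noncomputable section

variable {N : ℕ}

/-! ### Distances -/

theorem one_le_cLo (N s : ℕ) : 1 ≤ cLo N s :=
  one_le_pow₀ (by linarith [(Nat.cast_nonneg N : (0 : ℝ) ≤ N)])

/-- The constant in the comparison of `dsin` with `Close`. -/
def cD (N s : ℕ) : ℝ := 1 + cUp N s * N

theorem one_le_cD (N s : ℕ) : 1 ≤ cD N s := by
  have : (0 : ℝ) ≤ cUp N s * N := by positivity
  rw [cD]; linarith

section

variable {s : ℕ} {v w : Space N → ℝ} {α β : Fin N → L2C N} {d : ℝ}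

theorem close_of_dsin (hα : GradRep s v α) (hβ : GradRep s w β)
    (hv : AEStronglyMeasurable v volume) (hw : AEStronglyMeasurable w volume) (hd : 0 ≤ d)
    (h : dsin (s + 1) v w ≤ ENNReal.ofReal d) : Close s v w α β (cLo N s * d) := by
  have h1 := one_le_cLo N s
  have h2 : 0 ≤ cLo N s * d := by positivity
  refine ⟨hα, hβ, hv, hw, h2, ?_, fun i => ?_⟩
  · refine (eLpNorm_sin_le_dsin (s + 1) v w).trans (h.trans (ENNReal.ofReal_le_ofReal ?_))
    nlinarith
  · have := (hα.sub hβ).norm_le_dsin i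
    rw [← ENNReal.ofReal_le_ofReal_iff h2, ENNReal.ofReal_mul (by positivity)]
    exact this.trans (by gcongr)

theorem Close.dsin_le (h : Close s v w α β d) : dsin (s + 1) v w ≤ ENNReal.ofReal (cD N s * d) := by
  have hd := h.nonneg
  refine (h.left.sub h.right).dsin_le.trans ?_
  rw [cD, add_mul, one_mul, ENNReal.ofReal_add hd (by positivity)]
  refine add_le_add h.sin_le (ENNReal.ofReal_le_ofReal ?_)
  rw [mul_assoc]
  gcongr
  calc _ ≤ ∑ _i : Fin N, d := Finset.sum_le_sum fun i _ => h.grad_le i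
    _ = _ := by simp

theorem MemHsin.exists_close (h : MemHsin (s + 1) v) : ∃ α D, Close s v 0 α 0 D := by
  obtain ⟨h1, ⟨α, hα⟩, h3⟩ := memHsin_iff.mp h
  refine ⟨α, (eLpNorm (fun x => Real.sin (v x)) 2 volume).toReal + ∑ i, ‖α i‖, hα, gradRep_zero s,
    h1.aestronglyMeasurable, aestronglyMeasurable_const, by positivity, ?_, fun i => ?_⟩
  · simp only [Pi.zero_apply, sub_zero]
    rw [ENNReal.ofReal_add (by positivity) (by positivity), ENNReal.ofReal_toReal h3.2.ne]
    exact le_self_add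
  · have h4 := Finset.single_le_sum (f := fun i => ‖α i‖) (fun _ _ => norm_nonneg _) (Finset.mem_univ i)
    have h5 : 0 ≤ (eLpNorm (fun x => Real.sin (v x)) 2 volume).toReal := ENNReal.toReal_nonneg
    simp only [Pi.zero_apply, sub_zero]
    linarith

/-- The sine distance obeys the triangle inequality because `|sin (a + b)| ≤ |sin a| + |sin b|`. -/
theorem Close.triangle {w' : Space N → ℝ} {γ : Fin N → L2C N} {d' : ℝ} (h : Close s v w α β d)
    (h' : Close s w w' β γ d') : Close s v w' α γ (d + d') where
  left := h.left
  right := h'.right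
  left_meas := h.left_meas
  right_meas := h'.right_meas
  nonneg := add_nonneg h.nonneg h'.nonneg
  sin_le := by
    have m1 : AEStronglyMeasurable (fun x => |Real.sin (v x - w x)|) volume :=
      (Real.continuous_sin.comp_aestronglyMeasurable (h.left_meas.sub h.right_meas)).norm
    have m2 : AEStronglyMeasurable (fun x => |Real.sin (w x - w' x)|) volume :=
      (Real.continuous_sin.comp_aestronglyMeasurable (h'.left_meas.sub h'.right_meas)).norm
    calc _ ≤ eLpNorm ((fun x => |Real.sin (v x - w x)|) + fun x => |Real.sin (w x - w' x)|) 2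
          volume := by
          refine eLpNorm_mono fun x => ?_
          refine le_trans ?_ (le_abs_self _)
          rw [Real.norm_eq_abs, show v x - w' x = (v x - w x) + (w x - w' x) by ring, Real.sin_add]
          refine (abs_add_le _ _).trans (add_le_add ?_ ?_)
          · rw [abs_mul]
            exact mul_le_of_le_one_right (abs_nonneg _) (Real.abs_cos_le_one _)
          · rw [abs_mul]
            exact mul_le_of_le_one_left (abs_nonneg _) (Real.abs_cos_le_one _)
      _ ≤ eLpNorm (fun x => |Real.sin (v x - w x)|) 2 volume +
          eLpNorm (fun x => |Real.sin (w x - w' x)|) 2 volume := eLpNorm_add_le m1 m2 (by norm_num)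
      _ ≤ ENNReal.ofReal d + ENNReal.ofReal d' := by
          gcongr
          · exact (eLpNorm_norm (fun x => Real.sin (v x - w x))).trans_le h.sin_le
          · exact (eLpNorm_norm (fun x => Real.sin (w x - w' x))).trans_le h'.sin_le
      _ = _ := (ENNReal.ofReal_add h.nonneg h'.nonneg).symm
  grad_le := fun i => by
    rw [← sub_add_sub_cancel (α i) (β i) (γ i)]
    exact (norm_add_le _ _).trans (add_le_add (h.grad_le i) (h'.grad_le i))

end

/-! ### Uniqueness -/

section

variable {σ : ℝ} {s : ℕ} {I : Set ℝ} {φ₀ φ₁ : Space N → ℝ} {α : Fin N → L2C N} {D T : ℝ}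
  {φ ψ φ' ψ' : ℝ → Space N → ℝ} {u p q : ℝ → L2C N}

theorem IsSolution.exists_evol (hs : 1 ≤ s) (hL : LipschitzSin N s) (h0 : Close s φ₀ 0 α 0 D)
    (hφ₀ : LocallyIntegrable φ₀ volume) (h : IsSolution σ (s + 1) I φ₀ φ₁ φ ψ) (hT : 0 ≤ T)
    (hI : Icc 0 T ⊆ I) : ∃ u p q, Evol σ s (Icc 0 T) φ₀ α φ ψ u p q ∧ u 0 = 0 ∧ Rep s φ₁ (p 0) := by
  obtain ⟨u, p, q, hev⟩ := (h.solOn.mono hI).exists_evol hs hL h0 hφ₀ (convex_Icc 0 T)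
  refine ⟨u, p, q, hev, ?_, (hev.rep_p 0 ⟨le_rfl, hT⟩).congr h.initial_deriv⟩
  refine (hev.rep_u 0 ⟨le_rfl, hT⟩).unique ((Rep.zero (s + 1)).congr ?_)
  filter_upwards [h.initial] with x hx
  simp [hx]

theorem Evol.exists_bound (h : Evol σ s (Icc 0 T) φ₀ α φ ψ u p q) :
    ∃ B : ℝ, 0 ≤ B ∧ ∀ t ∈ Icc 0 T, ‖u t‖ ≤ B ∧ ‖p t‖ ≤ B := by
  obtain ⟨B, hB⟩ := isCompact_Icc.exists_bound_of_continuousOn h.cont_u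
  obtain ⟨B', hB'⟩ := isCompact_Icc.exists_bound_of_continuousOn h.cont_p
  exact ⟨max (max B B') 0, le_max_right _ _, fun t ht =>
    ⟨(hB t ht).trans ((le_max_left _ _).trans (le_max_left _ _)),
      (hB' t ht).trans ((le_max_right _ _).trans (le_max_left _ _))⟩⟩

/-- Stability with `d = m = 0`, the bounds on the solutions coming from compactness of `[0, T]`. The
two domains may differ, so that solutions with different lifespans can be compared. -/
theorem IsSolution.unique (hs : 1 ≤ s) (hL : LipschitzSin N s) (hφ₀ : MemHsin (s + 1) φ₀)
    {I' : Set ℝ} (h : IsSolution σ (s + 1) I φ₀ φ₁ φ ψ)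
    (h' : IsSolution σ (s + 1) I' φ₀ φ₁ φ' ψ') (hT : 0 ≤ T) (hI : Icc 0 T ⊆ I)
    (hI' : Icc 0 T ⊆ I') : φ T =ᵐ[volume] φ' T ∧ ψ T =ᵐ[volume] ψ' T := by
  obtain ⟨α, D, h0⟩ := hφ₀.exists_close
  obtain ⟨u, p, q, e, hu, hp⟩ := h.exists_evol hs hL h0 hφ₀.1 hT hI
  obtain ⟨u', p', q', e', hu', hp'⟩ := h'.exists_evol hs hL h0 hφ₀.1 hT hI'
  obtain ⟨B, hB0, hB⟩ := e.exists_bound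
  obtain ⟨B', hB0', hB'⟩ := e'.exists_bound
  obtain ⟨A, -, hA⟩ := hL.exists_stability σ T (D + (B + B'))
  have hTT : T ∈ Icc 0 T := ⟨hT, le_rfl⟩
  have := hA T φ₀ φ₀ α α φ ψ φ' ψ' u p q u' p' q' 0 0 le_rfl e e' hu hu' h0.refl_of
    (by rw [hp.unique hp', sub_self, norm_zero])
    (fun t ht => (close_of_rep h0 (e.rep_u t ht)).le (by linarith [(hB t ht).1]))
    (fun t ht => (close_of_rep h0 (e'.rep_u t ht)).le (by linarith [(hB' t ht).1])) T hTT
  simp only [add_zero, mul_zero, norm_le_zero_iff, sub_eq_zero] at this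
  constructor
  · have h1 := e.rep_u T hTT
    rw [this.1] at h1
    filter_upwards [h1.ae_eq (e'.rep_u T hTT)] with x hx
    simpa using hx
  · have h1 := e.rep_p T hTT
    rw [this.2] at h1
    exact h1.ae_eq (e'.rep_p T hTT)

end

/-! ### The maximal solution -/

theorem Icc_subset_timeIco {T : ℝ≥0∞} {t : ℝ} (ht : ENNReal.ofReal t < T) : Icc 0 t ⊆ timeIco T :=
  fun _ hr => ⟨hr.1, (ENNReal.ofReal_le_ofReal hr.2).trans_lt ht⟩

theorem timeIco_mono {T T' : ℝ≥0∞} (h : T ≤ T') : timeIco T ⊆ timeIco T' :=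
  fun _ ht => ⟨ht.1, ht.2.trans_le h⟩

theorem timeIco_ofReal_subset (T : ℝ) : timeIco (ENNReal.ofReal T) ⊆ Icc 0 T := fun _ ht =>
  ⟨ht.1, ((ENNReal.ofReal_lt_ofReal_iff_of_nonneg ht.1).mp ht.2).le⟩

theorem timeIco_mem_nhdsWithin {T T' : ℝ≥0∞} {t : ℝ} (ht : t ∈ timeIco T) :
    timeIco T ∈ 𝓝[timeIco T'] t := by
  have h1 : {r : ℝ | ENNReal.ofReal r < T} ∈ 𝓝 t :=
    (isOpen_lt ENNReal.continuous_ofReal continuous_const).mem_nhds ht.2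
  filter_upwards [mem_nhdsWithin_of_mem_nhds h1, self_mem_nhdsWithin] with r hr hr'
  exact ⟨hr'.1, hr⟩

section

variable {σ : ℝ} {s : ℕ} {φ₀ φ₁ : Space N → ℝ}

theorem IsSolution.mono {k : ℕ} {I J : Set ℝ} {φ ψ : ℝ → Space N → ℝ}
    (h : IsSolution σ k I φ₀ φ₁ φ ψ) (hJ : J ⊆ I) : IsSolution σ k J φ₀ φ₁ φ ψ :=
  isSolution_iff.mpr ⟨h.solOn.mono hJ, h.initial, h.initial_deriv⟩

theorem IsSolution.le_maxTime {k : ℕ} {T : ℝ≥0∞} {φ ψ : ℝ → Space N → ℝ}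
    (h : IsSolution σ k (timeIco T) φ₀ φ₁ φ ψ) : T ≤ maxTime σ k φ₀ φ₁ :=
  le_sSup ⟨φ, ψ, h⟩

/-- For each `t` a solution living beyond `t` is chosen and evaluated at `t`. By uniqueness this
diagonal choice agrees near `t` with one solution, and being a solution is local. -/
theorem exists_maximal (hs : 1 ≤ s) (hL : LipschitzSin N s) (hφ₀ : MemHsin (s + 1) φ₀)
    (hpos : 0 < maxTime σ (s + 1) φ₀ φ₁) : ∃ φ ψ : ℝ → Space N → ℝ,
      IsSolution σ (s + 1) (timeIco (maxTime σ (s + 1) φ₀ φ₁)) φ₀ φ₁ φ ψ := by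
  have h1 : ∀ t, t ∈ timeIco (maxTime σ (s + 1) φ₀ φ₁) → ∃ (T : ℝ≥0∞) (φ ψ : ℝ → Space N → ℝ),
      t ∈ timeIco T ∧ IsSolution σ (s + 1) (timeIco T) φ₀ φ₁ φ ψ := by
    intro t ht
    obtain ⟨T, ⟨φ, ψ, h⟩, hT⟩ := lt_sSup_iff.mp ht.2
    exact ⟨T, φ, ψ, ⟨ht.1, hT⟩, h⟩
  choose! T Φ Ψ hT h using h1
  have h00 : (0 : ℝ) ∈ timeIco (maxTime σ (s + 1) φ₀ φ₁) := ⟨le_rfl, by simpa using hpos⟩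
  have key : ∀ t ∈ timeIco (maxTime σ (s + 1) φ₀ φ₁), ∀ r ∈ timeIco (T t),
      Φ t r =ᵐ[volume] Φ r r ∧ Ψ t r =ᵐ[volume] Ψ r r := fun t ht r hr => by
    have hr' : r ∈ timeIco (maxTime σ (s + 1) φ₀ φ₁) :=
      timeIco_mono ((h t ht).le_maxTime) hr
    exact (h t ht).unique hs hL hφ₀ (h r hr') hr.1 (Icc_subset_timeIco hr.2)
      (Icc_subset_timeIco (hT r hr').2)
  refine ⟨fun t => Φ t t, fun t => Ψ t t, isSolution_iff.mpr ⟨solOn_of_local fun t ht => ?_, ?_, ?_⟩⟩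
  · exact ⟨timeIco (T t), hT t ht, timeIco_mem_nhdsWithin (hT t ht),
      (h t ht).solOn.congr (fun r hr => (key t ht r hr).1) fun r hr => (key t ht r hr).2⟩
  · exact (h 0 h00).initial
  · exact (h 0 h00).initial_deriv

/-- A solution which is bounded at a time `t₁` extends to the time `t₁ + τ`. -/
theorem exists_continuation (σ : ℝ) (hs : 1 ≤ s) (hL : LipschitzSin N s) (D M : ℝ) :
    ∃ τ : ℝ, 0 < τ ∧ ∀ (φ₀ φ₁ : Space N → ℝ) (φ ψ : ℝ → Space N → ℝ) (I : Set ℝ) (t₁ : ℝ)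
      (α : Fin N → L2C N), 0 ≤ t₁ → Icc 0 t₁ ⊆ I → LocallyIntegrable (φ t₁) volume →
      IsSolution σ (s + 1) I φ₀ φ₁ φ ψ → Close s (φ t₁) 0 α 0 D → HBound s (ψ t₁) M →
      ENNReal.ofReal (t₁ + τ) ≤ maxTime σ (s + 1) φ₀ φ₁ := by
  obtain ⟨τ, B, hτ, hloc⟩ := exists_local_solOn σ hs hL D M
  refine ⟨τ, hτ, fun φ₀ φ₁ φ ψ I t₁ α ht₁ hI hInt h hc ⟨p₀, hp₀, hpM⟩ => ?_⟩
  obtain ⟨φ', ψ', h', hφ', hψ', -⟩ := hloc (φ t₁) (ψ t₁) α p₀ t₁ hc hInt hp₀ hpM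
  -- The local solution lives in `φ t₁ + H^k`, which is `φ₀ + H^k`.
  have h'' := h'.change_ref (h.contInH.1 t₁ (hI ⟨ht₁, le_rfl⟩))
  have hg := SolOn.glue (b := t₁) isClosed_Icc isClosed_Icc (fun t ht => ht.2) (fun t ht => ht.1)
    (h.solOn.mono hI) h'' hφ'.symm hψ'.symm
  refine IsSolution.le_maxTime (isSolution_iff.mpr ⟨hg.mono ?_, ?_, ?_⟩)
  · intro t ht
    have h1 := timeIco_ofReal_subset _ ht
    rcases le_total t t₁ with h2 | h2
    · exact Or.inl ⟨h1.1, h2⟩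
    · exact Or.inr ⟨h2, h1.2⟩
  · simp only [if_pos ht₁]; exact h.initial
  · simp only [if_pos ht₁]; exact h.initial_deriv

/-- Local existence, with a time of existence and a bound depending on the norms of the data. -/
theorem exists_local_bound (σ : ℝ) (hs : 1 ≤ s) (hL : LipschitzSin N s) (D M : ℝ) :
    ∃ τ B : ℝ, 0 < τ ∧ ∀ (φ₀ φ₁ : Space N → ℝ) (α : Fin N → L2C N),
      LocallyIntegrable φ₀ volume → Close s φ₀ 0 α 0 D → HBound s φ₁ M →
      ∃ φ ψ, IsSolution σ (s + 1) (Icc 0 τ) φ₀ φ₁ φ ψ ∧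
        ∀ t ∈ Icc 0 τ, HBound (s + 1) (φ t - φ₀) B ∧ HBound s (ψ t) B := by
  obtain ⟨τ, B, hτ, hloc⟩ := exists_local_solOn σ hs hL D M
  refine ⟨τ, B, hτ, fun φ₀ φ₁ α hInt hc ⟨p₀, hp₀, hpM⟩ => ?_⟩
  obtain ⟨φ, ψ, h, h1, h2, h3⟩ := hloc φ₀ φ₁ α p₀ 0 hc hInt hp₀ hpM
  rw [zero_add] at h h3
  exact ⟨φ, ψ, isSolution_iff.mpr ⟨h, h1, h2⟩, h3⟩

theorem MemH.exists_hBound {v : Space N → ℝ} (h : MemH s v) : ∃ M, HBound s v M := by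
  obtain ⟨y, hy⟩ := memH_iff.mp h
  exact ⟨‖y‖, y, hy, le_rfl⟩

theorem maxTime_pos (hs : 1 ≤ s) (hL : LipschitzSin N s) (hφ₀ : MemHsin (s + 1) φ₀)
    (hφ₁ : MemH s φ₁) : 0 < maxTime σ (s + 1) φ₀ φ₁ := by
  obtain ⟨α, D, h0⟩ := hφ₀.exists_close
  obtain ⟨M, hM⟩ := hφ₁.exists_hBound
  obtain ⟨τ, B, hτ, h⟩ := exists_local_bound σ hs hL D M
  obtain ⟨φ, ψ, h1, -⟩ := h φ₀ φ₁ α hφ₀.1 h0 hM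
  exact (ENNReal.ofReal_pos.mpr hτ).trans_le (h1.mono (timeIco_ofReal_subset τ)).le_maxTime

end

end

end SineGordon

open scoped NNReal

namespace SineGordon

noncomputable section

variable {N : ℕ}

/-! ### Bounded solutions -/

theorem GradRep.unique {s : ℕ} {v : Space N → ℝ} {α β : Fin N → L2C N} (h : GradRep s v α)
    (h' : GradRep s v β) : α = β := by
  funext i
  exact (h.rep i).unique ((h'.rep i).congr ((h' i).1.unique (h i).1))

/-- `(v, w)` is bounded by `B` in `H_sin^{s+1} × H^s`. -/
def BddBy (s : ℕ) (v w : Space N → ℝ) (B : ℝ) : Prop := (∃ α, Close s v 0 α 0 B) ∧ HBound s w B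

section

variable {s : ℕ} {v w v' w' φ₀ : Space N → ℝ} {B : ℝ}

theorem BddBy.close {α : Fin N → L2C N} (h : BddBy s v w B) (hα : GradRep s v α) :
    Close s v 0 α 0 B := by
  obtain ⟨⟨β, hβ⟩, -⟩ := h
  rwa [hα.unique hβ.left]

theorem BddBy.congr (h : BddBy s v w B) (hv : v =ᵐ[volume] v') (hw : w =ᵐ[volume] w') :
    BddBy s v' w' B := by
  obtain ⟨⟨β, hβ⟩, h2⟩ := h
  exact ⟨⟨β, hβ.congr hv (ae_eq_refl _)⟩, h2.congr hw⟩

theorem HBound.hNorm_le {c : ℝ} (h : HBound s v c) : hNorm s v ≤ ENNReal.ofReal (cUp N s * c) := by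
  obtain ⟨y, hy, hyc⟩ := h
  refine hy.hNorm_le.trans (ENNReal.ofReal_le_ofReal ?_)
  gcongr

theorem hBound_of_hNorm_le {c : ℝ} (hv : MemH s v) (hc : 0 ≤ c) (h : hNorm s v ≤ ENNReal.ofReal c) :
    HBound s v (cLo N s * c) := by
  obtain ⟨y, hy⟩ := memH_iff.mp hv
  refine ⟨y, hy, ?_⟩
  have h1 := cLo_pos N s
  rw [← ENNReal.ofReal_le_ofReal_iff (by positivity), ENNReal.ofReal_mul h1.le]
  exact hy.norm_le.trans (by gcongr)

theorem BddBy.dsin_add_hNorm_le (h : BddBy s v w B) :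
    dsin (s + 1) v 0 + hNorm s w ≤ ENNReal.ofReal ((cD N s + cUp N s) * B) := by
  obtain ⟨⟨β, hβ⟩, h2⟩ := h
  have hB := hβ.nonneg
  have := one_le_cD N s
  rw [add_mul, ENNReal.ofReal_add (by positivity) (by positivity)]
  exact add_le_add hβ.dsin_le h2.hNorm_le

theorem bddBy_of_dsin_add_hNorm_le {α : Fin N → L2C N} (hα : GradRep s v α)
    (hv : AEStronglyMeasurable v volume) (hw : MemH s w) (hB : 0 ≤ B)
    (h : dsin (s + 1) v 0 + hNorm s w ≤ ENNReal.ofReal B) : BddBy s v w (cLo N s * B) :=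
  ⟨⟨α, close_of_dsin hα (gradRep_zero s) hv aestronglyMeasurable_const hB (le_self_add.trans h)⟩,
    hBound_of_hNorm_le hw hB (le_add_self.trans h)⟩

end

section

variable {σ : ℝ} {s : ℕ} {I : Set ℝ} {φ₀ φ₁ : Space N → ℝ} {α : Fin N → L2C N} {D M T : ℝ}
  {φ ψ : ℝ → Space N → ℝ} {u p q : ℝ → L2C N}

theorem IsSolution.memH_deriv (h : IsSolution σ (s + 1) I φ₀ φ₁ φ ψ) {t : ℝ} (ht : t ∈ I) :
    MemH s (ψ t) := by
  have := h.contInH_deriv.1 t ht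
  rwa [sub_zero] at this

theorem IsSolution.memHsin (hφ₀ : MemHsin (s + 1) φ₀) (h : IsSolution σ (s + 1) I φ₀ φ₁ φ ψ) {t : ℝ}
    (ht : t ∈ I) : MemHsin (s + 1) (φ t) := by
  obtain ⟨α, D, h0⟩ := hφ₀.exists_close
  obtain ⟨u, hu⟩ := memH_iff.mp (h.contInH.1 t ht)
  have h1 := close_of_rep h0 hu
  refine memHsin_iff.mpr ⟨locallyIntegrable_of_rep hφ₀.1 hu, ⟨_, h1.left⟩, ?_⟩
  refine ⟨Real.continuous_sin.comp_aestronglyMeasurable h1.left_meas, ?_⟩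
  have h2 := h1.sin_le
  simp only [Pi.zero_apply, sub_zero] at h2
  exact h2.trans_lt ENNReal.ofReal_lt_top

theorem Evol.mono {J : Set ℝ} (h : Evol σ s I φ₀ α φ ψ u p q) (hJ : J ⊆ I) :
    Evol σ s J φ₀ α φ ψ u p q :=
  ⟨fun t ht => h.rep_u t (hJ ht), fun t ht => h.rep_p t (hJ ht), fun t ht => h.rep_q t (hJ ht),
    h.cont_u.mono hJ, h.cont_p.mono hJ, h.cont_q.mono hJ, fun t ht => (h.deriv_u t (hJ ht)).mono hJ,
    fun t ht => (h.deriv_p t (hJ ht)).mono hJ⟩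

theorem Evol.bddBy (h : Evol σ s I φ₀ α φ ψ u p q) (h0 : Close s φ₀ 0 α 0 D) {B t : ℝ} (ht : t ∈ I)
    (hu : ‖u t‖ ≤ B) (hp : ‖p t‖ ≤ B) : BddBy s (φ t) (ψ t) (D + B) :=
  ⟨⟨_, (close_of_rep h0 (h.rep_u t ht)).le (by linarith)⟩,
    ⟨p t, h.rep_p t ht, by linarith [h0.nonneg]⟩⟩

theorem IsSolution.exists_bddBy (hs : 1 ≤ s) (hL : LipschitzSin N s) (hφ₀ : MemHsin (s + 1) φ₀)
    (h : IsSolution σ (s + 1) I φ₀ φ₁ φ ψ) (hT : 0 ≤ T) (hI : Icc 0 T ⊆ I) :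
    ∃ B, ∀ t ∈ Icc 0 T, BddBy s (φ t) (ψ t) B := by
  obtain ⟨α, D, h0⟩ := hφ₀.exists_close
  obtain ⟨u, p, q, e, -, -⟩ := h.exists_evol hs hL h0 hφ₀.1 hT hI
  obtain ⟨B, hB0, hB⟩ := e.exists_bound
  exact ⟨D + B, fun t ht => e.bddBy h0 ht (hB t ht).1 (hB t ht).2⟩

/-- The hypothesis on `q` allows linear growth of the nonlinearity, so Gronwall's inequality works
on intervals of any length. The case `K = 1` serves when `q` is already bounded, and `K = 1 + 2|σ|`
at the lowest regularity. -/
theorem Evol.norm_le (h : Evol σ s (Icc 0 T) φ₀ α φ ψ u p q) (h0 : Close s φ₀ 0 α 0 D) (hu0 : u 0 = 0)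
    (hp0 : ‖p 0‖ ≤ M) {K ε : ℝ} (hK : 1 ≤ K) (hε : 0 ≤ ε)
    (hq : ∀ t ∈ Icc 0 T, |σ| * ‖q t‖ ≤ (K - 1) * ‖u t‖ + ε) {t T' : ℝ} (ht : t ∈ Icc 0 T)
    (hT' : T ≤ T') :
    ‖u t‖ ≤ (N * D + M + (ε + K * (N * D))) * Real.exp (K * T') + N * D ∧
      ‖p t‖ ≤ (N * D + M + (ε + K * (N * D))) * Real.exp (K * T') + N * D := by
  have hD := h0.nonneg
  have hM : 0 ≤ M := (norm_nonneg _).trans hp0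
  set e : L2C N := ∑ i, rie i (α i) with he
  have heN : ‖e‖ ≤ N * D := norm_sum_rie_le h0.norm_le
  have her : conjL e = e := conjL_sum_rie fun i => (h0.left i).2
  have hur : ∀ t ∈ Icc 0 T, conjL (u t - e) = u t - e := fun t ht => by
    rw [map_sub, (h.rep_u t ht).conj, her]
  have hYu : ∀ t ∈ Icc 0 T, ‖u t‖ ≤ ‖wave α (u t) (p t)‖ + N * D := fun t ht => by
    have h1 : ‖u t - e‖ ≤ ‖wave α (u t) (p t)‖ := by
      have := norm_reL_le (wave α (u t) (p t))
      rwa [wave, reL_add_I_smul (hur t ht) (h.rep_p t ht).conj] at this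
    have h2 := norm_le_norm_sub_add (u t) e
    linarith
  have hYp : ∀ t ∈ Icc 0 T, ‖p t‖ ≤ ‖wave α (u t) (p t)‖ := fun t ht => by
    have := norm_imL_le (wave α (u t) (p t))
    rwa [wave, imL_add_I_smul (hur t ht) (h.rep_p t ht).conj] at this
  have hG := norm_le_of_gronwall (N := N) (T := T) (K := K) (δ := N * D + M)
    (ε := ε + K * (N * D)) (f := fun t => kg t (wave α (u t) (p t)))
    (f' := fun t => kg t (Complex.I • force σ (u t) (q t))) hK (by positivity)
    (fun t ht => h.hasDerivWithinAt_kg (convex_Icc 0 T) ht) ?_ ?_ ht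
  · rw [norm_kg] at hG
    have h1 : (N * D + M + (ε + K * (N * D))) * Real.exp (K * T) ≤
        (N * D + M + (ε + K * (N * D))) * Real.exp (K * T') := by
      have : Real.exp (K * T) ≤ Real.exp (K * T') := Real.exp_le_exp.mpr (by gcongr)
      gcongr
    have h2 : 0 ≤ N * D := by positivity
    exact ⟨by linarith [hYu t ht], by linarith [hYp t ht]⟩
  · rw [norm_kg, wave, hu0, zero_sub]
    refine (norm_add_le _ _).trans ?_
    rw [norm_neg, norm_I_smul]
    exact add_le_add heN hp0
  · intro t ht
    rw [norm_kg, norm_kg, norm_I_smul]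
    refine (norm_force_le _ _ _).trans ?_
    have h1 := hq t ht
    have h2 := hYu t ht
    nlinarith

/-- A solution bounded in `H_sin^{s+1}` has a bounded time derivative. -/
theorem LipschitzSin.exists_deriv_bound (hL : LipschitzSin N s) (σ T D M B : ℝ) :
    ∃ B' : ℝ, ∀ (T' : ℝ) (φ₀ : Space N → ℝ) (α : Fin N → L2C N) (φ ψ : ℝ → Space N → ℝ)
      (u p q : ℝ → L2C N), T' ≤ T → Evol σ s (Icc 0 T') φ₀ α φ ψ u p q → Close s φ₀ 0 α 0 D →
      u 0 = 0 → ‖p 0‖ ≤ M → (∀ t ∈ Icc 0 T', Close s (φ t) 0 (α + fun i => rie i (u t)) 0 B) →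
      ∀ t ∈ Icc 0 T', ‖u t‖ ≤ B' ∧ ‖p t‖ ≤ B' := by
  obtain ⟨L, hL0, hLip⟩ := hL.exists_norm_sub_le B
  refine ⟨_, fun T' φ₀ α φ ψ u p q hT h h0 hu0 hp0 hB t ht =>
    h.norm_le h0 hu0 hp0 (K := 1) (ε := |σ| * (L * B)) le_rfl ?_ (fun t ht => ?_) ht hT⟩
  · have := (hB t ht).nonneg
    positivity
  · rw [sub_self, zero_mul, zero_add]
    gcongr
    have := hLip _ _ _ _ _ _ 0 (hB t ht) (hB t ht) (close_zero_zero (hB t ht).nonneg) (h.rep_q t ht)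
      ((Rep.zero s).congr (ae_of_all _ fun x => by simp))
    simpa using this

/-! ### Blow-up -/

/-- A bound `B` at any time in `(T - τ, T)`, with the `τ` attached to `B`, would continue the
solution past `T`. All these times are excluded, which is why the norm tends to infinity and is not
merely unbounded. -/
theorem eventually_not_bddBy (hs : 1 ≤ s) (hL : LipschitzSin N s) (hφ₀ : MemHsin (s + 1) φ₀)
    {T : ℝ} (hT : 0 < T) (hmax : maxTime σ (s + 1) φ₀ φ₁ = ENNReal.ofReal T)
    (h : IsSolution σ (s + 1) (timeIco (ENNReal.ofReal T)) φ₀ φ₁ φ ψ) (B : ℝ) :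
    ∀ᶠ t in 𝓝[<] T, ¬ BddBy s (φ t) (ψ t) B := by
  obtain ⟨τ, hτ, hc⟩ := exists_continuation σ hs hL B B
  have h1 : max 0 (T - τ) < T := max_lt hT (by linarith)
  filter_upwards [Ioo_mem_nhdsLT h1] with t ht hb
  have ht0 : 0 < t := (le_max_left _ _).trans_lt ht.1
  have hmem : t ∈ timeIco (ENNReal.ofReal T) := ⟨ht0.le, (ENNReal.ofReal_lt_ofReal_iff hT).mpr ht.2⟩
  obtain ⟨⟨β, hβ⟩, hψ⟩ := hb
  have h2 := hc φ₀ φ₁ φ ψ _ t β ht0.le (Icc_subset_timeIco hmem.2) (h.memHsin hφ₀ hmem).1 h hβ hψ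
  rw [hmax, ENNReal.ofReal_le_ofReal_iff hT.le] at h2
  linarith [(le_max_right 0 (T - τ)).trans_lt ht.1]

/-- The maximal solution lives beyond `T`, agrees with this one, and is bounded on the compact
interval `[0, T]`. -/
theorem exists_bddBy_of_lt_maxTime (hs : 1 ≤ s) (hL : LipschitzSin N s) (hφ₀ : MemHsin (s + 1) φ₀)
    {T : ℝ} (hT : 0 ≤ T) (hmax : ENNReal.ofReal T < maxTime σ (s + 1) φ₀ φ₁)
    (h : IsSolution σ (s + 1) (timeIco (ENNReal.ofReal T)) φ₀ φ₁ φ ψ) :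
    ∃ B, ∀ t ∈ timeIco (ENNReal.ofReal T), BddBy s (φ t) (ψ t) B := by
  obtain ⟨φ', ψ', h'⟩ := exists_maximal hs hL hφ₀ (zero_le.trans_lt hmax)
  obtain ⟨B, hB⟩ := h'.exists_bddBy hs hL hφ₀ hT (Icc_subset_timeIco hmax)
  refine ⟨B, fun t ht => ?_⟩
  obtain ⟨h1, h2⟩ := h'.unique hs hL hφ₀ h ht.1 (Icc_subset_timeIco (ht.2.trans hmax))
    (Icc_subset_timeIco ht.2)
  exact (hB t (timeIco_ofReal_subset T ht)).congr h1 h2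

theorem eventually_mem_timeIco {T : ℝ} (hT : 0 < T) :
    ∀ᶠ t in 𝓝[<] T, t ∈ timeIco (ENNReal.ofReal T) := by
  filter_upwards [Ioo_mem_nhdsLT hT] with t ht
  exact ⟨ht.1.le, (ENNReal.ofReal_lt_ofReal_iff hT).mpr ht.2⟩

theorem IsSolution.bddBy_of_le (hφ₀ : MemHsin (s + 1) φ₀) (h : IsSolution σ (s + 1) I φ₀ φ₁ φ ψ)
    {t B : ℝ} (ht : t ∈ I) (hB : 0 ≤ B)
    (hle : dsin (s + 1) (φ t) 0 + hNorm s (ψ t) ≤ ENNReal.ofReal B) :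
    BddBy s (φ t) (ψ t) (cLo N s * B) := by
  have h1 := h.memHsin hφ₀ ht
  obtain ⟨-, ⟨β, hβ⟩, -⟩ := memHsin_iff.mp h1
  exact bddBy_of_dsin_add_hNorm_le hβ h1.1.aestronglyMeasurable (h.memH_deriv ht) hB hle

theorem tendsto_of_eq_maxTime (hs : 1 ≤ s) (hL : LipschitzSin N s) (hφ₀ : MemHsin (s + 1) φ₀)
    {T : ℝ} (hT : 0 < T) (hmax : maxTime σ (s + 1) φ₀ φ₁ = ENNReal.ofReal T)
    (h : IsSolution σ (s + 1) (timeIco (ENNReal.ofReal T)) φ₀ φ₁ φ ψ) :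
    Tendsto (fun t => dsin (s + 1) (φ t) 0 + hNorm s (ψ t)) (𝓝[<] T) (𝓝 ⊤) := by
  rw [ENNReal.tendsto_nhds_top_iff_nnreal]
  intro x
  filter_upwards [eventually_not_bddBy hs hL hφ₀ hT hmax h (cLo N s * x), eventually_mem_timeIco hT]
    with t h1 ht
  by_contra! hcon
  refine h1 (h.bddBy_of_le hφ₀ ht x.2 ?_)
  rw [ENNReal.ofReal_coe_nnreal]
  exact hcon

/-- The velocity cannot blow up alone: a finite upper limit would bound `φ` in `H_sin` up to `T`,
hence `∂_t φ` by `exists_deriv_bound`, against `eventually_not_bddBy`. -/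
theorem limsup_of_eq_maxTime (hs : 1 ≤ s) (hL : LipschitzSin N s) (hφ₀ : MemHsin (s + 1) φ₀)
    {T : ℝ} (hT : 0 < T) (hmax : maxTime σ (s + 1) φ₀ φ₁ = ENNReal.ofReal T)
    (h : IsSolution σ (s + 1) (timeIco (ENNReal.ofReal T)) φ₀ φ₁ φ ψ) :
    limsup (fun t => dsin (s + 1) (φ t) 0) (𝓝[<] T) = ⊤ := by
  by_contra hne
  obtain ⟨x, hx, -⟩ := ENNReal.lt_iff_exists_nnreal_btwn.mp (lt_top_iff_ne_top.mpr hne)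
  have h1 := eventually_lt_of_limsup_lt hx
  obtain ⟨T₁, hT₁, h2⟩ := (mem_nhdsLT_iff_exists_Ioo_subset).mp h1
  obtain ⟨α, D, h0⟩ := hφ₀.exists_close
  have hT₂ : max 0 T₁ < T := max_lt hT hT₁
  -- On `[0, T₂]` the bound comes from compactness, and after `T₂` from the upper limit.
  set T₂ := (max 0 T₁ + T) / 2 with hT₂d
  have hT₂0 : 0 ≤ T₂ := by
    have := le_max_left 0 T₁
    rw [hT₂d]; linarith
  have hT₂T : T₂ < T := by rw [hT₂d]; linarith
  have hlt : ENNReal.ofReal T₂ < ENNReal.ofReal T := (ENNReal.ofReal_lt_ofReal_iff hT).mpr hT₂T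
  obtain ⟨B, hB⟩ := h.exists_bddBy hs hL hφ₀ hT₂0 (Icc_subset_timeIco hlt)
  have hclose : ∀ t ∈ timeIco (ENNReal.ofReal T), ∀ β, GradRep s (φ t) β →
      Close s (φ t) 0 β 0 (max B (cLo N s * x)) := fun t ht β hβ => by
    rcases le_or_gt t T₂ with h3 | h3
    · exact ((hB t ⟨ht.1, h3⟩).close hβ).le (le_max_left _ _)
    · refine (close_of_dsin hβ (gradRep_zero s) (h.memHsin hφ₀ ht).1.aestronglyMeasurable
        aestronglyMeasurable_const x.coe_nonneg ?_).le (le_max_right _ _)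
      rw [ENNReal.ofReal_coe_nnreal]
      have htT : t < T := (ENNReal.ofReal_lt_ofReal_iff hT).mp ht.2
      refine (h2 ⟨?_, htT⟩ : dsin (s + 1) (φ t) 0 < x).le
      have := le_max_right 0 T₁
      rw [hT₂d] at h3
      linarith
  obtain ⟨M, hM⟩ := (h.memH_deriv (t := 0) ⟨le_rfl, by simpa using hT⟩).exists_hBound
  obtain ⟨B', hB'⟩ := hL.exists_deriv_bound σ T D M (max B (cLo N s * x))
  have hnot := eventually_not_bddBy hs hL hφ₀ hT hmax h (D + B')
  obtain ⟨t, h4, ht⟩ := (hnot.and (eventually_mem_timeIco hT)).exists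
  obtain ⟨u, p, q, e, hu, hp⟩ := h.exists_evol hs hL h0 hφ₀.1 ht.1 (Icc_subset_timeIco ht.2)
  have hpM : ‖p 0‖ ≤ M := by
    obtain ⟨y, hy, hyM⟩ := hM
    rwa [(hp.congr h.initial_deriv.symm).unique hy]
  have htT : t ≤ T := (timeIco_ofReal_subset T ht).2
  have h5 := hB' t φ₀ α φ ψ u p q htT e h0 hu hpM
    (fun r hr => hclose r (Icc_subset_timeIco ht.2 hr) _ (close_of_rep h0 (e.rep_u r hr)).left)
    t ⟨ht.1, le_rfl⟩
  exact h4 (e.bddBy h0 ⟨ht.1, le_rfl⟩ h5.1 h5.2)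

theorem blowup_iff (hs : 1 ≤ s) (hL : LipschitzSin N s) (hφ₀ : MemHsin (s + 1) φ₀)
    {T : ℝ≥0∞} (hT : 0 < T) (h : IsSolution σ (s + 1) (timeIco T) φ₀ φ₁ φ ψ) :
    (T = maxTime σ (s + 1) φ₀ φ₁ ↔ (T ≠ ⊤ →
      Tendsto (fun t => dsin (s + 1) (φ t) 0 + hNorm s (ψ t)) (𝓝[<] T.toReal) (𝓝 ⊤))) ∧
    (T = maxTime σ (s + 1) φ₀ φ₁ ↔ (T ≠ ⊤ →
      limsup (fun t => dsin (s + 1) (φ t) 0) (𝓝[<] T.toReal) = ⊤)) := by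
  have hle := h.le_maxTime
  by_cases hTt : T = ⊤
  · subst hTt
    simp only [ne_eq, not_true, IsEmpty.forall_iff, iff_true]
    exact ⟨le_antisymm hle le_top, le_antisymm hle le_top⟩
  have hT0 : 0 < T.toReal := ENNReal.toReal_pos hT.ne' hTt
  have hTr : ENNReal.ofReal T.toReal = T := ENNReal.ofReal_toReal hTt
  have h' : IsSolution σ (s + 1) (timeIco (ENNReal.ofReal T.toReal)) φ₀ φ₁ φ ψ := by rwa [hTr]
  have hbd : T ≠ maxTime σ (s + 1) φ₀ φ₁ → ∃ x : ℝ≥0, ∀ᶠ t in 𝓝[<] T.toReal,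
      dsin (s + 1) (φ t) 0 + hNorm s (ψ t) ≤ x := fun hne => by
    obtain ⟨B, hB⟩ := exists_bddBy_of_lt_maxTime hs hL hφ₀ hT0.le
      (by rw [hTr]; exact lt_of_le_of_ne hle hne) h'
    refine ⟨((cD N s + cUp N s) * B).toNNReal, ?_⟩
    filter_upwards [eventually_mem_timeIco hT0] with t ht
    exact (hB t ht).dsin_add_hNorm_le
  constructor
  · refine ⟨fun heq _ => tendsto_of_eq_maxTime hs hL hφ₀ hT0 (by rw [hTr, heq]) h', fun ht => ?_⟩
    by_contra hne
    obtain ⟨x, hx⟩ := hbd hne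
    have h1 := ENNReal.tendsto_nhds_top_iff_nnreal.mp (ht hTt) x
    obtain ⟨t, h2, h3⟩ := (h1.and hx).exists
    exact absurd h3 (not_le.mpr h2)
  · refine ⟨fun heq _ => limsup_of_eq_maxTime hs hL hφ₀ hT0 (by rw [hTr, heq]) h', fun ht => ?_⟩
    by_contra hne
    obtain ⟨x, hx⟩ := hbd hne
    have h1 : limsup (fun t => dsin (s + 1) (φ t) 0) (𝓝[<] T.toReal) ≤ x :=
      limsup_le_of_le (by isBoundedDefault) (hx.mono fun t ht => le_self_add.trans ht)
    rw [ht hTt, top_le_iff] at h1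
    exact ENNReal.coe_ne_top h1

end

end

end SineGordon

open scoped NNReal
namespace SineGordon
noncomputable section
variable {N : ℕ}

/-! ### Lipschitz continuity of the flow -/

section

variable {σ : ℝ} {s : ℕ} {φ₀ φ₁ : Space N → ℝ}

/-- Solutions with initial conditions close to those of a bounded solution remain close to it. -/
theorem exists_stability_of_bddBy (σ : ℝ) (hs : 1 ≤ s) (hL : LipschitzSin N s) (T B : ℝ) :
    ∃ A : ℝ, 1 ≤ A ∧ ∀ (φ₀ φ₁ φ₀' φ₁' : Space N → ℝ) (α α' : Fin N → L2C N)
      (φ ψ φ' ψ' : ℝ → Space N → ℝ) (I I' : Set ℝ) (t d : ℝ), MemHsin (s + 1) φ₀ →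
      MemHsin (s + 1) φ₀' → IsSolution σ (s + 1) I φ₀ φ₁ φ ψ →
      IsSolution σ (s + 1) I' φ₀' φ₁' φ' ψ' → 0 ≤ t → t ≤ T → Icc 0 t ⊆ I → Icc 0 t ⊆ I' →
      Close s φ₀ φ₀' α α' d → HBound s (φ₁ - φ₁') d → 8 * A * d ≤ 1 →
      (∀ r ∈ Icc 0 t, BddBy s (φ r) (ψ r) B) →
      (∃ β β', Close s (φ t) (φ' t) β β' ((1 + 2 * A) * d)) ∧
        HBound s (ψ t - ψ' t) (2 * A * d) := by
  -- The margin `1` contains the perturbed solution: `8 A d ≤ 1` and `1 ≤ A` give `d ≤ 1/8`, and the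
  -- bootstrap improves `‖u - u'‖ ≤ 1/2` to `2 A d ≤ 1/4`.
  obtain ⟨A, hA, hst⟩ := hL.exists_stability σ T (B + 1)
  refine ⟨A, hA, fun φ₀ φ₁ φ₀' φ₁' α α' φ ψ φ' ψ' I I' t d hφ₀ hφ₀' h h' ht htT hI hI' hc hp hd hB =>
    ?_⟩
  have hd0 := hc.nonneg
  have hd8 : d ≤ 1 / 8 := by nlinarith
  obtain ⟨γ, D, h0⟩ := hφ₀.exists_close
  obtain rfl := hc.left.unique h0.left
  obtain ⟨γ', D', h0'⟩ := hφ₀'.exists_close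
  obtain rfl := hc.right.unique h0'.left
  obtain ⟨u, p, q, e, hu, hp0⟩ := h.exists_evol hs hL h0 hφ₀.1 ht hI
  obtain ⟨u', p', q', e', hu', hp0'⟩ := h'.exists_evol hs hL h0' hφ₀'.1 ht hI'
  have hpd : ‖p 0 - p' 0‖ ≤ d := by
    obtain ⟨y, hy, hyd⟩ := hp
    rwa [(hp0.sub hp0').unique hy]
  have main : ∀ r ∈ Icc 0 t, (∀ r' ∈ Icc 0 r, ‖u r' - u' r'‖ ≤ 1 / 2) →
      ‖u r - u' r‖ ≤ A * (d + d) ∧ ‖p r - p' r‖ ≤ A * (d + d) := fun r hr hg => by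
    have hsub : Icc 0 r ⊆ Icc 0 t := Icc_subset_Icc_right hr.2
    have hcl : ∀ r' ∈ Icc 0 r, Close s (φ r') 0 (α + fun i => rie i (u r')) 0 B := fun r' hr' =>
      (hB r' (hsub hr')).close (close_of_rep h0 (e.rep_u r' (hsub hr'))).left
    refine hst r φ₀ φ₀' α α' φ ψ φ' ψ' u p q u' p' q' d d (hr.2.trans htT) (e.mono hsub)
      (e'.mono hsub) hu hu' hc hpd (fun r' hr' => (hcl r' hr').le (by linarith)) (fun r' hr' => ?_) r
      ⟨hr.1, le_rfl⟩
    have h1 := close_of_rep₂ hc (e.rep_u r' (hsub hr')) (e'.rep_u r' (hsub hr'))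
    exact (h1.symm.triangle (hcl r' hr')).le (by linarith [hg r' hr'])
  have hboot : ∀ r ∈ Icc 0 t, ‖u r - u' r‖ ≤ 1 / 4 := by
    refine forall_le_of_bootstrap (b := 1 / 2) (by norm_num) (e.cont_u.sub e'.cont_u).norm ?_
      fun r hr hg => (main r hr hg).1.trans (by linarith)
    rw [hu, hu', sub_self, norm_zero]; norm_num
  obtain ⟨h1, h2⟩ := main t ⟨ht, le_rfl⟩ fun r hr => (hboot r hr).trans (by norm_num)
  refine ⟨⟨_, _, (close_of_rep₂ hc (e.rep_u t ⟨ht, le_rfl⟩) (e'.rep_u t ⟨ht, le_rfl⟩)).le ?_⟩,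
    p t - p' t, (e.rep_p t ⟨ht, le_rfl⟩).sub (e'.rep_p t ⟨ht, le_rfl⟩), ?_⟩ <;> linarith

theorem BddBy.of_close {v w v' w' : Space N → ℝ} {B d : ℝ} {β β' : Fin N → L2C N}
    (h : BddBy s v w B) (hc : Close s v v' β β' d) (hw : HBound s (w - w') d) :
    BddBy s v' w' (d + B) := by
  refine ⟨⟨_, hc.symm.triangle (h.close hc.left)⟩, ?_⟩
  have := (hw.smul (-1)).add h.2
  rw [abs_neg, abs_one, one_mul] at this
  exact this.congr (ae_of_all _ fun x => by simp)

/-- The flow is Lipschitz near a bounded solution. -/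
theorem exists_flowLipschitz_of_bddBy (σ : ℝ) (hs : 1 ≤ s) (hL : LipschitzSin N s) {T : ℝ}
    (hT : 0 ≤ T) (B : ℝ) : ∃ R A : ℝ, 0 < R ∧ 0 < A ∧ ∀ (φ₀ φ₁ : Space N → ℝ)
      (φ ψ : ℝ → Space N → ℝ) (I : Set ℝ), MemHsin (s + 1) φ₀ → MemH s φ₁ →
      ENNReal.ofReal T < maxTime σ (s + 1) φ₀ φ₁ → Icc 0 T ⊆ I →
      IsSolution σ (s + 1) I φ₀ φ₁ φ ψ → (∀ t ∈ Icc 0 T, BddBy s (φ t) (ψ t) B) →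
      FlowLipschitz σ (s + 1) T R A φ₀ φ₁ := by
  obtain ⟨A, hA, hst⟩ := exists_stability_of_bddBy σ hs hL T B
  set c := cLo N s with hcdef
  have hc1 : 1 ≤ c := one_le_cLo N s
  have hcD := one_le_cD N s
  have hcU := one_le_cUp N s
  -- The factor `c` converts distances of data into norms of representatives, so this radius ensures
  -- `8 A d ≤ 1` for `d = c δ`; `cD` and `cUp` convert back.
  refine ⟨1 / (8 * A * c), cD N s * ((1 + 2 * A) * c) + cUp N s * (2 * A * c), by positivity,
    by positivity, fun φ₀ φ₁ φ ψ I hφ₀ hφ₁ hTmax hI h hB φ₀' φ₁' hφ₀' hφ₁' hlt => ?_⟩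
  rw [Nat.add_sub_cancel] at *
  set δ := dsin (s + 1) φ₀ φ₀' + hNorm s (φ₁ - φ₁') with hδ
  have hδt : δ ≠ ⊤ := (hlt.trans ENNReal.ofReal_lt_top).ne
  have hδ' : δ = ENNReal.ofReal δ.toReal := (ENNReal.ofReal_toReal hδt).symm
  have hδ0 : 0 ≤ δ.toReal := ENNReal.toReal_nonneg
  have hδR : δ.toReal < 1 / (8 * A * c) := by
    rw [hδ'] at hlt
    exact (ENNReal.ofReal_lt_ofReal_iff_of_nonneg hδ0).mp hlt
  have hd : 8 * A * (c * δ.toReal) ≤ 1 := by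
    rw [lt_div_iff₀ (by positivity)] at hδR
    nlinarith
  obtain ⟨α, D, h0⟩ := hφ₀.exists_close
  obtain ⟨α', D', h0'⟩ := hφ₀'.exists_close
  have hclose : Close s φ₀ φ₀' α α' (c * δ.toReal) :=
    close_of_dsin h0.left h0'.left hφ₀.1.aestronglyMeasurable hφ₀'.1.aestronglyMeasurable hδ0
      (le_self_add.trans hδ'.le)
  have hHB : HBound s (φ₁ - φ₁') (c * δ.toReal) :=
    hBound_of_hNorm_le (hφ₁.sub hφ₁') hδ0 (le_add_self.trans hδ'.le)
  have main : ∀ (φ' ψ' : ℝ → Space N → ℝ) (I' : Set ℝ) (t : ℝ), t ∈ Icc 0 T → Icc 0 t ⊆ I' →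
      IsSolution σ (s + 1) I' φ₀' φ₁' φ' ψ' →
      (∃ β β', Close s (φ t) (φ' t) β β' ((1 + 2 * A) * (c * δ.toReal))) ∧
        HBound s (ψ t - ψ' t) (2 * A * (c * δ.toReal)) := fun φ' ψ' I' t ht hI' h' =>
    hst φ₀ φ₁ φ₀' φ₁' α α' φ ψ φ' ψ' I I' t _ hφ₀ hφ₀' h h' ht.1 ht.2
      ((Icc_subset_Icc_right ht.2).trans hI) hI' hclose hHB hd
      fun r hr => hB r ⟨hr.1, hr.2.trans ht.2⟩
  -- If the perturbed solution ended by time `T`, comparison would keep it bounded up to its end,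
  -- against blow-up.
  have hTmax' : ENNReal.ofReal T < maxTime σ (s + 1) φ₀' φ₁' := by
    by_contra! hle
    have hpos := maxTime_pos (σ := σ) hs hL hφ₀' hφ₁'
    obtain ⟨φ', ψ', h'⟩ := exists_maximal hs hL hφ₀' hpos
    have hfin : maxTime σ (s + 1) φ₀' φ₁' ≠ ⊤ := (hle.trans_lt ENNReal.ofReal_lt_top).ne
    set T' := (maxTime σ (s + 1) φ₀' φ₁').toReal with hT'
    have hmax : maxTime σ (s + 1) φ₀' φ₁' = ENNReal.ofReal T' := (ENNReal.ofReal_toReal hfin).symm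
    have hT'0 : 0 < T' := ENNReal.toReal_pos hpos.ne' hfin
    have hT'T : T' ≤ T := by
      rw [hmax] at hle
      exact (ENNReal.ofReal_le_ofReal_iff hT).mp hle
    rw [hmax] at h'
    obtain ⟨t, h4, ht⟩ := ((eventually_not_bddBy hs hL hφ₀' hT'0 hmax h'
      ((1 + 2 * A) * (c * δ.toReal) + B)).and (eventually_mem_timeIco hT'0)).exists
    have htT : t ∈ Icc 0 T := ⟨ht.1, (timeIco_ofReal_subset T' ht).2.trans hT'T⟩
    obtain ⟨⟨β, β', h5⟩, h6⟩ := main φ' ψ' _ t htT (Icc_subset_timeIco ht.2) h'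
    refine h4 ((hB t htT).of_close h5 (h6.le ?_))
    gcongr
    linarith
  refine ⟨hTmax', fun φ₂ ψ₂ φ' ψ' h₂ h' t ht => ?_⟩
  have hle : ENNReal.ofReal t ≤ ENNReal.ofReal T := ENNReal.ofReal_le_ofReal ht.2
  obtain ⟨⟨β, β', h5⟩, h6⟩ := main φ' ψ' _ t ht (Icc_subset_timeIco (hle.trans_lt hTmax')) h'
  obtain ⟨e1, e2⟩ := h.unique hs hL hφ₀ h₂ ht.1 ((Icc_subset_Icc_right ht.2).trans hI)
    (Icc_subset_timeIco (hle.trans_lt hTmax))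
  have h7 := (h5.congr e1 (ae_eq_refl _)).dsin_le
  have h8 := (h6.congr (e2.sub (ae_eq_refl _))).hNorm_le
  refine (add_le_add h7 h8).trans (le_of_eq ?_)
  rw [← ENNReal.ofReal_add (by positivity) (by positivity), hδ',
    ← ENNReal.ofReal_mul (by positivity), ENNReal.toReal_ofReal hδ0]
  congr 1
  ring

theorem exists_flowLipschitz_of_bound (σ : ℝ) (hs : 1 ≤ s) (hL : LipschitzSin N s) {T : ℝ}
    (hT : 0 ≤ T) (B : ℝ) : ∃ R A : ℝ, 0 < R ∧ 0 < A ∧ ∀ φ₀ φ₁ : Space N → ℝ, MemHsin (s + 1) φ₀ →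
      MemH s φ₁ → ENNReal.ofReal T < maxTime σ (s + 1) φ₀ φ₁ → ∀ φ ψ : ℝ → Space N → ℝ,
        IsSolution σ (s + 1) (timeIco (maxTime σ (s + 1) φ₀ φ₁)) φ₀ φ₁ φ ψ →
        (∀ t ∈ Icc 0 T, dsin (s + 1) (φ t) 0 + hNorm s (ψ t) ≤ ENNReal.ofReal B) →
        FlowLipschitz σ (s + 1) T R A φ₀ φ₁ := by
  obtain ⟨R, A, hR, hA, h⟩ := exists_flowLipschitz_of_bddBy σ hs hL hT (cLo N s * max B 0)
  refine ⟨R, A, hR, hA, fun φ₀ φ₁ hφ₀ hφ₁ hTmax φ ψ hsol hB =>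
    h φ₀ φ₁ φ ψ _ hφ₀ hφ₁ hTmax (Icc_subset_timeIco hTmax) hsol fun t ht => ?_⟩
  exact hsol.bddBy_of_le hφ₀ (Icc_subset_timeIco hTmax ht) (le_max_right _ _)
    ((hB t ht).trans (ENNReal.ofReal_le_ofReal (le_max_left _ _)))

theorem exists_flowLipschitz_of_lt_maxTime (hs : 1 ≤ s) (hL : LipschitzSin N s)
    (hφ₀ : MemHsin (s + 1) φ₀) (hφ₁ : MemH s φ₁) {T : ℝ} (hT : 0 ≤ T)
    (hTmax : ENNReal.ofReal T < maxTime σ (s + 1) φ₀ φ₁) :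
    ∃ R A : ℝ, 0 < R ∧ 0 < A ∧ FlowLipschitz σ (s + 1) T R A φ₀ φ₁ := by
  obtain ⟨φ, ψ, h⟩ := exists_maximal hs hL hφ₀ (zero_le.trans_lt hTmax)
  obtain ⟨B, hB⟩ := h.exists_bddBy hs hL hφ₀ hT (Icc_subset_timeIco hTmax)
  obtain ⟨R, A, hR, hA, hF⟩ := exists_flowLipschitz_of_bddBy σ hs hL hT B
  exact ⟨R, A, hR, hA, hF φ₀ φ₁ φ ψ _ hφ₀ hφ₁ hTmax (Icc_subset_timeIco hTmax) h hB⟩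

theorem exists_close_of_dsin_le (hφ₀ : MemHsin (s + 1) φ₀) {D : ℝ}
    (hD : dsin (s + 1) φ₀ 0 ≤ ENNReal.ofReal D) : ∃ α, Close s φ₀ 0 α 0 (cLo N s * max D 0) := by
  obtain ⟨α, D', h0⟩ := hφ₀.exists_close
  exact ⟨α, close_of_dsin h0.left h0.right h0.left_meas h0.right_meas (le_max_right _ _)
    (hD.trans (ENNReal.ofReal_le_ofReal (le_max_left _ _)))⟩

theorem exists_flowLipschitz_local (σ : ℝ) (hs : 1 ≤ s) (hL : LipschitzSin N s) (D M : ℝ) :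
    ∃ τ R A : ℝ, 0 < τ ∧ 0 < R ∧ 0 < A ∧ ∀ φ₀ φ₁ : Space N → ℝ, MemHsin (s + 1) φ₀ → MemH s φ₁ →
      dsin (s + 1) φ₀ 0 ≤ ENNReal.ofReal D → hNorm s φ₁ ≤ ENNReal.ofReal M →
      ENNReal.ofReal τ < maxTime σ (s + 1) φ₀ φ₁ ∧ FlowLipschitz σ (s + 1) τ R A φ₀ φ₁ := by
  obtain ⟨τ, B, hτ, hloc⟩ := exists_local_bound σ hs hL (cLo N s * max D 0) (cLo N s * max M 0)
  -- Half of the existence time, so that the maximal time is strictly larger.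
  obtain ⟨R, A, hR, hA, hF⟩ := exists_flowLipschitz_of_bddBy σ hs hL (T := τ / 2) (by linarith)
    (cLo N s * max D 0 + B)
  refine ⟨τ / 2, R, A, by linarith, hR, hA, fun φ₀ φ₁ hφ₀ hφ₁ hD hM => ?_⟩
  obtain ⟨α, h0⟩ := exists_close_of_dsin_le hφ₀ hD
  obtain ⟨φ, ψ, h, hB⟩ := hloc φ₀ φ₁ α hφ₀.1 h0 (hBound_of_hNorm_le hφ₁ (le_max_right _ _)
    (hM.trans (ENNReal.ofReal_le_ofReal (le_max_left _ _))))
  have hlt : ENNReal.ofReal (τ / 2) < maxTime σ (s + 1) φ₀ φ₁ :=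
    ((ENNReal.ofReal_lt_ofReal_iff hτ).mpr (by linarith)).trans_le
      (h.mono (timeIco_ofReal_subset τ)).le_maxTime
  refine ⟨hlt, hF φ₀ φ₁ φ ψ _ hφ₀ hφ₁ hlt (Icc_subset_Icc_right (by linarith)) h fun t ht => ?_⟩
  obtain ⟨⟨y, hy, hyB⟩, h2⟩ := hB t ⟨ht.1, ht.2.trans (by linarith)⟩
  exact ⟨⟨_, (close_of_rep h0 hy).le (by linarith)⟩, h2.le (by linarith [h0.nonneg])⟩

end
end
end SineGordon

open scoped NNReal
namespace SineGordon
noncomputable section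
variable {N : ℕ}

/-! ### Bounds at higher regularity and global existence in low dimension -/

section

variable {σ : ℝ} {s : ℕ} {I : Set ℝ} {φ₀ φ₁ : Space N → ℝ} {α : Fin N → L2C N} {D : ℝ}
  {φ ψ : ℝ → Space N → ℝ} {u p q : ℝ → L2C N}

theorem Close.lower {v w : Space N → ℝ} {β : Fin N → L2C N} {d : ℝ} (h : Close (s + 1) v w α β d) :
    Close s v w (fun i => bes 1 (α i)) (fun i => bes 1 (β i)) d where
  left := h.left.mono
  right := h.right.mono
  left_meas := h.left_meas
  right_meas := h.right_meas
  nonneg := h.nonneg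
  sin_le := h.sin_le
  grad_le i := by
    rw [← map_sub]
    exact (norm_bes_le _ _).trans (h.grad_le i)

theorem HasDerivWithinAt.bes {f : ℝ → L2C N} {f' : L2C N} {t : ℝ} (r : ℕ)
    (h : HasDerivWithinAt f f' I t) :
    HasDerivWithinAt (fun t => SineGordon.bes r (f t)) (SineGordon.bes r f') I t :=
  (((SineGordon.bes r).restrictScalars ℝ).hasFDerivAt).comp_hasDerivWithinAt t h

theorem Evol.lower (h : Evol σ (s + 1) I φ₀ α φ ψ u p q) :
    Evol σ s I φ₀ (fun i => bes 1 (α i)) φ ψ (fun t => bes 1 (u t)) (fun t => bes 1 (p t))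
      (fun t => bes 1 (q t)) where
  rep_u t ht := (h.rep_u t ht).mono
  rep_p t ht := (h.rep_p t ht).mono
  rep_q t ht := (h.rep_q t ht).mono
  cont_u := (bes 1).continuous.comp_continuousOn h.cont_u
  cont_p := (bes 1).continuous.comp_continuousOn h.cont_p
  cont_q := (bes 1).continuous.comp_continuousOn h.cont_q
  deriv_u t ht := HasDerivWithinAt.bes 1 (h.deriv_u t ht)
  deriv_p t ht := by
    refine (HasDerivWithinAt.bes 1 (h.deriv_p t ht)).congr_deriv ?_
    rw [map_sub, map_sum, bes_smul_real]
    simp only [bes_rie, map_add]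

/-- A solution bounded in `H_sin^{s+1}` is bounded in `H_sin^{s+2} × H^{s+1}`. -/
theorem exists_bound_succ (hsin : ∀ B, ∃ L : ℝ, ∀ (v : Space N → ℝ) (α : Fin N → L2C N),
      Close s v 0 α 0 B → HBound (s + 1) (fun x => Real.sin (2 * v x)) L) (σ T D M B : ℝ) :
    ∃ B' : ℝ, ∀ (T' : ℝ) (φ₀ : Space N → ℝ) (α : Fin N → L2C N) (φ ψ : ℝ → Space N → ℝ)
      (u p q : ℝ → L2C N), T' ≤ T → Evol σ (s + 1) (Icc 0 T') φ₀ α φ ψ u p q →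
      Close (s + 1) φ₀ 0 α 0 D → u 0 = 0 → ‖p 0‖ ≤ M →
      (∀ t ∈ Icc 0 T', ∃ β, Close s (φ t) 0 β 0 B) → ∀ t ∈ Icc 0 T', ‖u t‖ ≤ B' ∧ ‖p t‖ ≤ B' := by
  obtain ⟨L, hL⟩ := hsin B
  refine ⟨_, fun T' φ₀ α φ ψ u p q hT h h0 hu0 hp0 hB t ht =>
    h.norm_le h0 hu0 hp0 (K := 1) (ε := |σ| * L) le_rfl ?_ (fun t ht => ?_) ht hT⟩
  · obtain ⟨β, hβ⟩ := hB t ht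
    have := (hL _ _ hβ).nonneg
    positivity
  · obtain ⟨β, hβ⟩ := hB t ht
    obtain ⟨y, hy, hyL⟩ := hL _ _ hβ
    rw [sub_self, zero_mul, zero_add, (h.rep_q t ht).unique hy]
    gcongr

/-- In dimension at most `3`, the solutions are bounded on bounded intervals. -/
theorem exists_bound_of_le_three (hN : N ≤ 3) (σ T D M : ℝ) (s : ℕ) :
    ∃ B' : ℝ, ∀ (T' : ℝ) (φ₀ : Space N → ℝ) (α : Fin N → L2C N) (φ ψ : ℝ → Space N → ℝ)
      (u p q : ℝ → L2C N), T' ≤ T → Evol σ s (Icc 0 T') φ₀ α φ ψ u p q →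
      Close s φ₀ 0 α 0 D → u 0 = 0 → ‖p 0‖ ≤ M → ∀ t ∈ Icc 0 T', ‖u t‖ ≤ B' ∧ ‖p t‖ ≤ B' := by
  induction s with
  | zero =>
    -- In `H_sin^1 × L²`, `|sin 2φ| ≤ 2|sin φ|` gives `‖q‖ ≤ 2(D + ‖u‖)`: linear growth, hence a
    -- bound on any finite interval.
    refine ⟨_, fun T' φ₀ α φ ψ u p q hT h h0 hu0 hp0 t ht =>
      h.norm_le h0 hu0 hp0 (K := 1 + 2 * |σ|) (ε := 2 * |σ| * D) (by linarith [abs_nonneg σ])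
        (by have := h0.nonneg; positivity) (fun t ht => ?_) ht hT⟩
    obtain ⟨y, hy, hyL⟩ := (close_of_rep h0 (h.rep_u t ht)).hBound_sin
    have h1 : q t = y := (h.rep_q t ht).unique (hy.congr (ae_of_all _ fun x => by simp))
    rw [h1]
    have := mul_le_mul_of_nonneg_left hyL (abs_nonneg σ)
    linarith
  | succ s ih =>
    obtain ⟨B, hB⟩ := ih
    -- The bound at level `s` controls `sin 2φ` in `H^{s+1}`, the forcing at the next level.
    obtain ⟨B', hB'⟩ := exists_bound_succ (s := s) (exists_hBound_sin hN s) σ T D M (D + B)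
    refine ⟨B', fun T' φ₀ α φ ψ u p q hT h h0 hu0 hp0 =>
      hB' T' φ₀ α φ ψ u p q hT h h0 hu0 hp0 fun t ht => ?_⟩
    have h1 := h.lower
    have h0' : Close s φ₀ 0 (fun i => bes 1 (α i)) 0 D := by
      have := h0.lower
      simp only [Pi.zero_apply, map_zero] at this
      exact this
    have h2 := hB T' φ₀ _ φ ψ _ _ _ hT h1 h0' (by simp [hu0]) ((norm_bes_le _ _).trans hp0) t ht
    exact ⟨_, (close_of_rep h0' (h1.rep_u t ht)).le (by linarith [h2.1])⟩

theorem maxTime_eq_top (hN : N ≤ 3) (hs : 1 ≤ s) (hL : LipschitzSin N s)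
    (hφ₀ : MemHsin (s + 1) φ₀) (hφ₁ : MemH s φ₁) : maxTime σ (s + 1) φ₀ φ₁ = ⊤ := by
  by_contra hfin
  have hpos := maxTime_pos (σ := σ) hs hL hφ₀ hφ₁
  obtain ⟨φ, ψ, h⟩ := exists_maximal hs hL hφ₀ hpos
  set T := (maxTime σ (s + 1) φ₀ φ₁).toReal with hT
  have hmax : maxTime σ (s + 1) φ₀ φ₁ = ENNReal.ofReal T := (ENNReal.ofReal_toReal hfin).symm
  have hT0 : 0 < T := ENNReal.toReal_pos hpos.ne' hfin
  rw [hmax] at h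
  obtain ⟨α, D, h0⟩ := hφ₀.exists_close
  obtain ⟨p₀, hp₀⟩ := memH_iff.mp hφ₁
  obtain ⟨B, hB⟩ := exists_bound_of_le_three hN σ T D ‖p₀‖ s
  obtain ⟨t, h4, ht⟩ := ((eventually_not_bddBy hs hL hφ₀ hT0 hmax h (D + B)).and
    (eventually_mem_timeIco hT0)).exists
  obtain ⟨u, p, q, e, hu, hp⟩ := h.exists_evol hs hL h0 hφ₀.1 ht.1 (Icc_subset_timeIco ht.2)
  have h5 := hB t φ₀ α φ ψ u p q (timeIco_ofReal_subset T ht).2 e h0 hu (by rw [hp.unique hp₀])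
    t ⟨ht.1, le_rfl⟩
  exact h4 (e.bddBy h0 ⟨ht.1, le_rfl⟩ h5.1 h5.2)

theorem exists_flowLipschitz_of_le_three (hN : N ≤ 3) (σ : ℝ) (hs : 1 ≤ s) (hL : LipschitzSin N s)
    {T : ℝ} (hT : 0 ≤ T) (D M : ℝ) : ∃ R A : ℝ, 0 < R ∧ 0 < A ∧ ∀ φ₀ φ₁ : Space N → ℝ,
      MemHsin (s + 1) φ₀ → MemH s φ₁ → dsin (s + 1) φ₀ 0 ≤ ENNReal.ofReal D →
      hNorm s φ₁ ≤ ENNReal.ofReal M → FlowLipschitz σ (s + 1) T R A φ₀ φ₁ := by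
  obtain ⟨B, hB⟩ := exists_bound_of_le_three hN σ T (cLo N s * max D 0) (cLo N s * max M 0) s
  obtain ⟨R, A, hR, hA, hF⟩ := exists_flowLipschitz_of_bddBy σ hs hL hT (cLo N s * max D 0 + B)
  refine ⟨R, A, hR, hA, fun φ₀ φ₁ hφ₀ hφ₁ hD hM => ?_⟩
  obtain ⟨α, h0⟩ := exists_close_of_dsin_le hφ₀ hD
  obtain ⟨p₀, hp₀, hpM⟩ := hBound_of_hNorm_le hφ₁ (le_max_right _ _)
    (hM.trans (ENNReal.ofReal_le_ofReal (le_max_left _ 0)))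
  have hlt : ENNReal.ofReal T < maxTime σ (s + 1) φ₀ φ₁ := by
    rw [maxTime_eq_top hN hs hL hφ₀ hφ₁]; exact ENNReal.ofReal_lt_top
  obtain ⟨φ, ψ, h⟩ := exists_maximal hs hL hφ₀ (zero_le.trans_lt hlt)
  refine hF φ₀ φ₁ φ ψ _ hφ₀ hφ₁ hlt (Icc_subset_timeIco hlt) h fun t ht => ?_
  obtain ⟨u, p, q, e, hu, hp⟩ := h.exists_evol hs hL h0 hφ₀.1 hT (Icc_subset_timeIco hlt)
  have h5 := hB T φ₀ α φ ψ u p q le_rfl e h0 hu (by rwa [hp.unique hp₀]) t ht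
  exact e.bddBy h0 ht h5.1 h5.2

/-! ### Persistence of regularity -/

theorem IsSolution.lower {k : ℕ} (h : IsSolution σ (k + 1) I φ₀ φ₁ φ ψ) :
    IsSolution σ k I φ₀ φ₁ φ ψ := by
  have hk : k - 1 ≤ k + 1 - 1 := by omega
  have key : ∀ {ι : Type} {l : Filter ι} {a b : ℕ} (_ : a ≤ b) {f : ι → Space N → ℝ},
      Tendsto (fun i => hNorm b (f i)) l (𝓝 0) → Tendsto (fun i => hNorm a (f i)) l (𝓝 0) :=
    fun hab _ hf => tendsto_of_tendsto_of_tendsto_of_le_of_le tendsto_const_nhds hf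
      (fun _ => zero_le) fun _ => hNorm_mono hab _
  exact ⟨⟨fun t ht => (h.contInH.1 t ht).mono (by omega), fun t ht => key (by omega) (h.contInH.2 t ht)⟩,
    ⟨fun t ht => (h.contInH_deriv.1 t ht).mono hk, fun t ht => key hk (h.contInH_deriv.2 t ht)⟩,
    fun t ht => key hk (h.hasTimeDeriv t ht), h.equation, h.initial, h.initial_deriv⟩

theorem maxTime_succ_le (σ : ℝ) (k : ℕ) (φ₀ φ₁ : Space N → ℝ) :
    maxTime σ (k + 1) φ₀ φ₁ ≤ maxTime σ k φ₀ φ₁ :=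
  sSup_le_sSup fun _ ⟨φ, ψ, h⟩ => ⟨φ, ψ, h.lower⟩

theorem MemHsin.mono {j k : ℕ} (hjk : j ≤ k) {v : Space N → ℝ} (h : MemHsin k v) : MemHsin j v :=
  ⟨h.1, fun m h1 hm => h.2.1 m h1 (hm.trans hjk), h.2.2⟩

/-- If the smoother solution ended first, at `T`, it would stay bounded in the lower norm up to `T`;
then `sin 2φ` is bounded in `H^{s+1}` and `exists_bound_succ` bounds the higher norm, against
blow-up at `T`. -/
theorem maxTime_succ (hs : N < 2 * s) (hs1 : 1 ≤ s) (hφ₀ : MemHsin (s + 2) φ₀)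
    (hφ₁ : MemH (s + 1) φ₁) : maxTime σ (s + 2) φ₀ φ₁ = maxTime σ (s + 1) φ₀ φ₁ := by
  have hL := lipschitzSin_of_lt hs
  have hL' : LipschitzSin N (s + 1) := lipschitzSin_of_lt (by omega)
  refine (maxTime_succ_le σ (s + 1) φ₀ φ₁).eq_of_not_lt fun hlt => ?_
  have hpos := maxTime_pos (σ := σ) (by omega) hL' hφ₀ hφ₁
  obtain ⟨φ, ψ, h⟩ := exists_maximal (by omega) hL' hφ₀ hpos
  have hfin := hlt.ne_top
  set T := (maxTime σ (s + 2) φ₀ φ₁).toReal with hT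
  have hmax : maxTime σ (s + 2) φ₀ φ₁ = ENNReal.ofReal T := (ENNReal.ofReal_toReal hfin).symm
  have hT0 : 0 < T := ENNReal.toReal_pos hpos.ne' hfin
  rw [hmax] at h hlt
  obtain ⟨B, hB⟩ := exists_bddBy_of_lt_maxTime hs1 hL (hφ₀.mono (by omega)) hT0.le hlt h.lower
  obtain ⟨α, D, h0⟩ := hφ₀.exists_close
  obtain ⟨p₀, hp₀⟩ := memH_iff.mp hφ₁
  obtain ⟨B', hB'⟩ := exists_bound_succ (s := s) (fun B => by
    obtain ⟨L, -, hL⟩ := exists_hBound_sin_cos hs (le_refl (s + 1)) B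
    exact ⟨L * B, fun v α hv => (hL v 0 α 0 B hv hv (close_zero_zero hv.nonneg)).1.congr
      (ae_of_all _ fun x => by simp)⟩) σ T D ‖p₀‖ B
  obtain ⟨t, h4, ht⟩ := ((eventually_not_bddBy (by omega) hL' hφ₀ hT0 hmax h (D + B')).and
    (eventually_mem_timeIco hT0)).exists
  obtain ⟨u, p, q, e, hu, hp⟩ := h.exists_evol (by omega) hL' h0 hφ₀.1 ht.1 (Icc_subset_timeIco ht.2)
  have h5 := hB' t φ₀ α φ ψ u p q (timeIco_ofReal_subset T ht).2 e h0 hu (by rw [hp.unique hp₀])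
    (fun r hr => (hB r (Icc_subset_timeIco ht.2 hr)).1) t ⟨ht.1, le_rfl⟩
  exact h4 (e.bddBy h0 ⟨ht.1, le_rfl⟩ h5.1 h5.2)

theorem IsSolution.succ (hs : N < 2 * s) (hs1 : 1 ≤ s) (hφ₀ : MemHsin (s + 2) φ₀)
    (hφ₁ : MemH (s + 1) φ₁)
    (h : IsSolution σ (s + 1) (timeIco (maxTime σ (s + 1) φ₀ φ₁)) φ₀ φ₁ φ ψ) :
    IsSolution σ (s + 2) (timeIco (maxTime σ (s + 1) φ₀ φ₁)) φ₀ φ₁ φ ψ := by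
  have hL' : LipschitzSin N (s + 1) := lipschitzSin_of_lt (by omega)
  obtain ⟨φ', ψ', h'⟩ := exists_maximal (by omega) hL' hφ₀
    (maxTime_pos (σ := σ) (by omega) hL' hφ₀ hφ₁)
  have e : maxTime σ (s + 1 + 1) φ₀ φ₁ = maxTime σ (s + 1) φ₀ φ₁ := maxTime_succ hs hs1 hφ₀ hφ₁
  rw [e] at h'
  have huniq : ∀ t ∈ timeIco (maxTime σ (s + 1) φ₀ φ₁), φ' t =ᵐ[volume] φ t ∧ ψ' t =ᵐ[volume] ψ t :=
    fun t ht => h'.lower.unique hs1 (lipschitzSin_of_lt hs) (hφ₀.mono (by omega)) h ht.1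
      (Icc_subset_timeIco ht.2) (Icc_subset_timeIco ht.2)
  exact isSolution_iff.mpr ⟨h'.solOn.congr (fun t ht => (huniq t ht).1) fun t ht => (huniq t ht).2,
    h.initial, h.initial_deriv⟩

/-- `∂_tt φ` is read off from the equation at level `s + 1`: the derivative of `bes 1 p` is a
continuous real element `g` of `L²`, and `θ = bes s g`. -/
theorem IsSolution.exists_second_deriv (hs : 1 ≤ s) (hL : LipschitzSin N (s + 1))
    (hφ₀ : MemHsin (s + 2) φ₀) (hI : Convex ℝ I) (h : IsSolution σ (s + 2) I φ₀ φ₁ φ ψ) :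
    ∃ θ : ℝ → Space N → ℝ, HasTimeDeriv s I ψ θ ∧ ContInH s I 0 θ := by
  obtain ⟨α, D, h0⟩ := hφ₀.exists_close
  obtain ⟨u, p, q, e⟩ := h.solOn.exists_evol (by omega) hL h0 hφ₀.1 hI
  set g : ℝ → L2C N := fun t => (∑ i, rie i (α i + rie i (u t))) - (σ / 2) • bes 1 (q t) with hg
  have hconj : ∀ t ∈ I, conjL (g t) = g t := fun t ht => by
    rw [hg, map_sub, map_sum, map_smul, conjL_bes, (e.rep_q t ht).conj]
    simp only [conjL_rie, map_add, (h0.left.rep _).conj, (e.rep_u t ht).conj]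
  have hrep : ∀ t ∈ I, Rep s (reF (bes s (g t))) (g t) := fun t ht => rep_reF (hconj t ht)
  have hgc : ContinuousOn g I := by
    have h1 : ContinuousOn (fun t => bes 1 (q t)) I := (bes 1).continuous.comp_continuousOn e.cont_q
    refine ContinuousOn.sub (continuousOn_finsetSum _ fun i _ => ?_) (h1.const_smul (σ / 2))
    exact (rie i).continuous.comp_continuousOn
      (continuousOn_const.add ((rie i).continuous.comp_continuousOn e.cont_u))
  refine ⟨fun t => reF (bes s (g t)), fun t ht => ?_, fun t ht => ?_, fun t ht => ?_⟩
  · have h1 := hasDerivWithinAt_iff_tendsto_slope.mp (e.deriv_p t ht)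
    rw [tendsto_hNorm_iff (y := fun r => slope (fun t => bes 1 (p t)) t r - g t)]
    · rw [← tendsto_sub_nhds_zero_iff] at h1
      exact h1
    · filter_upwards [self_mem_nhdsWithin] with r hr
      exact ((((e.rep_p r hr.1).mono).sub ((e.rep_p t ht).mono)).smul _).sub (hrep t ht)
  · rw [sub_zero]
    exact (hrep t ht).memH
  · rw [tendsto_hNorm_iff (y := fun r => g r - g t)]
    · exact tendsto_sub_nhds_zero_iff.mpr (hgc t ht)
    · filter_upwards [self_mem_nhdsWithin] with r hr
      exact (hrep r hr).sub (hrep t ht)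

theorem convex_timeIco (T : ℝ≥0∞) : Convex ℝ (timeIco T) := by
  refine Set.OrdConnected.convex ⟨fun a ha b hb x hx => ⟨ha.1.trans hx.1, ?_⟩⟩
  exact (ENNReal.ofReal_le_ofReal hx.2).trans_lt hb.2

end
end
end SineGordon

open scoped NNReal
namespace SineGordon
noncomputable section
variable {N : ℕ}

/-! ### Reversal of time and the flow on `ℝ` -/

section

variable {σ : ℝ} {k : ℕ} {I : Set ℝ} {φ₀ φ₁ : Space N → ℝ} {φ ψ φ' ψ' : ℝ → Space N → ℝ}

theorem orderNormSq_neg (m : ℕ) (v : Space N → ℝ) : orderNormSq m (-v) = orderNormSq m v := by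
  have key : ∀ (w : Space N → ℝ) (α : Fin m → Fin N), weakDerivNorm α (-w) ≤ weakDerivNorm α w :=
    fun w α => le_iInf₂ fun g hg => by
      refine (iInf₂_le (-g) ⟨hg.1.neg, hg.2.1.neg, fun χ hχ => ?_⟩).trans_eq (eLpNorm_neg g 2 volume)
      simp only [Pi.neg_apply, neg_mul, integral_neg, hg.2.2 χ hχ, mul_neg]
  refine Finset.sum_congr rfl fun α _ => ?_
  congr 1
  refine le_antisymm (key v α) ?_
  have := key (-v) α
  rwa [neg_neg] at this

theorem hNorm_neg (k : ℕ) (v : Space N → ℝ) : hNorm k (-v) = hNorm k v := by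
  simp only [hNorm, orderNormSq_neg]

theorem hNorm_sub_comm (k : ℕ) (v w : Space N → ℝ) : hNorm k (v - w) = hNorm k (w - v) := by
  rw [← hNorm_neg, neg_sub]

theorem dsin_comm (k : ℕ) (v w : Space N → ℝ) : dsin k v w = dsin k w v := by
  have h1 : eLpNorm (fun x => Real.sin (v x - w x)) 2 volume =
      eLpNorm (fun x => Real.sin (w x - v x)) 2 volume := by
    rw [← eLpNorm_neg]
    congr 1
    funext x
    rw [Pi.neg_apply, ← Real.sin_neg, neg_sub]
  rw [dsin, dsin, h1, ← neg_sub w v]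
  simp only [orderNormSq_neg]

/-- The equation is of second order in time, so reversing time only changes the sign of the
velocity. -/
theorem IsSolution.reflect (h : IsSolution σ k I φ₀ φ₁ φ ψ) :
    IsSolution σ k (Neg.neg ⁻¹' I) φ₀ (-φ₁) (fun t => φ (-t)) (fun t => -ψ (-t)) := by
  have hneg : ∀ t : ℝ, Tendsto (Neg.neg : ℝ → ℝ) (𝓝[Neg.neg ⁻¹' I] t) (𝓝[I] (-t)) := fun t =>
    continuous_neg.continuousWithinAt.tendsto_nhdsWithin fun _ h => h
  refine ⟨⟨fun t ht => h.contInH.1 _ ht, fun t ht => (h.contInH.2 _ ht).comp (hneg t)⟩,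
    ⟨fun t ht => ?_, fun t ht => ?_⟩, fun t ht => ?_, fun χ hχ t ht => ?_, ?_, ?_⟩
  · have := (h.contInH_deriv.1 _ ht).neg
    simpa only [sub_zero] using this
  · refine ((h.contInH_deriv.2 _ ht).comp (hneg t)).congr fun r => ?_
    rw [Function.comp_apply, neg_sub_neg, hNorm_sub_comm]
  · have h1 : Tendsto (Neg.neg : ℝ → ℝ) (𝓝[(Neg.neg ⁻¹' I) \ {t}] t) (𝓝[I \ {-t}] (-t)) :=
      continuous_neg.continuousWithinAt.tendsto_nhdsWithin fun r hr =>
        ⟨hr.1, fun h => hr.2 (neg_injective h)⟩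
    refine ((h.hasTimeDeriv _ ht).comp h1).congr fun r => ?_
    rw [Function.comp_apply, ← hNorm_neg]
    congr 1
    have hinv : (-r - -t)⁻¹ = -(r - t)⁻¹ := by rw [← inv_neg]; congr 1; ring
    funext x
    simp only [hinv, Pi.neg_apply, Pi.sub_apply, Pi.smul_apply, smul_eq_mul]
    ring
  · have h1 := (h.equation χ hχ (-t) ht).scomp t ((hasDerivAt_neg t).hasDerivWithinAt)
      (fun _ h => h : MapsTo (Neg.neg : ℝ → ℝ) (Neg.neg ⁻¹' I) I)
    have h2 := h1.neg
    simp only [neg_smul, one_smul, neg_neg] at h2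
    refine h2.congr_of_mem (fun r _ => ?_) ht
    simp only [Pi.neg_apply, neg_mul, integral_neg, Function.comp_apply]
  · rw [neg_zero]; exact h.initial
  · rw [neg_zero]; exact h.initial_deriv.neg

variable {s : ℕ}

theorem IsSolution.unique_univ (hs : 1 ≤ s) (hL : LipschitzSin N s) (hφ₀ : MemHsin (s + 1) φ₀)
    (h : IsSolution σ (s + 1) univ φ₀ φ₁ φ ψ) (h' : IsSolution σ (s + 1) univ φ₀ φ₁ φ' ψ') (t : ℝ) :
    φ t =ᵐ[volume] φ' t ∧ ψ t =ᵐ[volume] ψ' t := by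
  rcases le_total 0 t with ht | ht
  · exact h.unique hs hL hφ₀ h' ht (subset_univ _) (subset_univ _)
  · obtain ⟨h1, h2⟩ := h.reflect.unique hs hL hφ₀ h'.reflect (neg_nonneg.mpr ht)
      (fun _ _ => mem_univ _) fun _ _ => mem_univ _
    simp only [neg_neg] at h1 h2
    exact ⟨h1, by simpa using h2.neg⟩

theorem exists_isSolution_univ (hN : N ≤ 3) (hs : 1 ≤ s) (hL : LipschitzSin N s)
    (hφ₀ : MemHsin (s + 1) φ₀) (hφ₁ : MemH s φ₁) :
    ∃ φ ψ : ℝ → Space N → ℝ, IsSolution σ (s + 1) univ φ₀ φ₁ φ ψ := by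
  have key : ∀ φ₁ : Space N → ℝ, MemH s φ₁ → ∃ φ ψ : ℝ → Space N → ℝ,
      IsSolution σ (s + 1) (Ici 0) φ₀ φ₁ φ ψ := fun φ₁ hφ₁ => by
    obtain ⟨φ, ψ, h⟩ := exists_maximal hs hL hφ₀ (maxTime_pos (σ := σ) hs hL hφ₀ hφ₁)
    rw [maxTime_eq_top hN hs hL hφ₀ hφ₁] at h
    exact ⟨φ, ψ, h.mono fun t ht => ⟨ht, ENNReal.ofReal_lt_top⟩⟩
  obtain ⟨φ, ψ, h⟩ := key φ₁ hφ₁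
  obtain ⟨φ', ψ', h'⟩ := key (-φ₁) hφ₁.neg
  have h2 := h'.reflect
  rw [neg_neg] at h2
  have hI : (Neg.neg ⁻¹' Ici 0 : Set ℝ) = Iic 0 := by ext; simp
  rw [hI] at h2
  have h3 := h2.solOn.glue isClosed_Iic isClosed_Ici (fun t ht => ht) (fun t ht => ht) h.solOn
    (h2.initial.trans h.initial.symm) (h2.initial_deriv.trans h.initial_deriv.symm)
  rw [Iic_union_Ici] at h3
  refine ⟨_, _, isSolution_iff.mpr ⟨h3, ?_, ?_⟩⟩
  · rw [if_pos le_rfl]; exact h2.initial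
  · rw [if_pos le_rfl]; exact h2.initial_deriv

/-- The Lipschitz estimate on `[0, T]` is applied to the data `(φ₀, φ₁)` and, for negative times, to
the reflected data `(φ₀, -φ₁)`; for large `n` the data are within both radii. -/
theorem tendsto_flow (hN : N ≤ 3) (hs : 1 ≤ s) (hL : LipschitzSin N s) {φ₀n φ₁n : ℕ → Space N → ℝ}
    {φn ψn : ℕ → ℝ → Space N → ℝ} (hφ₀ : MemHsin (s + 1) φ₀) (hφ₁ : MemH s φ₁)
    (hφ₀n : ∀ n, MemHsin (s + 1) (φ₀n n)) (hφ₁n : ∀ n, MemH s (φ₁n n))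
    (h : IsSolution σ (s + 1) univ φ₀ φ₁ φ ψ)
    (hn : ∀ n, IsSolution σ (s + 1) univ (φ₀n n) (φ₁n n) (φn n) (ψn n))
    (hlim : Tendsto (fun n => dsin (s + 1) (φ₀n n) φ₀ + hNorm s (φ₁n n - φ₁)) atTop (𝓝 0)) (T : ℝ) :
    Tendsto (fun n => ⨆ t ∈ Icc (-T) T,
      (dsin (s + 1) (φn n t) (φ t) + hNorm s (ψn n t - ψ t))) atTop (𝓝 0) := by
  rcases lt_or_ge T 0 with hT | hT
  · rw [Icc_eq_empty (by linarith)]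
    simp
  have hlt : ∀ φ₁, MemH s φ₁ → ENNReal.ofReal T < maxTime σ (s + 1) φ₀ φ₁ := fun φ₁ hφ₁ => by
    rw [maxTime_eq_top hN hs hL hφ₀ hφ₁]; exact ENNReal.ofReal_lt_top
  obtain ⟨R, A, hR, hA, hF⟩ := exists_flowLipschitz_of_lt_maxTime hs hL hφ₀ hφ₁ hT (hlt φ₁ hφ₁)
  obtain ⟨R', A', hR', hA', hF'⟩ :=
    exists_flowLipschitz_of_lt_maxTime hs hL hφ₀ hφ₁.neg hT (hlt _ hφ₁.neg)
  have hbound : Tendsto (fun n => ENNReal.ofReal (max A A') *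
      (dsin (s + 1) (φ₀n n) φ₀ + hNorm s (φ₁n n - φ₁))) atTop (𝓝 0) := by
    have := ENNReal.Tendsto.const_mul hlim (Or.inr (ENNReal.ofReal_ne_top (r := max A A')))
    rwa [mul_zero] at this
  refine tendsto_of_tendsto_of_tendsto_of_le_of_le' tendsto_const_nhds hbound
    (Eventually.of_forall fun _ => zero_le) ?_
  filter_upwards [hlim.eventually (gt_mem_nhds (ENNReal.ofReal_pos.mpr (lt_min hR hR')))] with n hδ
  refine iSup₂_le fun t ht => ?_
  rw [dsin_comm, hNorm_sub_comm] at hδ ⊢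
  rw [dsin_comm _ (φ₀n n), hNorm_sub_comm _ (φ₁n n)]
  rcases le_total 0 t with ht0 | ht0
  · have := (hF (φ₀n n) (φ₁n n) (hφ₀n n) (hφ₁n n) (hδ.trans_le
      (ENNReal.ofReal_le_ofReal (min_le_left _ _)))).2 φ ψ (φn n) (ψn n) (h.mono (subset_univ _))
      ((hn n).mono (subset_univ _)) t ⟨ht0, ht.2⟩
    refine this.trans ?_
    gcongr
    · exact le_max_left _ _
    · rfl
  · have e : hNorm s (-φ₁ - -φ₁n n) = hNorm s (φ₁ - φ₁n n) := by
      rw [neg_sub_neg, hNorm_sub_comm]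
    have := (hF' (φ₀n n) (-φ₁n n) (hφ₀n n) (hφ₁n n).neg (by
      rw [Nat.add_sub_cancel, e]
      exact hδ.trans_le (ENNReal.ofReal_le_ofReal (min_le_right _ _)))).2 _ _ _ _
      (h.reflect.mono (subset_univ _)) ((hn n).reflect.mono (subset_univ _)) (-t)
      ⟨neg_nonneg.mpr ht0, by linarith [ht.1]⟩
    simp only [neg_neg, Nat.add_sub_cancel, e] at this
    rw [neg_sub_neg, hNorm_sub_comm] at this
    refine this.trans ?_
    gcongr
    exact le_max_right _ _

end
end
end SineGordon

/-! ### Assembly of the theorem -/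

theorem mainTheorem6 (N : ℕ) (hN : 1 ≤ N) (σ : ℝ) (hσ : σ ≠ 0) :
    (∀ k : ℕ, (N : ℝ) / 2 + 1 < k →
      -- properties of the solution with given initial conditions
      (∀ φ₀ φ₁ : Space N → ℝ, MemHsin k φ₀ → MemH (k - 1) φ₁ →
        -- existence on `[0, T_max)`
        0 < maxTime σ k φ₀ φ₁ ∧
        (∃ φ ψ : ℝ → Space N → ℝ,
          IsSolution σ k (timeIco (maxTime σ k φ₀ φ₁)) φ₀ φ₁ φ ψ) ∧
        -- uniqueness on every interval `[0, T)`
        (∀ (T : ℝ≥0∞) (φ ψ φ' ψ' : ℝ → Space N → ℝ),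
          IsSolution σ k (timeIco T) φ₀ φ₁ φ ψ → IsSolution σ k (timeIco T) φ₀ φ₁ φ' ψ' →
          ∀ t ∈ timeIco T, φ t =ᵐ[volume] φ' t ∧ ψ t =ᵐ[volume] ψ' t) ∧
        -- characterization of the maximal time by blow-up
        (∀ (T : ℝ≥0∞) (φ ψ : ℝ → Space N → ℝ), 0 < T →
          IsSolution σ k (timeIco T) φ₀ φ₁ φ ψ →
          (T = maxTime σ k φ₀ φ₁ ↔ (T ≠ ⊤ →
            Tendsto (fun t => dsin k (φ t) 0 + hNorm (k - 1) (ψ t)) (𝓝[<] T.toReal) (𝓝 ⊤))) ∧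
          (T = maxTime σ k φ₀ φ₁ ↔ (T ≠ ⊤ →
            limsup (fun t => dsin k (φ t) 0) (𝓝[<] T.toReal) = ⊤))) ∧
        -- the flow is locally Lipschitz
        (∀ T : ℝ, 0 ≤ T → ENNReal.ofReal T < maxTime σ k φ₀ φ₁ →
          ∃ R A : ℝ, 0 < R ∧ 0 < A ∧ FlowLipschitz σ k T R A φ₀ φ₁) ∧
        -- persistence of regularity, and independence of `T_max` of `k`
        (MemHsin (k + 1) φ₀ → MemH k φ₁ →
          (∀ φ ψ : ℝ → Space N → ℝ,
            IsSolution σ k (timeIco (maxTime σ k φ₀ φ₁)) φ₀ φ₁ φ ψ →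
            IsSolution σ (k + 1) (timeIco (maxTime σ k φ₀ φ₁)) φ₀ φ₁ φ ψ ∧
            ∃ θ : ℝ → Space N → ℝ,
              HasTimeDeriv (k - 1) (timeIco (maxTime σ k φ₀ φ₁)) ψ θ ∧
              ContInH (k - 1) (timeIco (maxTime σ k φ₀ φ₁)) 0 θ) ∧
          maxTime σ (k + 1) φ₀ φ₁ = maxTime σ k φ₀ φ₁) ∧
        -- global existence in low dimension
        (N ≤ 3 → maxTime σ k φ₀ φ₁ = ⊤)) ∧
      -- dependence of the constants `R` and `A`:
      -- up to any time `T`, on `T` and on a bound for the solution on `[0, T]`;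
      (∀ T B : ℝ, 0 ≤ T → ∃ R A : ℝ, 0 < R ∧ 0 < A ∧
        ∀ φ₀ φ₁ : Space N → ℝ, MemHsin k φ₀ → MemH (k - 1) φ₁ →
          ENNReal.ofReal T < maxTime σ k φ₀ φ₁ →
          ∀ φ ψ : ℝ → Space N → ℝ,
            IsSolution σ k (timeIco (maxTime σ k φ₀ φ₁)) φ₀ φ₁ φ ψ →
            (∀ t ∈ Icc 0 T, dsin k (φ t) 0 + hNorm (k - 1) (ψ t) ≤ ENNReal.ofReal B) →
            FlowLipschitz σ k T R A φ₀ φ₁) ∧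
      -- up to a time `τ > 0` depending only on the norms of the initial conditions, on these norms;
      (∀ D M : ℝ, ∃ τ R A : ℝ, 0 < τ ∧ 0 < R ∧ 0 < A ∧
        ∀ φ₀ φ₁ : Space N → ℝ, MemHsin k φ₀ → MemH (k - 1) φ₁ →
          dsin k φ₀ 0 ≤ ENNReal.ofReal D → hNorm (k - 1) φ₁ ≤ ENNReal.ofReal M →
          ENNReal.ofReal τ < maxTime σ k φ₀ φ₁ ∧ FlowLipschitz σ k τ R A φ₀ φ₁) ∧
      -- up to any time `T`, on `T` and on these norms, when `N ≤ 3`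
      (N ≤ 3 → ∀ T D M : ℝ, 0 ≤ T → ∃ R A : ℝ, 0 < R ∧ 0 < A ∧
        ∀ φ₀ φ₁ : Space N → ℝ, MemHsin k φ₀ → MemH (k - 1) φ₁ →
          dsin k φ₀ 0 ≤ ENNReal.ofReal D → hNorm (k - 1) φ₁ ≤ ENNReal.ofReal M →
          FlowLipschitz σ k T R A φ₀ φ₁)) ∧
    -- the flow is well-defined on `ℝ` and continuous for `k = 2` when `N = 2` or `N = 3`
    (N = 2 ∨ N = 3 →
      (∀ φ₀ φ₁ : Space N → ℝ, MemHsin 2 φ₀ → MemH 1 φ₁ →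
        (∃ φ ψ : ℝ → Space N → ℝ, IsSolution σ 2 univ φ₀ φ₁ φ ψ) ∧
        (∀ φ ψ φ' ψ' : ℝ → Space N → ℝ,
          IsSolution σ 2 univ φ₀ φ₁ φ ψ → IsSolution σ 2 univ φ₀ φ₁ φ' ψ' →
          ∀ t, φ t =ᵐ[volume] φ' t ∧ ψ t =ᵐ[volume] ψ' t)) ∧
      (∀ (φ₀ φ₁ : Space N → ℝ) (φ₀n φ₁n : ℕ → Space N → ℝ)
        (φ ψ : ℝ → Space N → ℝ) (φn ψn : ℕ → ℝ → Space N → ℝ),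
        MemHsin 2 φ₀ → MemH 1 φ₁ → (∀ n, MemHsin 2 (φ₀n n)) → (∀ n, MemH 1 (φ₁n n)) →
        IsSolution σ 2 univ φ₀ φ₁ φ ψ →
        (∀ n, IsSolution σ 2 univ (φ₀n n) (φ₁n n) (φn n) (ψn n)) →
        Tendsto (fun n => dsin 2 (φ₀n n) φ₀ + hNorm 1 (φ₁n n - φ₁)) atTop (𝓝 0) →
        ∀ T : ℝ, Tendsto (fun n => ⨆ t ∈ Icc (-T) T,
          (dsin 2 (φn n t) (φ t) + hNorm 1 (ψn n t - ψ t))) atTop (𝓝 0))) := by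
  refine ⟨fun k hk => ?_, fun hN' => ?_⟩
  -- With `k = s + 1`, the condition `k > N/2 + 1` reads `N < 2 * s`.
  · obtain ⟨s, rfl⟩ : ∃ s, k = s + 1 := by
      refine ⟨k - 1, ?_⟩
      rcases k with - | k
      · have : (0 : ℝ) ≤ N := Nat.cast_nonneg N
        norm_num at hk
        linarith
      · simp
    have hs : N < 2 * s := by
      push_cast at hk
      have : (N : ℝ) < 2 * s := by linarith
      exact_mod_cast this
    have hs1 : 1 ≤ s := by omega
    have hL := lipschitzSin_of_lt hs
    simp only [Nat.add_sub_cancel]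
    refine ⟨fun φ₀ φ₁ hφ₀ hφ₁ => ?_, fun T B hT => exists_flowLipschitz_of_bound σ hs1 hL hT B,
      exists_flowLipschitz_local σ hs1 hL,
      fun hN3 T D M hT => exists_flowLipschitz_of_le_three hN3 σ hs1 hL hT D M⟩
    have hpos := maxTime_pos (σ := σ) hs1 hL hφ₀ hφ₁
    refine ⟨hpos, exists_maximal hs1 hL hφ₀ hpos, fun T φ ψ φ' ψ' h h' t ht =>
      h.unique hs1 hL hφ₀ h' ht.1 (Icc_subset_timeIco ht.2) (Icc_subset_timeIco ht.2),
      fun T φ ψ hT h => blowup_iff hs1 hL hφ₀ hT h,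
      fun T hT hlt => exists_flowLipschitz_of_lt_maxTime hs1 hL hφ₀ hφ₁ hT hlt,
      fun hφ₀' hφ₁' => ⟨fun φ ψ h => ?_, maxTime_succ hs hs1 hφ₀' hφ₁'⟩,
      fun hN3 => maxTime_eq_top hN3 hs1 hL hφ₀ hφ₁⟩
    have h' := h.succ hs hs1 hφ₀' hφ₁'
    exact ⟨h', h'.exists_second_deriv hs1 (lipschitzSin_of_lt (by omega)) hφ₀' (convex_timeIco _)⟩
  · have hN3 : N ≤ 3 := by omega
    -- For `k = 2` and `N = 2` or `3`, `N < 2 * s` fails with `s = 1`, and the low-dimensional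
    -- Lipschitz estimate takes over.
    have hL := lipschitzSin_one hN3
    exact ⟨fun φ₀ φ₁ hφ₀ hφ₁ => ⟨exists_isSolution_univ hN3 le_rfl hL hφ₀ hφ₁,
      fun φ ψ φ' ψ' h h' t => h.unique_univ le_rfl hL hφ₀ h' t⟩,
      fun φ₀ φ₁ φ₀n φ₁n φ ψ φn ψn hφ₀ hφ₁ hφ₀n hφ₁n h hn hlim T =>
        tendsto_flow hN3 le_rfl hL hφ₀ hφ₁ hφ₀n hφ₁n h hn hlim T⟩
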